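/- **Fair Max-Min diversification.** An instance consists of a universe $\mathcal U$ of $n$ elements with a pseudometric $d:\mathcal U\times\mathcal U\to\mathbb R_{\ge 0}$ (that is, $d(u,u)=0$, $d(u,v)=d(v,u)$ and $d(u,v)\le d(u,w)+d(w,v)$), a partition of $\mathcal U$ into $m$ pairwise disjoint classes $\mathcal U_1,\dots,\mathcal U_m$, and non-negative integers $k_1,\dots,k_m$ with $k_i\le|\mathcal U_i|$; put $k=\sum_i k_i$. A set $\mathcal S\subseteq\mathcal U$ is *fair* if $|\mathcal S\cap\mathcal U_i|=k_i$ for all $i$. Its diversity is $\operatorname{div}(\mathcal S)=\min_{u,v\in\mathcal S,\,u\ne v}d(u,v)$ (read as $\infty$ if $|\mathcal S|\le 1$), and $\ell^*_{\mathrm{fair}}$ is the maximum of $\operatorname{div}(\mathcal S)$ over all fair sets $\mathcal S$. **Theorem.** There is a $\tfrac1{3m-1}$-approximation algorithm for this problem that runs in time $O(kn+k^2m^2\log(km))$. Precisely: there are a single deterministic real-RAM program and a constant $C$ such that, for all $n$, $m$ and every instance, the program terminates and outputs a fair set $\mathcal S$ with $$\operatorname{div}(\mathcal S)\ \ge\ \frac{\ell^*_{\mathrm{fair}}}{3m-1},$$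 and, if $k\ge 1$, it makes at most $C\,\bigl(kn+k^2m^2\log(km)\bigr)$ steps. Here the program works on arrays of natural numbers and of reals, initially zero; a step is an assignment or a test, built from a bounded number of elementary operations: array accesses, addition, (truncated) subtraction and comparison of natural numbers, field operations and comparison of reals, conversion of a natural number to a real, and reading from the input $n$, $m$, some $k_i$, the class of an element, or the distance of two elements. -/

import Mathlib

open scoped ENNReal

noncomputable section

namespace FairDiv

/-! ### The problem -/

/-- An instance of Fair Max-Min diversification: a universe of `n` elements (named `0, …, n-1`)
with a pseudometric, a partition of the universe into `m` classes (given by the class, or colour,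
of each element), and a non-negative integer for each class. -/
structure Instance (n m : ℕ) where
  dist : Fin n → Fin n → ℝ
  dist_nonneg : ∀ u v, 0 ≤ dist u v
  dist_self : ∀ u, dist u u = 0
  dist_comm : ∀ u v, dist u v = dist v u
  dist_triangle : ∀ u v w, dist u v ≤ dist u w + dist w v
  color : Fin n → Fin m
  quota : Fin m → ℕ

namespace Instance

variable {n m : ℕ} (I : Instance n m)

/-- The class `U_i`. -/
def group (i : Fin m) : Finset (Fin n) := Finset.univ.filter fun u => I.color u = i

/-- `k = k_1 + ⋯ + k_m`. -/
def k : ℕ := ∑ i, I.quota i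

/-- The fairness constraints: `|S ∩ U_i| = k_i` for all `i`. -/
def IsFair (S : Finset (Fin n)) : Prop := ∀ i, (S ∩ I.group i).card = I.quota i

/-- `div(S)`, the minimum distance between two distinct elements of `S`
(`∞` if there are no two distinct elements). -/
def div (S : Finset (Fin n)) : ℝ≥0∞ :=
  ⨅ u ∈ S, ⨅ v ∈ S, ⨅ _ : u ≠ v, ENNReal.ofReal (I.dist u v)

/-- The optimum fair diversity. -/
def opt : ℝ≥0∞ := ⨆ S : Finset (Fin n), ⨆ _ : I.IsFair S, I.div S

end Instance

/-! ### The machine model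

A real RAM in structured form. The memory consists of arrays of natural numbers and arrays of
real numbers, named by natural numbers and indexed by natural numbers; a scalar variable is an
array used at the single index `0`. Natural numbers can be added, subtracted and compared; real
numbers can be added, subtracted, multiplied, divided and compared; a natural number can be
converted to a real number but not conversely. A program has no real constants. The instance is
read-only; reading a colour, a fairness constraint or a distance is an elementary operation. -/

/-- Expressions of natural number type. -/
inductive NExp : Type
  | lit (c : ℕ)
  /-- entry `i` of the array `a` of natural numbers -/
  | get (a : ℕ) (i : NExp)
  | add (x y : NExp)
  /-- truncated subtraction -/
  | sub (x y : NExp)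
  /-- the number `n` of elements -/
  | numElems
  /-- the number `m` of classes -/
  | numClasses
  /-- the colour of an element -/
  | color (u : NExp)
  /-- the fairness constraint of a class -/
  | quota (i : NExp)

/-- Expressions of real type. -/
inductive RExp : Type
  /-- entry `i` of the array `a` of reals -/
  | get (a : ℕ) (i : NExp)
  | ofNat (x : NExp)
  | add (x y : RExp)
  | sub (x y : RExp)
  | mul (x y : RExp)
  | div (x y : RExp)
  /-- the distance of two elements -/
  | dist (u v : NExp)

/-- Tests. -/
inductive BExp : Type
  | nlt (x y : NExp)
  | rlt (x y : RExp)
  | not (b : BExp)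
  | and (b c : BExp)

/-- Programs. -/
inductive Prog : Type
  | skip
  /-- write `x` to entry `i` of the array `a` of natural numbers -/
  | nset (a : ℕ) (i x : NExp)
  /-- write `x` to entry `i` of the array `a` of reals -/
  | rset (a : ℕ) (i : NExp) (x : RExp)
  | seq (p q : Prog)
  | ite (b : BExp) (p q : Prog)
  | loop (b : BExp) (p : Prog)

/-- The contents of the memory. -/
structure Store where
  nat : ℕ → ℕ → ℕ
  real : ℕ → ℕ → ℝ

namespace Store

/-- All memory cells contain `0` at the start. -/
def init : Store := ⟨fun _ _ => 0, fun _ _ => 0⟩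

/-- Overwrite one natural number. -/
def setNat (s : Store) (a i x : ℕ) : Store :=
  { s with nat := Function.update s.nat a (Function.update (s.nat a) i x) }

/-- Overwrite one real number. -/
def setReal (s : Store) (a i : ℕ) (x : ℝ) : Store :=
  { s with real := Function.update s.real a (Function.update (s.real a) i x) }

/-- The set that a final memory represents: array `0` of natural numbers holds its
characteristic vector. -/
def output (s : Store) (n : ℕ) : Finset (Fin n) :=
  Finset.univ.filter fun u => s.nat 0 u = 1

end Store

section Semantics

variable {n m : ℕ} (I : Instance n m)

/-- Value of an expression of natural number type; reading the input out of range gives `0`. -/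
def NExp.eval (s : Store) : NExp → ℕ
  | .lit c => c
  | .get a i => s.nat a (i.eval s)
  | .add x y => x.eval s + y.eval s
  | .sub x y => x.eval s - y.eval s
  | .numElems => n
  | .numClasses => m
  | .color u => if h : u.eval s < n then (I.color ⟨u.eval s, h⟩ : ℕ) else 0
  | .quota i => if h : i.eval s < m then I.quota ⟨i.eval s, h⟩ else 0

/-- Value of an expression of real type; reading the input out of range gives `0`. -/
def RExp.eval (s : Store) : RExp → ℝ
  | .get a i => s.real a (i.eval I s)
  | .ofNat x => (x.eval I s : ℝ)
  | .add x y => x.eval s + y.eval s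
  | .sub x y => x.eval s - y.eval s
  | .mul x y => x.eval s * y.eval s
  | .div x y => x.eval s / y.eval s
  | .dist u v =>
      if h : u.eval I s < n ∧ v.eval I s < n then
        I.dist ⟨u.eval I s, h.1⟩ ⟨v.eval I s, h.2⟩
      else 0

/-- Truth of a test. -/
def BExp.Holds (s : Store) : BExp → Prop
  | .nlt x y => x.eval I s < y.eval I s
  | .rlt x y => x.eval I s < y.eval I s
  | .not b => ¬ b.Holds s
  | .and b c => b.Holds s ∧ c.Holds s

/-- `Runs I p s s' t`: on the instance `I`, the program `p` started with memory `s` terminates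
with memory `s'` after `t` steps. Each executed assignment, each evaluated test and each `skip`
counts as one step; an expression in a fixed program consists of a fixed number of elementary
operations, so `t` is the number of elementary operations up to a factor that depends on the
program only. -/
inductive Runs : Prog → Store → Store → ℕ → Prop
  | skip (s : Store) : Runs .skip s s 1
  | nset (a : ℕ) (i x : NExp) (s : Store) :
      Runs (.nset a i x) s (s.setNat a (i.eval I s) (x.eval I s)) 1
  | rset (a : ℕ) (i : NExp) (x : RExp) (s : Store) :
      Runs (.rset a i x) s (s.setReal a (i.eval I s) (x.eval I s)) 1
  | seq {p q : Prog} {s s' s'' : Store} {t t' : ℕ} :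
      Runs p s s' t → Runs q s' s'' t' → Runs (.seq p q) s s'' (t + t')
  | ite_true {b : BExp} {p q : Prog} {s s' : Store} {t : ℕ} :
      b.Holds I s → Runs p s s' t → Runs (.ite b p q) s s' (t + 1)
  | ite_false {b : BExp} {p q : Prog} {s s' : Store} {t : ℕ} :
      ¬ b.Holds I s → Runs q s s' t → Runs (.ite b p q) s s' (t + 1)
  | loop_done {b : BExp} {p : Prog} {s : Store} :
      ¬ b.Holds I s → Runs (.loop b p) s s 1
  | loop_step {b : BExp} {p : Prog} {s s' s'' : Store} {t t' : ℕ} :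
      b.Holds I s → Runs p s s' t → Runs (.loop b p) s' s'' t' →
      Runs (.loop b p) s s'' (t + t' + 1)

/-- Programs are deterministic: final memory and number of steps are unique. -/
theorem Runs.unique {p : Prog} {s s₁ s₂ : Store} {t₁ t₂ : ℕ}
    (h₁ : Runs I p s s₁ t₁) (h₂ : Runs I p s s₂ t₂) : s₁ = s₂ ∧ t₁ = t₂ := by
  induction h₁ generalizing s₂ t₂ with
  | skip => cases h₂; exact ⟨rfl, rfl⟩
  | nset => cases h₂; exact ⟨rfl, rfl⟩
  | rset => cases h₂; exact ⟨rfl, rfl⟩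
  | seq _ _ ihp ihq =>
    cases h₂ with
    | seq hp hq =>
      obtain ⟨rfl, rfl⟩ := ihp hp
      obtain ⟨rfl, rfl⟩ := ihq hq
      exact ⟨rfl, rfl⟩
  | ite_true hb _ ih =>
    cases h₂ with
    | ite_true _ hp => obtain ⟨rfl, rfl⟩ := ih hp; exact ⟨rfl, rfl⟩
    | ite_false hb' _ => exact absurd hb hb'
  | ite_false hb _ ih =>
    cases h₂ with
    | ite_true hb' _ => exact absurd hb' hb
    | ite_false _ hq => obtain ⟨rfl, rfl⟩ := ih hq; exact ⟨rfl, rfl⟩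
  | loop_done hb =>
    cases h₂ with
    | loop_done _ => exact ⟨rfl, rfl⟩
    | loop_step hb' _ _ => exact absurd hb' hb
  | loop_step hb _ _ ihp ihl =>
    cases h₂ with
    | loop_done hb' => exact absurd hb hb'
    | loop_step _ hp hl =>
      obtain ⟨rfl, rfl⟩ := ihp hp
      obtain ⟨rfl, rfl⟩ := ihl hl
      exact ⟨rfl, rfl⟩

end Semantics

end FairDiv

end

/-!
In each class choose up to `k` points by farthest point sampling, and call the distance of a point
to the earlier points of its class its radius (a large number for the first point). For a threshold
`t > 0` let `Y` be the set of points with radius at least `m t`, and join two points of `Y` at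
distance less than `t`. Points of `Y` in the same class are at least `m t` apart, so a path that
returned to the class in which it started could not consist of `m` or fewer of these edges. Hence a
path visits each class at most once, it has fewer than `m` edges, and each component has diameter at
most `(m - 1) t`.

Points in different components have distance at least `t`, so if the components can be assigned to
the classes with `k i` components for the class `i`, each component through one of its points of
class `i`, then these points form a fair set of diversity at least `t`. Conversely, let `S` be a
fair set of diversity at least `(3 m - 1) t`. If `Y` contains `k` points of a class, these lie in
`k` different components. Otherwise each element of the class is closer than `m t` to a point of `Y`
of the class; as `(3 m - 1) t = 2 m t + (m - 1) t`, different elements of `S` are close to points in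
different components. So Hall's condition for the assignment is satisfied. The assignment is
computed with augmenting paths.

It remains to find a reachable threshold such that thresholds slightly above it are not reachable.
The set `Y` changes only at the values `rad p / m`. While `Y` is fixed, its components change only
at the keys of Prim's algorithm, because a component is an interval in the order in which this
algorithm visits the points. So two binary searches among at most `k m` candidates each suffice.
They make `O(log (k m))` tests, of cost `O(k² m²)` each, and the sampling costs `O(k n)`.
-/

namespace FairDiv

/-! ### The input as functions of natural numbers -/

namespace Instance

variable {n m : ℕ} (I : Instance n m)

/-- The distance as the machine reads it: a function of natural numbers, `0` out of range. Because
of this junk value the triangle inequality needs the middle point to be in range. -/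
noncomputable def d (u v : ℕ) : ℝ := if h : u < n ∧ v < n then I.dist ⟨u, h.1⟩ ⟨v, h.2⟩ else 0

/-- The colour as the machine reads it: a function of natural numbers, `0` out of range. -/
def col (u : ℕ) : ℕ := if h : u < n then (I.color ⟨u, h⟩ : ℕ) else 0

/-- The quota as the machine reads it: a function of natural numbers, `0` out of range. -/
def quo (i : ℕ) : ℕ := if h : i < m then I.quota ⟨i, h⟩ else 0

theorem d_nonneg (u v : ℕ) : 0 ≤ I.d u v := by
  unfold d
  split_ifs
  · exact I.dist_nonneg _ _
  · exact le_rfl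

theorem d_self (u : ℕ) : I.d u u = 0 := by
  unfold d
  split_ifs
  · exact I.dist_self _
  · rfl

theorem d_comm (u v : ℕ) : I.d u v = I.d v u := by
  unfold d
  by_cases h : u < n ∧ v < n
  · rw [dif_pos h, dif_pos h.symm, I.dist_comm]
  · rw [dif_neg h, dif_neg fun h' => h h'.symm]

theorem d_triangle {w : ℕ} (hw : w < n) (u v : ℕ) : I.d u v ≤ I.d u w + I.d w v := by
  by_cases h : u < n ∧ v < n
  · simpa only [d, h.1, h.2, hw, and_self, dif_pos] using I.dist_triangle _ _ _
  · rw [d, dif_neg h]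
    exact add_nonneg (I.d_nonneg _ _) (I.d_nonneg _ _)

theorem d_coe (u v : Fin n) : I.d u v = I.dist u v := by simp [d]

theorem col_coe (u : Fin n) : I.col u = I.color u := by simp [col]

theorem quo_coe (i : Fin m) : I.quo i = I.quota i := by simp [quo]

theorem col_lt {u : ℕ} (h : u < n) : I.col u < m := by
  rw [col, dif_pos h]
  exact (I.color ⟨u, h⟩).2

theorem sum_quo : ∑ i ∈ Finset.range m, I.quo i = I.k := by
  simp [Finset.sum_range, quo, k]

theorem quo_le_k {i : ℕ} (hi : i < m) : I.quo i ≤ I.k := by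
  rw [← I.sum_quo]
  exact Finset.single_le_sum_of_canonicallyOrdered (Finset.mem_range.2 hi)

end Instance

/-! ### Reasoning about programs -/

namespace Store

variable (s : Store)

@[simp] theorem nat_setNat_self (a i x : ℕ) :
    (s.setNat a i x).nat a = Function.update (s.nat a) i x := by simp [setNat]

@[simp] theorem nat_setNat_of_ne {a b : ℕ} (h : b ≠ a) (i x : ℕ) :
    (s.setNat a i x).nat b = s.nat b := by simp [setNat, h]

@[simp] theorem real_setNat (a i x : ℕ) : (s.setNat a i x).real = s.real := rfl

@[simp] theorem real_setReal_self (a i : ℕ) (x : ℝ) :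
    (s.setReal a i x).real a = Function.update (s.real a) i x := by simp [setReal]

@[simp] theorem real_setReal_of_ne {a b : ℕ} (h : b ≠ a) (i : ℕ) (x : ℝ) :
    (s.setReal a i x).real b = s.real b := by simp [setReal, h]

@[simp] theorem nat_setReal (a i : ℕ) (x : ℝ) : (s.setReal a i x).nat = s.nat := rfl

end Store

section Eval

variable {n m : ℕ} (I : Instance n m) (s : Store)

@[simp] theorem NExp.eval_lit (c : ℕ) : (NExp.lit c).eval I s = c := rfl

@[simp] theorem NExp.eval_get (a : ℕ) (i : NExp) :
    (NExp.get a i).eval I s = s.nat a (i.eval I s) := rfl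

@[simp] theorem NExp.eval_add (x y : NExp) :
    (NExp.add x y).eval I s = x.eval I s + y.eval I s := rfl

@[simp] theorem NExp.eval_sub (x y : NExp) :
    (NExp.sub x y).eval I s = x.eval I s - y.eval I s := rfl

@[simp] theorem NExp.eval_numClasses : NExp.numClasses.eval I s = m := rfl

@[simp] theorem NExp.eval_color (u : NExp) : (NExp.color u).eval I s = I.col (u.eval I s) := rfl

@[simp] theorem NExp.eval_quota (i : NExp) : (NExp.quota i).eval I s = I.quo (i.eval I s) := rfl

@[simp] theorem RExp.eval_get (a : ℕ) (i : NExp) :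
    (RExp.get a i).eval I s = s.real a (i.eval I s) := rfl

@[simp] theorem RExp.eval_ofNat (x : NExp) : (RExp.ofNat x).eval I s = (x.eval I s : ℝ) := rfl

@[simp] theorem RExp.eval_add (x y : RExp) :
    (RExp.add x y).eval I s = x.eval I s + y.eval I s := rfl

@[simp] theorem RExp.eval_sub (x y : RExp) :
    (RExp.sub x y).eval I s = x.eval I s - y.eval I s := rfl

@[simp] theorem RExp.eval_mul (x y : RExp) :
    (RExp.mul x y).eval I s = x.eval I s * y.eval I s := rfl

@[simp] theorem RExp.eval_div (x y : RExp) :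
    (RExp.div x y).eval I s = x.eval I s / y.eval I s := rfl

@[simp] theorem RExp.eval_dist (u v : NExp) :
    (RExp.dist u v).eval I s = I.d (u.eval I s) (v.eval I s) := rfl

@[simp] theorem BExp.holds_nlt (x y : NExp) :
    (BExp.nlt x y).Holds I s ↔ x.eval I s < y.eval I s := Iff.rfl

@[simp] theorem BExp.holds_rlt (x y : RExp) :
    (BExp.rlt x y).Holds I s ↔ x.eval I s < y.eval I s := Iff.rfl

@[simp] theorem BExp.holds_not (b : BExp) : (BExp.not b).Holds I s ↔ ¬ b.Holds I s := Iff.rfl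

@[simp] theorem BExp.holds_and (b c : BExp) :
    (BExp.and b c).Holds I s ↔ b.Holds I s ∧ c.Holds I s := Iff.rfl

end Eval

/-- The arrays of natural numbers that a program may write to. -/
def Prog.natWrites : Prog → List ℕ
  | .skip => []
  | .nset a _ _ => [a]
  | .rset _ _ _ => []
  | .seq p q => p.natWrites ++ q.natWrites
  | .ite _ p q => p.natWrites ++ q.natWrites
  | .loop _ p => p.natWrites

/-- The arrays of reals that a program may write to. -/
def Prog.realWrites : Prog → List ℕ
  | .skip => []
  | .nset _ _ _ => []
  | .rset a _ _ => [a]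
  | .seq p q => p.realWrites ++ q.realWrites
  | .ite _ p q => p.realWrites ++ q.realWrites
  | .loop _ p => p.realWrites

/-- Two memories differ only on the arrays that `p` may write to. -/
structure Frame (p : Prog) (s s' : Store) : Prop where
  nat : ∀ (a : ℕ) (_ : a ∉ p.natWrites := by decide), s'.nat a = s.nat a
  real : ∀ (a : ℕ) (_ : a ∉ p.realWrites := by decide), s'.real a = s.real a

theorem Frame.refl (p : Prog) (s : Store) : Frame p s s := ⟨fun _ _ => rfl, fun _ _ => rfl⟩

theorem Frame.trans {p : Prog} {s s' s'' : Store} (h : Frame p s s') (h' : Frame p s' s'') :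
    Frame p s s'' :=
  ⟨fun a ha => (h'.nat a ha).trans (h.nat a ha), fun a ha => (h'.real a ha).trans (h.real a ha)⟩

theorem Frame.mono {p q : Prog} {s s' : Store} (h : Frame p s s')
    (hn : p.natWrites ⊆ q.natWrites) (hr : p.realWrites ⊆ q.realWrites) : Frame q s s' :=
  ⟨fun a ha => h.nat a fun h' => ha (hn h'), fun a ha => h.real a fun h' => ha (hr h')⟩

theorem Frame.real_eq {p : Prog} {s s' : Store} (h : Frame p s s')
    (hp : p.realWrites = [] := by decide) : s'.real = s.real :=
  funext fun a => h.real a (by simp [hp])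

theorem Frame.setNat (a : ℕ) (i x : NExp) (s : Store) (j y : ℕ) :
    Frame (.nset a i x) s (s.setNat a j y) :=
  ⟨fun _ hb => Store.nat_setNat_of_ne _ (fun h => hb (List.mem_singleton.2 h)) _ _, fun _ _ => rfl⟩

theorem Frame.setReal (a : ℕ) (i : NExp) (x : RExp) (s : Store) (j : ℕ) (y : ℝ) :
    Frame (.rset a i x) s (s.setReal a j y) :=
  ⟨fun _ _ => rfl,
    fun _ hb => Store.real_setReal_of_ne _ (fun h => hb (List.mem_singleton.2 h)) _ _⟩

section Rules

variable {n m : ℕ} {I : Instance n m}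

theorem Runs.frame {p : Prog} {s s' : Store} {t : ℕ} (h : Runs I p s s' t) : Frame p s s' := by
  induction h with
  | skip s => exact Frame.refl _ _
  | nset a i x s => exact Frame.setNat _ _ _ _ _ _
  | rset a i x s => exact Frame.setReal _ _ _ _ _ _
  | seq _ _ ihp ihq =>
    exact (ihp.mono (List.subset_append_left _ _) (List.subset_append_left _ _)).trans
      (ihq.mono (List.subset_append_right _ _) (List.subset_append_right _ _))
  | ite_true _ _ ih => exact ih.mono (List.subset_append_left _ _) (List.subset_append_left _ _)
  | ite_false _ _ ih =>
    exact ih.mono (List.subset_append_right _ _) (List.subset_append_right _ _)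
  | loop_done _ => exact Frame.refl _ _
  | loop_step _ _ _ ihp ihl =>
    exact Frame.trans (ihp.mono (List.Subset.refl _) (List.Subset.refl _)) ihl

/-- The total-correctness triple with a time bound: started with memory `s`, the program `p`
terminates within `T` steps with a memory satisfying `Q`. -/
def Does (I : Instance n m) (p : Prog) (s : Store) (T : ℕ) (Q : Store → Prop) : Prop :=
  ∃ s' t, Runs I p s s' t ∧ t ≤ T ∧ Q s'

variable {p q : Prog} {s : Store} {T T₁ T₂ : ℕ} {Q R : Store → Prop}

theorem Does.mono (h : Does I p s T₁ R) (hT : T₁ ≤ T) (hQ : ∀ s', Frame p s s' → R s' → Q s') :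
    Does I p s T Q := by
  obtain ⟨s', t, hr, ht, hR⟩ := h
  exact ⟨s', t, hr, ht.trans hT, hQ s' hr.frame hR⟩

theorem Does.le (h : Does I p s T₁ Q) (hT : T₁ ≤ T) : Does I p s T Q :=
  h.mono hT fun _ _ h => h

theorem Does.seq (hp : Does I p s T₁ R)
    (hq : ∀ s', Frame p s s' → R s' → Does I q s' T₂ Q) : Does I (.seq p q) s (T₁ + T₂) Q := by
  obtain ⟨s', t, hr, ht, hR⟩ := hp
  obtain ⟨s'', t', hr', ht', hQ⟩ := hq s' hr.frame hR
  exact ⟨s'', t + t', hr.seq hr', add_le_add ht ht', hQ⟩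

theorem Does.ite {b : BExp} (hp : b.Holds I s → Does I p s T Q)
    (hq : ¬ b.Holds I s → Does I q s T Q) : Does I (.ite b p q) s (T + 1) Q := by
  by_cases hb : b.Holds I s
  · obtain ⟨s', t, hr, ht, hQ⟩ := hp hb
    exact ⟨s', t + 1, hr.ite_true hb, by omega, hQ⟩
  · obtain ⟨s', t, hr, ht, hQ⟩ := hq hb
    exact ⟨s', t + 1, hr.ite_false hb, by omega, hQ⟩

/-- The weakest precondition of a loop-free program; loops get the junk value `False`. -/
def Prog.wp (I : Instance n m) : Prog → (Store → Prop) → Store → Prop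
  | .skip, Q, s => Q s
  | .nset a i x, Q, s => Q (s.setNat a (i.eval I s) (x.eval I s))
  | .rset a i x, Q, s => Q (s.setReal a (i.eval I s) (x.eval I s))
  | .seq p q, Q, s => p.wp I (q.wp I Q) s
  | .ite b p q, Q, s => (b.Holds I s → p.wp I Q s) ∧ (¬ b.Holds I s → q.wp I Q s)
  | .loop _ _, _, _ => False

/-- A bound for the number of steps of a loop-free program; loops get the junk value `0`. -/
def Prog.cost : Prog → ℕ
  | .skip => 1
  | .nset _ _ _ => 1
  | .rset _ _ _ => 1
  | .seq p q => p.cost + q.cost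
  | .ite _ p q => p.cost + q.cost + 1
  | .loop _ _ => 0

theorem Does.of_wp (h : p.wp I Q s) (hT : p.cost ≤ T := by decide) : Does I p s T Q := by
  suffices H : Does I p s p.cost Q from H.le hT
  clear hT
  induction p generalizing s Q with
  | skip => exact ⟨_, _, .skip s, le_rfl, h⟩
  | nset a i x => exact ⟨_, _, .nset a i x s, le_rfl, h⟩
  | rset a i x => exact ⟨_, _, .rset a i x s, le_rfl, h⟩
  | seq p q ihp ihq => exact (ihp h).seq fun s' _ h' => ihq h'
  | ite b p q ihp ihq =>
    exact Does.ite (T := p.cost + q.cost) (fun hb => (ihp (h.1 hb)).le (by omega))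
      (fun hb => (ihq (h.2 hb)).le (by omega))
  | loop b p => exact h.elim

theorem Does.while {b : BExp} (Inv : Store → Prop) (V : Store → ℕ) (h0 : Inv s)
    (hstep : ∀ s', Frame p s s' → Inv s' → b.Holds I s' →
      Does I p s' T fun s'' => Inv s'' ∧ V s'' < V s')
    (hQ : ∀ s', Frame p s s' → Inv s' → ¬ b.Holds I s' → Q s') :
    Does I (.loop b p) s (V s * (T + 1) + 1) Q := by
  suffices H : ∀ v s', V s' ≤ v → Frame p s s' → Inv s' →
      Does I (.loop b p) s' (v * (T + 1) + 1) Q from H _ s le_rfl (Frame.refl _ _) h0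
  intro v
  induction v with
  | zero =>
    intro s' hv hf hi
    by_cases hb : b.Holds I s'
    · obtain ⟨_, _, _, _, _, h⟩ := hstep s' hf hi hb
      omega
    · exact ⟨s', 1, .loop_done hb, by omega, hQ s' hf hi hb⟩
  | succ v ih =>
    intro s' hv hf hi
    by_cases hb : b.Holds I s'
    · obtain ⟨s₁, t₁, hr₁, ht₁, hi₁, hv₁⟩ := hstep s' hf hi hb
      obtain ⟨s₂, t₂, hr₂, ht₂, hq⟩ := ih s₁ (by omega) (hf.trans hr₁.frame) hi₁
      exact ⟨s₂, _, .loop_step hb hr₁ hr₂, by rw [Nat.succ_mul]; omega, hq⟩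
    · exact ⟨s', 1, .loop_done hb, by omega, hQ s' hf hi hb⟩

/-- A scalar variable of natural number type. -/
abbrev NExp.var (a : ℕ) : NExp := .get a (.lit 0)

/-- A scalar variable of real type. -/
abbrev RExp.var (a : ℕ) : RExp := .get a (.lit 0)

/-- Assignment to a scalar variable of natural number type. -/
abbrev Prog.nass (a : ℕ) (x : NExp) : Prog := .nset a (.lit 0) x

/-- Assignment to a scalar variable of real type. -/
abbrev Prog.rass (a : ℕ) (x : RExp) : Prog := .rset a (.lit 0) x

/-- Sequential composition of a list of programs. -/
def Prog.block : List Prog → Prog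
  | [] => .skip
  | [p] => p
  | p :: q :: l => .seq p (Prog.block (q :: l))

theorem Does.nass (a : ℕ) (x : NExp) :
    Does I (.nass a x) s 1 fun s' => s' = s.setNat a 0 (x.eval I s) :=
  Does.of_wp rfl le_rfl

theorem Does.rass (a : ℕ) (x : RExp) :
    Does I (.rass a x) s 1 fun s' => s' = s.setReal a 0 (x.eval I s) :=
  Does.of_wp rfl le_rfl

/-- Increment of a scalar variable. -/
abbrev Prog.incr (v : ℕ) : Prog := .nass v (.add (.var v) (.lit 1))

/-- The counting loop `for v < e do p`; the bound `e` is evaluated again before each round. -/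
def Prog.for (v : ℕ) (e : NExp) (p : Prog) : Prog :=
  .seq (.nass v (.lit 0)) (.loop (.nlt (.var v) e) (.seq p (.incr v)))

theorem Frame.of_for_body {v : ℕ} {e : NExp} {s' : Store}
    (h : Frame (.seq p (.incr v)) (s.setNat v 0 0) s') : Frame (.for v e p) s s' :=
  ((Frame.setNat v (.lit 0) (.lit 0) s 0 0).mono (List.subset_append_left _ _)
    (List.subset_append_left _ _)).trans
    (h.mono (List.subset_append_right _ _) (List.subset_append_right _ _))

theorem Does.seq_incr {v j : ℕ} {Inv : ℕ → Store → Prop} (hv : v ∉ p.natWrites)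
    (hInv : ∀ j s x, Inv j s → Inv j (s.setNat v 0 x)) (hj : s.nat v 0 = j)
    (hp : Does I p s T (Inv (j + 1))) :
    Does I (.seq p (.incr v)) s (T + 1) fun s' => s'.nat v 0 = j + 1 ∧ Inv (j + 1) s' := by
  refine hp.seq fun s' hf hi => Does.of_wp ?_ le_rfl
  have hj' : s'.nat v 0 = j := by rw [hf.nat v hv, hj]
  exact ⟨by simp [hj'], hInv _ _ _ hi⟩

theorem Does.for {v : ℕ} {e : NExp} {N : ℕ} (Inv : ℕ → Store → Prop)
    (hN : ∀ s', Frame (.for v e p) s s' → e.eval I s' = N)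
    (h0 : Inv 0 s)
    (hstep : ∀ j < N, ∀ s', Frame (.for v e p) s s' → s'.nat v 0 = j → Inv j s' →
      Does I p s' T (Inv (j + 1)))
    (hQ : ∀ s', Frame (.for v e p) s s' → Inv N s' → Q s')
    (hv : v ∉ p.natWrites := by decide)
    (hInv : ∀ j s x, Inv j s → Inv j (s.setNat v 0 x) := by intro j s x h; simpa using h) :
    Does I (.for v e p) s (N * (T + 2) + 2) Q := by
  refine ((Does.nass v (.lit 0)).seq (T₂ := N * (T + 2) + 1) (Q := Q) ?_).le (by omega)
  rintro _ - rfl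
  refine (Does.while (T := T + 1) (fun s' => s'.nat v 0 ≤ N ∧ Inv (s'.nat v 0) s')
    (fun s' => N - s'.nat v 0) ⟨by simp, by simpa using hInv 0 s 0 h0⟩ ?_ ?_).le (by simp)
  · rintro s' hf ⟨-, hi⟩ hb
    have hlt : s'.nat v 0 < N := hN s' (.of_for_body hf) ▸ hb
    refine (Does.seq_incr hv hInv rfl (hstep _ hlt s' (.of_for_body hf) rfl hi)).mono le_rfl ?_
    rintro s'' - ⟨hj, hi'⟩
    exact ⟨⟨by omega, hj ▸ hi'⟩, by omega⟩
  · rintro s' hf ⟨hle, hi⟩ hb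
    have hge : N ≤ s'.nat v 0 := hN s' (.of_for_body hf) ▸ not_lt.1 hb
    exact hQ s' (.of_for_body hf) (le_antisymm hle hge ▸ hi)

theorem Does.for_var {v a : ℕ} (Inv : ℕ → Store → Prop)
    (h0 : Inv 0 s)
    (hstep : ∀ j < s.nat a 0, ∀ s', Frame (.for v (.var a) p) s s' → s'.nat v 0 = j → Inv j s' →
      Does I p s' T (Inv (j + 1)))
    (hQ : ∀ s', Frame (.for v (.var a) p) s s' → Inv (s.nat a 0) s' → Q s')
    (ha : a ∉ (Prog.for v (.var a) p).natWrites := by decide)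
    (hv : v ∉ p.natWrites := by decide)
    (hInv : ∀ j s x, Inv j s → Inv j (s.setNat v 0 x) := by intro j s x h; simpa using h) :
    Does I (.for v (.var a) p) s (s.nat a 0 * (T + 2) + 2) Q :=
  Does.for Inv (fun s' hf => by simp [hf.nat a ha]) h0 hstep hQ hv hInv

end Rules

/-! ### Threshold graphs of separated coloured points -/

section Separated

variable {ι κ : Type*}

/-- The graph on the points of `Y` that joins distinct points at distance less than `t`. -/
def nearGraph (δ : ι → ι → ℝ) (Y : Finset ι) (t : ℝ) : SimpleGraph ι :=
  SimpleGraph.fromRel fun a b => a ∈ Y ∧ b ∈ Y ∧ δ a b < t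

/-- Hall's condition for giving `need i` components of `G` to each class `i ∈ K`, every component
through a point of its class in `Y`: the classes in `R` meet at least as many components as they
need. -/
def HallCondition (G : SimpleGraph ι) (Y : Finset ι) (col : ι → κ) (K : Finset κ) (need : κ → ℕ) :
    Prop :=
  ∀ R ⊆ K, ∃ S ⊆ Y, (∀ p ∈ S, col p ∈ R) ∧ Set.InjOn G.connectedComponentMk S ∧
    ∑ i ∈ R, need i ≤ S.card

/-- `δ` is a pseudometric as far as paths through `Y` are concerned. -/
structure IsPseudoDist (δ : ι → ι → ℝ) (Y : Finset ι) : Prop where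
  self : ∀ a, δ a a = 0
  comm : ∀ a b, δ a b = δ b a
  triangle : ∀ b ∈ Y, ∀ a c, δ a c ≤ δ a b + δ b c

/-- The points of `Y` have at most `m` colours, and points of the same colour have distance at
least `m t`. -/
structure IsSeparated [DecidableEq κ] (δ : ι → ι → ℝ) (col : ι → κ) (m : ℕ) (Y : Finset ι) (t : ℝ) :
    Prop extends IsPseudoDist δ Y where
  pos : 0 < t
  card_colors : (Y.image col).card ≤ m
  le_dist : ∀ p ∈ Y, ∀ q ∈ Y, p ≠ q → col p = col q → (m : ℝ) * t ≤ δ p q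

variable {δ : ι → ι → ℝ} {Y : Finset ι} {t : ℝ} {a b c : ι}

theorem nearGraph_adj (hδ : ∀ a b, δ a b = δ b a) :
    (nearGraph δ Y t).Adj a b ↔ a ≠ b ∧ a ∈ Y ∧ b ∈ Y ∧ δ a b < t := by
  simp only [nearGraph, SimpleGraph.fromRel_adj, hδ b a]
  tauto

theorem mem_left_of_adj (h : (nearGraph δ Y t).Adj a b) : a ∈ Y := by
  simp only [nearGraph, SimpleGraph.fromRel_adj] at h
  tauto

theorem mem_of_mem_support (w : (nearGraph δ Y t).Walk a b) (ha : a ∈ Y) :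
    ∀ x ∈ w.support, x ∈ Y := by
  induction w with
  | nil => simpa using ha
  | cons h w ih =>
    intro x hx
    rcases List.mem_cons.1 (by simpa using hx) with rfl | hx
    · exact ha
    · exact ih (mem_left_of_adj h.symm) x hx

theorem IsPseudoDist.dist_lt_of_adj (hδ : IsPseudoDist δ Y) (h : (nearGraph δ Y t).Adj a b) {r : ℝ}
    (hr : δ b c ≤ r) : δ a c < t + r := by
  obtain ⟨-, -, hb, hab⟩ := (nearGraph_adj hδ.comm).1 h
  linarith [hδ.triangle b hb a c]

theorem IsPseudoDist.dist_le_length_mul (hδ : IsPseudoDist δ Y) (w : (nearGraph δ Y t).Walk a b) :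
    δ a b ≤ w.length * t := by
  induction w with
  | nil => simp [hδ.self]
  | cons h w ih =>
    rw [SimpleGraph.Walk.length_cons, Nat.cast_succ, add_one_mul, add_comm]
    exact (hδ.dist_lt_of_adj h ih).le

variable [DecidableEq κ] {col : ι → κ} {m : ℕ}

theorem IsSeparated.length_lt_of_injOn_col (hY : IsSeparated δ col m Y t)
    {w : (nearGraph δ Y t).Walk a b} (hw : w.IsPath) (ha : a ∈ Y)
    (hinj : ∀ x ∈ w.support, ∀ y ∈ w.support, col x = col y → x = y) : w.length < m := by
  have hnodup : (w.support.map col).Nodup := List.Nodup.map_on hinj hw.support_nodup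
  have hsub : (w.support.map col).toFinset ⊆ Y.image col := by
    intro c hc
    obtain ⟨x, hx, rfl⟩ := List.mem_map.1 (List.mem_toFinset.1 hc)
    exact Finset.mem_image_of_mem _ (mem_of_mem_support w ha x hx)
  have hcard := (Finset.card_le_card hsub).trans hY.card_colors
  rwa [List.toFinset_card_of_nodup hnodup, List.length_map, SimpleGraph.Walk.length_support]
    at hcard

-- A path that returned to its first colour would have at most `m` edges of length less than `t`,
-- but points of equal colour are `m t` apart.
theorem IsSeparated.injOn_col_of_isPath (hY : IsSeparated δ col m Y t)
    (w : (nearGraph δ Y t).Walk a b) (hw : w.IsPath) (ha : a ∈ Y) :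
    ∀ x ∈ w.support, ∀ y ∈ w.support, col x = col y → x = y := by
  classical
  induction w with
  | nil => simp
  | @cons a b c h w ih =>
    obtain ⟨hwp, haw⟩ := (SimpleGraph.Walk.cons_isPath_iff h w).1 hw
    have hb : b ∈ Y := mem_left_of_adj h.symm
    have ih := ih hwp hb
    have hne : ∀ x ∈ w.support, col a ≠ col x := by
      intro x hx hc
      have hlen : (w.takeUntil x hx).length < m :=
        hY.length_lt_of_injOn_col (hwp.takeUntil hx) hb fun y hy z hz =>
          ih y (w.support_takeUntil_subset_support hx hy) z
            (w.support_takeUntil_subset_support hx hz)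
      have hlt := hY.dist_lt_of_adj h (hY.dist_le_length_mul (w.takeUntil x hx))
      have hle := hY.le_dist a ha x (mem_of_mem_support w hb x hx) (fun h' => haw (h' ▸ hx)) hc
      have hlen' : ((w.takeUntil x hx).length : ℝ) + 1 ≤ m := by exact_mod_cast hlen
      nlinarith [hY.pos]
    intro x hx y hy hxy
    simp only [SimpleGraph.Walk.support_cons, List.mem_cons] at hx hy
    rcases hx with rfl | hx <;> rcases hy with rfl | hy
    · rfl
    · exact absurd hxy (hne y hy)
    · exact absurd hxy.symm (hne x hx)
    · exact ih x hx y hy hxy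

theorem IsSeparated.dist_le_of_reachable (hY : IsSeparated δ col m Y t) (ha : a ∈ Y)
    (h : (nearGraph δ Y t).Reachable a b) : δ a b ≤ ((m : ℝ) - 1) * t := by
  obtain ⟨w, hw⟩ := h.exists_isPath
  have hlen := hY.length_lt_of_injOn_col hw ha (hY.injOn_col_of_isPath w hw ha)
  have hlen' : (w.length : ℝ) + 1 ≤ m := by exact_mod_cast hlen
  nlinarith [hY.pos, hY.dist_le_length_mul w]

theorem IsSeparated.eq_of_reachable_of_col_eq (hY : IsSeparated δ col m Y t) (ha : a ∈ Y)
    (h : (nearGraph δ Y t).Reachable a b) (hc : col a = col b) : a = b := by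
  obtain ⟨w, hw⟩ := h.exists_isPath
  exact hY.injOn_col_of_isPath w hw ha a w.start_mem_support b w.end_mem_support hc

theorem IsSeparated.injOn_component_of_col_eq (hY : IsSeparated δ col m Y t) (c : κ) :
    Set.InjOn (nearGraph δ Y t).connectedComponentMk (Y.filter fun p => col p = c) := by
  intro p hp q hq h
  rw [Finset.mem_coe, Finset.mem_filter] at hp hq
  exact hY.eq_of_reachable_of_col_eq hp.1 (SimpleGraph.ConnectedComponent.eq.1 h)
    (hp.2.trans hq.2.symm)

end Separated

section Fair

variable {n m : ℕ} {I : Instance n m}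

theorem card_filter_col_mem {S : Finset (Fin n)} (hS : I.IsFair S) {R : Finset ℕ}
    (hR : R ⊆ Finset.range m) :
    (S.filter fun u : Fin n => I.col u ∈ R).card = ∑ i ∈ R, I.quo i := by
  have hmaps : ∀ u ∈ S.filter (fun u : Fin n => I.col u ∈ R), I.col u ∈ R := fun u hu =>
    (Finset.mem_filter.1 hu).2
  rw [Finset.card_eq_sum_card_fiberwise (f := fun u : Fin n => I.col u) hmaps]
  refine Finset.sum_congr rfl fun i hi => ?_
  have him := Finset.mem_range.1 (hR hi)
  rw [show I.quo i = I.quota ⟨i, him⟩ from I.quo_coe ⟨i, him⟩, ← hS ⟨i, him⟩]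
  congr 1
  ext u
  simp only [Finset.mem_filter, Finset.mem_inter, Instance.group, Finset.mem_univ, true_and,
    I.col_coe, Fin.ext_iff]
  exact ⟨fun h => ⟨h.1.1, h.2⟩, fun h => ⟨⟨h.1, h.2.symm ▸ hi⟩, h.2⟩⟩

/-- The distance of the elements named by two points. Points are indices into an array `pt`
of elements, so that one element may occur as several points. -/
noncomputable abbrev Instance.ptDist (I : Instance n m) (pt : ℕ → ℕ) (p q : ℕ) : ℝ :=
  I.d (pt p) (pt q)

/-- The colour of the element named by a point. -/
abbrev Instance.ptCol (I : Instance n m) (pt : ℕ → ℕ) (p : ℕ) : ℕ := I.col (pt p)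

/-- For the threshold `t`, the components of the points of `Y` can be assigned to the classes,
according to Hall's condition. -/
def Rich (I : Instance n m) (pt : ℕ → ℕ) (Y : Finset ℕ) (t : ℝ) : Prop :=
  HallCondition (nearGraph (I.ptDist pt) Y t) Y (I.ptCol pt) (Finset.range m) I.quo

/-- `Y` contains, for each class, either `k` points or a point close to every element of the
class. -/
def Covers (I : Instance n m) (pt : ℕ → ℕ) (Y : Finset ℕ) (t : ℝ) : Prop :=
  ∀ c < m, I.k ≤ (Y.filter fun p => I.ptCol pt p = c).card ∨
    ∀ u < n, I.col u = c → ∃ p ∈ Y, I.ptCol pt p = c ∧ I.d u (pt p) < m * t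

variable {pt : ℕ → ℕ} {Y : Finset ℕ} {t : ℝ}

theorem isPseudoDist_ptDist (hpt : ∀ p ∈ Y, pt p < n) : IsPseudoDist (I.ptDist pt) Y where
  self _ := I.d_self _
  comm _ _ := I.d_comm _ _
  triangle _ hb _ _ := I.d_triangle (hpt _ hb) _ _

theorem card_image_ptCol_le (hpt : ∀ p ∈ Y, pt p < n) : (Y.image (I.ptCol pt)).card ≤ m := by
  refine (Finset.card_le_card (t := Finset.range m) fun c hc => ?_).trans_eq (Finset.card_range m)
  obtain ⟨p, hp, rfl⟩ := Finset.mem_image.1 hc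
  exact Finset.mem_range.2 (I.col_lt (hpt p hp))

theorem dist_lt_of_reachable_of_close (hpt : ∀ p ∈ Y, pt p < n)
    (hY : IsSeparated (I.ptDist pt) (I.ptCol pt) m Y t) {p q : ℕ} (hp : p ∈ Y) (hq : q ∈ Y)
    (h : (nearGraph (I.ptDist pt) Y t).Reachable p q) {u v : ℕ} (hu : I.d u (pt p) < m * t)
    (hv : I.d v (pt q) < m * t) : I.d u v < (3 * (m : ℝ) - 1) * t := by
  have hpq := hY.dist_le_of_reachable hp h
  have huv := I.d_triangle (hpt p hp) u v
  have hpv := I.d_triangle (hpt q hq) (pt p) v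
  rw [I.d_comm] at hv
  linarith

theorem exists_fair_representatives (hpt : ∀ p ∈ Y, pt p < n)
    (hY : IsSeparated (I.ptDist pt) (I.ptCol pt) m Y t) {S : Finset (Fin n)} (hS : I.IsFair S)
    (hd : ∀ u ∈ S, ∀ v ∈ S, u ≠ v → (3 * (m : ℝ) - 1) * t ≤ I.dist u v) {R : Finset ℕ}
    (hR : R ⊆ Finset.range m) {f : Fin n → ℕ}
    (hf : ∀ u : Fin n, I.col u ∈ R →
      f u ∈ Y ∧ I.ptCol pt (f u) = I.col u ∧ I.d u (pt (f u)) < m * t) :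
    ∃ S' ⊆ Y, (∀ p ∈ S', I.ptCol pt p ∈ R) ∧
      Set.InjOn (nearGraph (I.ptDist pt) Y t).connectedComponentMk S' ∧
      ∑ i ∈ R, I.quo i ≤ S'.card := by
  set T := S.filter fun u : Fin n => I.col u ∈ R
  have hT : ∀ u ∈ T, u ∈ S ∧ I.col u ∈ R := fun u hu => Finset.mem_filter.1 hu
  have heq : ∀ u ∈ T, ∀ v ∈ T, (nearGraph (I.ptDist pt) Y t).Reachable (f u) (f v) → u = v := by
    intro u hu v hv h
    by_contra hne
    have hlt := dist_lt_of_reachable_of_close hpt hY (hf u (hT u hu).2).1 (hf v (hT v hv).2).1 h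
      (hf u (hT u hu).2).2.2 (hf v (hT v hv).2).2.2
    rw [I.d_coe] at hlt
    exact hlt.not_ge (hd u (hT u hu).1 v (hT v hv).1 hne)
  refine ⟨T.image f, ?_, ?_, ?_, ?_⟩
  · exact Finset.image_subset_iff.2 fun u hu => (hf u (hT u hu).2).1
  · intro p hp
    obtain ⟨u, hu, rfl⟩ := Finset.mem_image.1 hp
    rw [(hf u (hT u hu).2).2.1]
    exact (hT u hu).2
  · intro p hp q hq h
    obtain ⟨u, hu, rfl⟩ := Finset.mem_image.1 (Finset.mem_coe.1 hp)
    obtain ⟨v, hv, rfl⟩ := Finset.mem_image.1 (Finset.mem_coe.1 hq)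
    rw [heq u hu v hv (SimpleGraph.ConnectedComponent.eq.1 h)]
  · rw [Finset.card_image_of_injOn, card_filter_col_mem hS hR]
    exact fun u hu v hv huv => heq u hu v hv (huv ▸ SimpleGraph.Reachable.refl _)

theorem rich_of_isFair (hpt : ∀ p ∈ Y, pt p < n)
    (hY : IsSeparated (I.ptDist pt) (I.ptCol pt) m Y t) (hcov : Covers I pt Y t)
    {S : Finset (Fin n)} (hS : I.IsFair S)
    (hd : ∀ u ∈ S, ∀ v ∈ S, u ≠ v → (3 * (m : ℝ) - 1) * t ≤ I.dist u v) : Rich I pt Y t := by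
  intro R hR
  by_cases hk : ∃ c ∈ R, I.k ≤ (Y.filter fun p => I.ptCol pt p = c).card
  · obtain ⟨c, hc, hk⟩ := hk
    refine ⟨_, Finset.filter_subset _ _, ?_, hY.injOn_component_of_col_eq c, le_trans ?_ hk⟩
    · exact fun p hp => (Finset.mem_filter.1 hp).2 ▸ hc
    · rw [← I.sum_quo]
      exact Finset.sum_le_sum_of_subset hR
  · push Not at hk
    have hf : ∀ u : Fin n, I.col u ∈ R →
        ∃ p, p ∈ Y ∧ I.ptCol pt p = I.col u ∧ I.d u (pt p) < m * t := fun u hu =>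
      ((hcov _ (Finset.mem_range.1 (hR hu))).resolve_left (hk _ hu).not_ge) u u.2 rfl
    choose! f hf using hf
    exact exists_fair_representatives hpt hY hS hd hR hf

end Fair

/-! ### Prim's algorithm -/

section Prim

variable {ι : Type*}

/-- The list `y 0, …, y (M - 1)` is visited in the order of Prim's algorithm up to position `j`:
`key i` is the distance of `y i` to its predecessors, and no later point is closer to them. -/
structure PrimPrefix (δ : ι → ι → ℝ) (M j : ℕ) (y : ℕ → ι) (key : ℕ → ℝ) : Prop where
  attained : ∀ i < j, 0 < i → ∃ i' < i, δ (y i') (y i) = key i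
  cut : ∀ i < j, 0 < i → ∀ i' < i, ∀ l < M, i ≤ l → key i ≤ δ (y i') (y l)

/-- From position `j` on, the keys are the distances to the first `j'` points. They are arbitrary
if there are no such points. -/
def FrontierKeys (δ : ι → ι → ℝ) (M j j' : ℕ) (y : ℕ → ι) (key : ℕ → ℝ) : Prop :=
  0 < j' → ∀ l < M, j ≤ l → IsLeast ((fun i => δ (y i) (y l)) '' Set.Iio j') (key l)

/-- `y 0, …, y (M - 1)` lists the set `Y` in the order in which Prim's algorithm visits it. -/
structure PrimOrder (δ : ι → ι → ℝ) (Y : Finset ι) (M : ℕ) (y : ℕ → ι) (key : ℕ → ℝ) : Prop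
    extends PrimPrefix δ M M y key where
  bijOn : Set.BijOn y (Set.Iio M) Y

open Classical in
/-- The keys after the point at position `j` has been visited, updated at positions below `L`. -/
noncomputable def relaxedKeys (δ : ι → ι → ℝ) (L j : ℕ) (y : ℕ → ι) (key : ℕ → ℝ) (l : ℕ) : ℝ :=
  if l < L ∧ j < l ∧ (0 < j → δ (y j) (y l) < key l) then δ (y j) (y l) else key l

variable {δ : ι → ι → ℝ} {Y : Finset ι} {M j j' : ℕ} {y : ℕ → ι} {key : ℕ → ℝ}

theorem le_perm_of_fixes_below {σ : Equiv.Perm ℕ} (hσ : ∀ i < j, σ i = i) {l : ℕ} (hl : j ≤ l) :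
    j ≤ σ l := by
  by_contra h
  have := σ.injective (hσ _ (not_le.1 h))
  omega

theorem PrimPrefix.comp_perm (h : PrimPrefix δ M j y key) {σ : Equiv.Perm ℕ}
    (hσ : ∀ i < j, σ i = i) (hM : ∀ l < M, σ l < M) :
    PrimPrefix δ M j (y ∘ σ) (key ∘ σ) where
  attained i hi h0 := by
    obtain ⟨i', hi', he⟩ := h.attained i hi h0
    exact ⟨i', hi', by simpa only [Function.comp, hσ i hi, hσ i' (hi'.trans hi)] using he⟩
  cut i hi h0 i' hi' l hl hil := by
    simpa only [Function.comp, hσ i hi, hσ i' (hi'.trans hi)] using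
      h.cut i hi h0 i' hi' (σ l) (hM l hl)
        (le_perm_of_fixes_below (fun a ha => hσ a (ha.trans hi)) hil)

theorem FrontierKeys.comp_perm (h : FrontierKeys δ M j j y key) {σ : Equiv.Perm ℕ}
    (hσ : ∀ i < j, σ i = i) (hM : ∀ l < M, σ l < M) :
    FrontierKeys δ M j j (y ∘ σ) (key ∘ σ) := by
  intro h0 l hl hjl
  have himage : (fun i => δ ((y ∘ σ) i) ((y ∘ σ) l)) '' Set.Iio j =
      (fun i => δ (y i) (y (σ l))) '' Set.Iio j :=
    Set.image_congr fun i hi => by rw [Function.comp, Function.comp, hσ i hi]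
  rw [himage]
  exact h h0 (σ l) (hM l hl) (le_perm_of_fixes_below hσ hjl)

theorem PrimPrefix.succ (h : PrimPrefix δ M j y key) (hf : FrontierKeys δ M j j y key) (hj : j < M)
    (hmin : ∀ l < M, j ≤ l → key j ≤ key l) : PrimPrefix δ M (j + 1) y key where
  attained i hi h0 := by
    rcases Nat.lt_succ_iff_lt_or_eq.1 hi with hi | rfl
    · exact h.attained i hi h0
    · exact (hf h0 i hj le_rfl).1
  cut i hi h0 i' hi' l hl hil := by
    rcases Nat.lt_succ_iff_lt_or_eq.1 hi with hi | rfl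
    · exact h.cut i hi h0 i' hi' l hl hil
    · exact (hmin l hl hil).trans ((hf h0 l hl hil).2 ⟨i', hi', rfl⟩)

theorem PrimPrefix.congr_key (h : PrimPrefix δ M j y key) {key' : ℕ → ℝ}
    (hk : ∀ i < j, key' i = key i) : PrimPrefix δ M j y key' where
  attained i hi h0 := hk i hi ▸ h.attained i hi h0
  cut i hi h0 := hk i hi ▸ h.cut i hi h0

theorem relaxedKeys_of_le {L l : ℕ} (h : l ≤ j) : relaxedKeys δ L j y key l = key l :=
  if_neg fun h' => h'.2.1.not_ge h

theorem relaxedKeys_succ_of_pos {L : ℕ} (h : j < L ∧ (0 < j → δ (y j) (y L) < key L)) :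
    relaxedKeys δ (L + 1) j y key =
      Function.update (relaxedKeys δ L j y key) L (δ (y j) (y L)) := by
  ext l
  rcases eq_or_ne l L with rfl | hl
  · simpa [relaxedKeys] using fun hc => absurd h.2 (by simpa using hc h.1)
  · simp only [relaxedKeys, Function.update_of_ne hl, show l < L + 1 ↔ l < L by omega]

theorem relaxedKeys_succ_of_neg {L : ℕ} (h : ¬ (j < L ∧ (0 < j → δ (y j) (y L) < key L))) :
    relaxedKeys δ (L + 1) j y key = relaxedKeys δ L j y key := by
  ext l
  rcases eq_or_ne l L with rfl | hl
  · simp [relaxedKeys, h]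
  · simp only [relaxedKeys, show l < L + 1 ↔ l < L by omega]

theorem PrimPrefix.relax (h : PrimPrefix δ M (j + 1) y key) (L : ℕ) :
    PrimPrefix δ M (j + 1) y (relaxedKeys δ L j y key) :=
  h.congr_key fun _ hi => relaxedKeys_of_le (Nat.le_of_lt_succ hi)

theorem FrontierKeys.relax (h : FrontierKeys δ M j j y key) :
    FrontierKeys δ M (j + 1) (j + 1) y (relaxedKeys δ M j y key) := by
  intro _ l hl hjl
  rw [← Order.succ_eq_add_one j, Order.Iio_succ_eq_insert, Set.image_insert_eq]
  rcases j.eq_zero_or_pos with rfl | h0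
  · simp [relaxedKeys, hl, show 0 < l from hjl]
  · have hval : relaxedKeys δ M j y key l = min (δ (y j) (y l)) (key l) := by
      simp only [relaxedKeys, hl, show j < l from hjl, h0, true_and, forall_const]
      split_ifs with hlt
      · exact (min_eq_left hlt.le).symm
      · exact (min_eq_right (not_lt.1 hlt)).symm
    rw [hval]
    exact (h h0 l hl (by omega)).insert (δ (y j) (y l))

/-- The state of Prim's algorithm on the list `y 0, …, y (M - 1)` of the points of `Y` when `j`
points have been visited. -/
structure PrimState (δ : ι → ι → ℝ) (Y : Finset ι) (M j : ℕ) (y : ℕ → ι) (key : ℕ → ℝ) : Prop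
    extends PrimPrefix δ M j y key where
  bijOn : Set.BijOn y (Set.Iio M) Y
  frontier : FrontierKeys δ M j j y key

theorem PrimState.zero (h : Set.BijOn y (Set.Iio M) Y) : PrimState δ Y M 0 y key :=
  ⟨⟨by simp, by simp⟩, h, fun h => absurd h (lt_irrefl 0)⟩

theorem PrimState.succ (h : PrimState δ Y M j y key) {b : ℕ} (hjb : j ≤ b) (hb : b < M)
    (hmin : ∀ l < M, j ≤ l → key b ≤ key l) :
    PrimState δ Y M (j + 1) (y ∘ Equiv.swap b j)
      (relaxedKeys δ M j (y ∘ Equiv.swap b j) (key ∘ Equiv.swap b j)) := by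
  have hjM : j < M := hjb.trans_lt hb
  have hfix : ∀ i < j, Equiv.swap b j i = i := fun i hi =>
    Equiv.swap_apply_of_ne_of_ne (by omega) (by omega)
  have hswap : Set.BijOn (Equiv.swap b j) (Set.Iio M) (Set.Iio M) :=
    Equiv.swap_bijOn_self (iff_of_true hb hjM)
  have hM : ∀ l < M, Equiv.swap b j l < M := fun l hl => hswap.mapsTo hl
  have hfrontier := h.frontier.comp_perm hfix hM
  refine ⟨((h.comp_perm hfix hM).succ hfrontier hjM fun l hl hjl => ?_).relax _,
    h.bijOn.comp hswap, hfrontier.relax⟩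
  simpa using hmin _ (hM l hl) (le_perm_of_fixes_below hfix hjl)

/-- The position at which the component of position `j` starts, in the order of Prim's algorithm,
for the threshold `t`. -/
noncomputable def compStart (key : ℕ → ℝ) (t : ℝ) : ℕ → ℕ
  | 0 => 0
  | j + 1 => if key (j + 1) < t then compStart key t j else j + 1

variable {t : ℝ}

theorem compStart_le (j : ℕ) : compStart key t j ≤ j := by
  induction j with
  | zero => exact le_rfl
  | succ j ih => unfold compStart; split_ifs <;> omega

theorem compStart_eq_zero_or_le_key (j : ℕ) :
    compStart key t j = 0 ∨ t ≤ key (compStart key t j) := by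
  induction j with
  | zero => exact Or.inl rfl
  | succ j ih =>
    by_cases h : key (j + 1) < t
    · simp only [compStart, if_pos h]
      exact ih
    · simp only [compStart, if_neg h]
      exact Or.inr (not_lt.1 h)

theorem key_lt_of_compStart_lt (h : compStart key t j < j) : key j < t := by
  obtain ⟨j, rfl⟩ := Nat.exists_eq_succ_of_ne_zero (by omega : j ≠ 0)
  by_contra hc
  simp [compStart, hc] at h

theorem compStart_eq_of_between {c : ℕ} (hc : compStart key t j ≤ c) (hj : c ≤ j) :
    compStart key t c = compStart key t j := by
  induction j with
  | zero => rw [Nat.le_zero.1 hj]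
  | succ j ih =>
    rcases hj.lt_or_eq with hlt | rfl
    · by_cases h : key (j + 1) < t
      · simp only [compStart, if_pos h] at hc ⊢
        exact ih hc (Nat.le_of_lt_succ hlt)
      · simp only [compStart, if_neg h] at hc
        omega
    · rfl

theorem compStart_congr {t' : ℝ} (h : ∀ i, 0 < i → i ≤ j → (key i < t ↔ key i < t')) :
    compStart key t j = compStart key t' j := by
  induction j with
  | zero => rfl
  | succ j ih =>
    simp only [compStart, h (j + 1) j.succ_pos le_rfl, ih fun i h0 hi => h i h0 (by omega)]

theorem PrimPrefix.compStart_le_of_dist_lt (h : PrimPrefix δ M M y key) {a b : ℕ} (hb : b < M)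
    (hab : δ (y a) (y b) < t) : compStart key t b ≤ a := by
  by_contra hlt
  have hle := compStart_le (key := key) (t := t) b
  rcases compStart_eq_zero_or_le_key (key := key) (t := t) b with h0 | h0
  · omega
  · have := h.cut (compStart key t b) (by omega) (by omega) a (not_le.1 hlt) b hb hle
    linarith

theorem PrimOrder.reachable_compStart (h : PrimOrder δ Y M y key) {j : ℕ} (hj : j < M) :
    (nearGraph δ Y t).Reachable (y (compStart key t j)) (y j) := by
  induction j using Nat.strong_induction_on with
  | _ j ih =>
    rcases (compStart_le (key := key) (t := t) j).lt_or_eq with hlt | heq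
    · obtain ⟨i, hij, hi⟩ := h.attained j hj (by omega)
      have hdist : δ (y i) (y j) < t := hi.trans_lt (key_lt_of_compStart_lt hlt)
      have hreach := ih i hij (hij.trans hj)
      rw [compStart_eq_of_between (h.compStart_le_of_dist_lt hj hdist) hij.le] at hreach
      refine hreach.trans (SimpleGraph.Adj.reachable ?_)
      refine (SimpleGraph.fromRel_adj _ _ _).2 ⟨fun he => hij.ne ?_, Or.inl ⟨?_, ?_, hdist⟩⟩
      · exact h.bijOn.injOn (hij.trans hj) hj he
      · exact h.bijOn.mapsTo (hij.trans hj)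
      · exact h.bijOn.mapsTo hj
    · rw [heq]

theorem PrimOrder.compStart_eq_of_dist_lt (h : PrimOrder δ Y M y key) (hδ : ∀ a b, δ a b = δ b a)
    {a b : ℕ} (ha : a < M) (hb : b < M) (hab : δ (y a) (y b) < t) :
    compStart key t a = compStart key t b := by
  wlog hle : a ≤ b generalizing a b
  · exact (this hb ha (by rwa [hδ]) (by omega)).symm
  exact compStart_eq_of_between (h.compStart_le_of_dist_lt hb hab) hle

theorem PrimOrder.compStart_eq_of_walk (h : PrimOrder δ Y M y key) (hδ : ∀ a b, δ a b = δ b a)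
    {p q : ι} (w : (nearGraph δ Y t).Walk p q) {a b : ℕ} (ha : a < M) (hb : b < M) (hp : y a = p)
    (hq : y b = q) : compStart key t a = compStart key t b := by
  induction w generalizing a with
  | nil => rw [h.bijOn.injOn ha hb (hp.trans hq.symm)]
  | cons hadj w ih =>
    obtain ⟨-, -, hmem, hlt⟩ := (nearGraph_adj hδ).1 hadj
    obtain ⟨c, hc, rfl⟩ := h.bijOn.surjOn hmem
    subst hp
    exact (h.compStart_eq_of_dist_lt hδ ha hc hlt).trans (ih hc rfl hq)

theorem PrimOrder.reachable_iff (h : PrimOrder δ Y M y key) (hδ : ∀ a b, δ a b = δ b a)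
    {a b : ℕ} (ha : a < M) (hb : b < M) :
    (nearGraph δ Y t).Reachable (y a) (y b) ↔ compStart key t a = compStart key t b := by
  refine ⟨fun ⟨w⟩ => h.compStart_eq_of_walk hδ w ha hb rfl rfl, fun he => ?_⟩
  have hreach := h.reachable_compStart (t := t) ha
  rw [he] at hreach
  exact hreach.symm.trans (h.reachable_compStart hb)

theorem PrimOrder.hallCondition_congr (h : PrimOrder δ Y M y key) (hδ : ∀ a b, δ a b = δ b a)
    {t' : ℝ} (hk : ∀ j < M, 0 < j → (key j < t ↔ key j < t')) {κ : Type*} {col : ι → κ}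
    {K : Finset κ} {need : κ → ℕ} (hr : HallCondition (nearGraph δ Y t) Y col K need) :
    HallCondition (nearGraph δ Y t') Y col K need := by
  have hcongr : ∀ j < M, compStart key t j = compStart key t' j := fun j hj =>
    compStart_congr fun i h0 hi => hk i (hi.trans_lt hj) h0
  intro R hR
  obtain ⟨S, hSY, hSR, hinj, hcard⟩ := hr R hR
  refine ⟨S, hSY, hSR, fun p hp q hq hpq => hinj hp hq ?_, hcard⟩
  obtain ⟨a, ha, rfl⟩ := h.bijOn.surjOn (hSY hp)
  obtain ⟨b, hb, rfl⟩ := h.bijOn.surjOn (hSY hq)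
  rw [SimpleGraph.ConnectedComponent.eq, h.reachable_iff hδ ha hb] at hpq ⊢
  rwa [hcongr a ha, hcongr b hb]

end Prim

/-! ### Nets and their components -/

/-
The memory layout. Arrays of which only the entry `0` is used serve as scalar variables; the array
`0` of natural numbers is the output. Names that begin with `r` are arrays of reals.
* `aK` is `k`, and `aSlot` lists each class as often as its quota says.
* `aPt` and `rRad` hold the `aP` sampled points and their radii. During the sampling, `rMin` holds
  the distances of the elements to the points, and `aBest` the farthest elements of the classes,
  plus one.
* `rTop` is larger than all distances, and `rT` is the threshold under consideration.
* `aY` and `rKey` list the `aM` points of the net and their keys, in the order of Prim's algorithm,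
  and `aLab` holds the positions at which their components start.
* `aOwn` holds the positions that represent the assigned components, plus one, and `aOk` tells
  whether all classes have been served.
* `aVis`, `aPar`, `aQue`, `aHead`, `aTail`, `aFound` and `aCur` belong to the search for an
  augmenting path.
* `rCand` holds the `aNc` candidates for the optimal threshold, which is sought between `rLo` and
  `rHi`. The next candidate to be tested is `rPiv`.
* `aCnt` counts the elements that have been chosen from each class by `fallback`.
-/
local notation "aK" => (1 : ℕ)
local notation "aSlot" => (2 : ℕ)
local notation "aP" => (3 : ℕ)
local notation "aPt" => (4 : ℕ)
local notation "aBest" => (5 : ℕ)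
local notation "aM" => (6 : ℕ)
local notation "aY" => (7 : ℕ)
local notation "aLab" => (8 : ℕ)
local notation "aOwn" => (9 : ℕ)
local notation "aOk" => (10 : ℕ)
local notation "aVis" => (11 : ℕ)
local notation "aPar" => (12 : ℕ)
local notation "aQue" => (13 : ℕ)
local notation "aHead" => (14 : ℕ)
local notation "aTail" => (15 : ℕ)
local notation "aFound" => (16 : ℕ)
local notation "aCur" => (17 : ℕ)
local notation "aNc" => (18 : ℕ)
local notation "aGo" => (19 : ℕ)
local notation "aLess" => (20 : ℕ)
local notation "aMore" => (21 : ℕ)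
local notation "aTot" => (22 : ℕ)
local notation "aHas" => (23 : ℕ)
local notation "aArg" => (24 : ℕ)
local notation "aTmp" => (25 : ℕ)
local notation "aCnt" => (26 : ℕ)
local notation "vI" => (30 : ℕ)
local notation "vJ" => (31 : ℕ)
local notation "vL" => (32 : ℕ)
local notation "vQ" => (33 : ℕ)
local notation "vA" => (34 : ℕ)
local notation "vB" => (35 : ℕ)
local notation "rMin" => (0 : ℕ)
local notation "rRad" => (1 : ℕ)
local notation "rTop" => (2 : ℕ)
local notation "rT" => (3 : ℕ)
local notation "rKey" => (4 : ℕ)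
local notation "rTmp" => (5 : ℕ)
local notation "rCand" => (6 : ℕ)
local notation "rLo" => (7 : ℕ)
local notation "rHi" => (8 : ℕ)
local notation "rPiv" => (9 : ℕ)

/-- The points with radius at least `m t`. -/
noncomputable def net (m P : ℕ) (rad : ℕ → ℝ) (t : ℝ) : Finset ℕ :=
  (Finset.range P).filter fun p => (m : ℝ) * t ≤ rad p

section Net

variable {m P M j : ℕ} {rad : ℕ → ℝ} {t : ℝ} {y : ℕ → ℕ}

theorem mem_net {p : ℕ} : p ∈ net m P rad t ↔ p < P ∧ (m : ℝ) * t ≤ rad p := by simp [net]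

theorem net_succ_of_le (h : m * t ≤ rad j) : net m (j + 1) rad t = insert j (net m j rad t) := by
  rw [net, Finset.range_add_one, Finset.filter_insert, if_pos h, net]

theorem net_succ_of_lt (h : rad j < m * t) : net m (j + 1) rad t = net m j rad t := by
  rw [net, Finset.range_add_one, Finset.filter_insert, if_neg h.not_ge, net]

theorem le_of_bijOn_net (h : Set.BijOn y (Set.Iio M) (net m P rad t)) : M ≤ P := by
  have hsub := Set.ncard_le_ncard (t := Set.Iio P)
    (fun p hp => (mem_net.1 (Finset.mem_coe.1 hp)).1 : ↑(net m P rad t) ⊆ Set.Iio P)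
  rwa [← h.image_eq, h.injOn.ncard_image, ← Finset.coe_range, ← Finset.coe_range,
    Set.ncard_coe_finset, Set.ncard_coe_finset, Finset.card_range, Finset.card_range] at hsub

theorem bijOn_update_insert {ι : Type*} [DecidableEq ι] {y : ℕ → ι} {Y : Finset ι} {p : ι}
    (h : Set.BijOn y (Set.Iio M) Y) (hp : p ∉ Y) :
    Set.BijOn (Function.update y M p) (Set.Iio (M + 1)) ↑(insert p Y) := by
  have heq : Set.EqOn y (Function.update y M p) (Set.Iio M) := fun a ha =>
    (Function.update_of_ne (ne_of_lt ha) _ _).symm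
  have hins := (h.congr heq).insert (a := M) (by simpa using hp)
  rwa [Function.update_self, ← Order.Iio_succ_eq_insert, Order.succ_eq_add_one,
    ← Finset.coe_insert] at hins

end Net

section Cluster

variable {n m : ℕ} {I : Instance n m} {s : Store}

/-- List in `aY` the points with radius at least `m rT`. -/
def buildNet : Prog := .block [
  .nass aM (.lit 0),
  .for vI (.var aP) (.ite (.rlt (.get rRad (.var vI)) (.mul (.ofNat .numClasses) (.var rT)))
    .skip
    (.block [.nset aY (.var aM) (.var vI), .incr aM]))]

theorem buildNet_spec :
    Does I buildNet s (10 * (s.nat aP 0 + 1)) fun s' => Set.BijOn (s'.nat aY)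
      (Set.Iio (s'.nat aM 0)) (net m (s.nat aP 0) (s.real rRad) (s.real rT 0)) := by
  refine ((Does.nass aM (.lit 0)).seq (T₂ := s.nat aP 0 * (5 + 2) + 2) ?_).le (by omega)
  intro s₁ hf₁ hM
  have eP : s₁.nat aP = s.nat aP := hf₁.nat aP
  rw [← eP, ← hf₁.real_eq]
  refine Does.for_var (fun j s' => Set.BijOn (s'.nat aY) (Set.Iio (s'.nat aM 0))
    (net m j (s₁.real rRad) (s₁.real rT 0))) (by simp [hM, net]) ?_ fun s' _ h => h
  intro j _ s' hf hv hY
  refine Does.of_wp ⟨fun hlt => ?_, fun hge => ?_⟩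
  · simp only [BExp.holds_rlt, RExp.eval_get, NExp.eval_get, NExp.eval_lit, RExp.eval_mul,
      RExp.eval_ofNat, NExp.eval_numClasses, hv, hf.real_eq] at hlt
    rwa [net_succ_of_lt hlt]
  · simp only [BExp.holds_rlt, RExp.eval_get, NExp.eval_get, NExp.eval_lit, RExp.eval_mul,
      RExp.eval_ofNat, NExp.eval_numClasses, hv, hf.real_eq, not_lt] at hge
    rw [net_succ_of_le hge]
    simpa [Prog.block, Prog.wp, hv] using bijOn_update_insert hY (fun h => (mem_net.1 h).1.false)

/-- Set `aArg` to the position of the smallest key at `vJ` or later. -/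
def primArgmin : Prog := .block [
  .nass aArg (.var vJ),
  .for vL (.var aM) (.ite (.and (.nlt (.var vJ) (.var vL))
      (.rlt (.get rKey (.var vL)) (.get rKey (.var aArg))))
    (.nass aArg (.var vL)) .skip)]

theorem primArgmin_spec (hj : s.nat vJ 0 < s.nat aM 0) :
    Does I primArgmin s (6 * s.nat aM 0 + 3) fun s' =>
      s.nat vJ 0 ≤ s'.nat aArg 0 ∧ s'.nat aArg 0 < s.nat aM 0 ∧
      ∀ l < s.nat aM 0, s.nat vJ 0 ≤ l → s.real rKey (s'.nat aArg 0) ≤ s.real rKey l := by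
  refine ((Does.nass aArg (.var vJ)).seq (T₂ := s.nat aM 0 * (4 + 2) + 2) ?_).le (by omega)
  intro s₁ hf₁ hA
  have hA : s₁.nat aArg 0 = s.nat vJ 0 := by simp [hA]
  rw [← hf₁.nat aM, ← hf₁.nat vJ, ← hf₁.real rKey] at *
  refine Does.for_var (fun l s' => s₁.nat vJ 0 ≤ s'.nat aArg 0 ∧ s'.nat aArg 0 < s₁.nat aM 0 ∧
    ∀ l', s₁.nat vJ 0 ≤ l' → l' < l ∨ l' = s₁.nat vJ 0 →
      s₁.real rKey (s'.nat aArg 0) ≤ s₁.real rKey l') ?_ ?_ ?_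
  · exact ⟨hA.ge, hA ▸ hj, fun l' _ h => by rw [hA, h.resolve_left (by omega)]⟩
  · rintro l hl s' hf hv ⟨hge, hlt, hmin⟩
    refine Does.of_wp ?_
    simp only [Prog.wp, BExp.holds_and, BExp.holds_nlt, BExp.holds_rlt, RExp.eval_get,
      NExp.eval_get, NExp.eval_lit, hf.nat vJ, hf.real rKey, hv, Store.nat_setNat_self,
      Function.update_self]
    refine ⟨fun ⟨hjl, hk⟩ => ⟨hjl.le, hl, fun l' hjl' hl' => ?_⟩,
      fun hn => ⟨hge, hlt, fun l' hjl' hl' => ?_⟩⟩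
    · rcases eq_or_ne l' l with rfl | hne
      · rfl
      · exact hk.le.trans (hmin l' hjl' (by omega))
    · by_cases h : l' < l ∨ l' = s₁.nat vJ 0
      · exact hmin l' hjl' h
      · obtain rfl : l' = l := by omega
        exact not_lt.1 fun hc => hn ⟨by omega, hc⟩
  · rintro s' - ⟨hge, hlt, hmin⟩
    exact ⟨hge, hlt, fun l hl hjl => hmin l hjl (Or.inl hl)⟩

/-- Exchange the positions `vJ` and `aArg`. -/
def primSwap : Prog := .block [
  .nass aTmp (.get aY (.var aArg)),
  .nset aY (.var aArg) (.get aY (.var vJ)),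
  .nset aY (.var vJ) (.var aTmp),
  .rass rTmp (.get rKey (.var aArg)),
  .rset rKey (.var aArg) (.get rKey (.var vJ)),
  .rset rKey (.var vJ) (.var rTmp)]

theorem primSwap_spec :
    Does I primSwap s 6 fun s' =>
      s'.nat aY = s.nat aY ∘ Equiv.swap (s.nat aArg 0) (s.nat vJ 0) ∧
      s'.real rKey = s.real rKey ∘ Equiv.swap (s.nat aArg 0) (s.nat vJ 0) := by
  refine Does.of_wp ?_
  rw [Equiv.swap_comm, Equiv.comp_swap_eq_update, Equiv.comp_swap_eq_update]
  simp [primSwap, Prog.wp, Prog.block]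

/-- Update the keys after the point at position `vJ` has been visited. -/
def primRelax : Prog :=
  .for vL (.var aM) (.ite (.and (.nlt (.var vJ) (.var vL)) (.not (.and (.nlt (.lit 0) (.var vJ))
      (.not (.rlt (.dist (.get aPt (.get aY (.var vJ))) (.get aPt (.get aY (.var vL))))
        (.get rKey (.var vL)))))))
    (.rset rKey (.var vL) (.dist (.get aPt (.get aY (.var vJ))) (.get aPt (.get aY (.var vL)))))
    .skip)

theorem primRelax_spec :
    Does I primRelax s (5 * s.nat aM 0 + 2) fun s' => s'.real rKey =
      relaxedKeys (I.ptDist (s.nat aPt)) (s.nat aM 0) (s.nat vJ 0) (s.nat aY) (s.real rKey) := by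
  refine (Does.for_var (T := 3) (fun L s' => s'.real rKey =
    relaxedKeys (I.ptDist (s.nat aPt)) L (s.nat vJ 0) (s.nat aY) (s.real rKey))
    (by ext l; simp [relaxedKeys]) ?_ fun s' _ h => h).le (by omega)
  intro L _ s' hf hv hkeys
  have hL : s'.real rKey L = s.real rKey L := by simp [hkeys, relaxedKeys]
  refine Does.of_wp ?_
  simp only [Prog.wp, BExp.holds_and, BExp.holds_nlt, BExp.holds_not, BExp.holds_rlt,
    RExp.eval_dist, RExp.eval_get, NExp.eval_get, NExp.eval_lit, hf.nat vJ, hf.nat aPt, hf.nat aY,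
    hv, hL, not_and, not_not, Store.real_setReal_self]
  exact ⟨fun hc => by rw [relaxedKeys_succ_of_pos hc, hkeys],
    fun hc => by rw [relaxedKeys_succ_of_neg (fun h => hc h.1 h.2), hkeys]⟩

/-- Prim's algorithm: reorder the points listed in `aY`. -/
def prim : Prog := .for vJ (.var aM) (.block [primArgmin, primSwap, primRelax])

theorem prim_step_spec {Y : Finset ℕ} {j : ℕ} (hj : j < s.nat aM 0) (hv : s.nat vJ 0 = j)
    (h : PrimState (I.ptDist (s.nat aPt)) Y (s.nat aM 0) j (s.nat aY) (s.real rKey)) :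
    Does I (.block [primArgmin, primSwap, primRelax]) s (11 * s.nat aM 0 + 11) fun s' =>
      PrimState (I.ptDist (s.nat aPt)) Y (s.nat aM 0) (j + 1) (s'.nat aY) (s'.real rKey) := by
  subst hv
  refine ((primArgmin_spec hj).seq (T₂ := 6 + (5 * s.nat aM 0 + 2)) ?_).le (by omega)
  rintro s₁ hf₁ ⟨hge, hlt, hmin⟩
  refine primSwap_spec.seq ?_
  rintro s₂ hf₂ ⟨hy, hkey⟩
  refine primRelax_spec.mono (by rw [hf₂.nat aM, hf₁.nat aM]) ?_
  intro s₃ hf₃ hrelax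
  rw [hf₁.nat aY, hf₁.nat vJ] at hy
  rw [hf₁.real rKey, hf₁.nat vJ] at hkey
  rw [hrelax, hf₃.nat aY, hf₂.nat vJ, hf₁.nat vJ, hf₂.nat aM, hf₁.nat aM, hf₂.nat aPt,
    hf₁.nat aPt, hy, hkey]
  exact h.succ hge hlt hmin

theorem prim_spec {Y : Finset ℕ} (hY : Set.BijOn (s.nat aY) (Set.Iio (s.nat aM 0)) Y) :
    Does I prim s (20 * (s.nat aM 0 + 1) * (s.nat aM 0 + 1)) fun s' =>
      PrimOrder (I.ptDist (s.nat aPt)) Y (s.nat aM 0) (s'.nat aY) (s'.real rKey) := by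
  refine (Does.for_var (T := 11 * s.nat aM 0 + 11) (fun j s' =>
    PrimState (I.ptDist (s.nat aPt)) Y (s.nat aM 0) j (s'.nat aY) (s'.real rKey)) (.zero hY) ?_
    fun s' _ h => ⟨h.toPrimPrefix, h.bijOn⟩).le (by nlinarith)
  intro j hj s' hf hv h
  rw [← hf.nat aM, ← hf.nat aPt] at *
  exact prim_step_spec hj hv h

/-- Compute the components of the net for the threshold `rT`. -/
def labels : Prog :=
  .for vI (.var aM) (.ite (.and (.nlt (.lit 0) (.var vI)) (.rlt (.get rKey (.var vI)) (.var rT)))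
    (.nset aLab (.var vI) (.get aLab (.sub (.var vI) (.lit 1))))
    (.nset aLab (.var vI) (.var vI)))

theorem compStart_eq_ite (key : ℕ → ℝ) (t : ℝ) (j : ℕ) :
    compStart key t j = if 0 < j ∧ key j < t then compStart key t (j - 1) else j := by
  cases j <;> simp [compStart]

theorem forall_lt_succ_update {α : Type*} {a f : ℕ → α} {j : ℕ} {x : α} (h : ∀ i < j, a i = f i)
    (hx : x = f j) : ∀ i < j + 1, Function.update a j x i = f i := by
  intro i hi
  rcases Nat.lt_succ_iff_lt_or_eq.1 hi with hi | rfl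
  · rw [Function.update_of_ne hi.ne, h i hi]
  · rw [Function.update_self, hx]

theorem labels_spec :
    Does I labels s (5 * s.nat aM 0 + 2) fun s' =>
      ∀ j < s.nat aM 0, s'.nat aLab j = compStart (s.real rKey) (s.real rT 0) j := by
  refine (Does.for_var (T := 3) (fun L s' =>
    ∀ j < L, s'.nat aLab j = compStart (s.real rKey) (s.real rT 0) j) (by simp) ?_
    fun s' _ h => h).le (by omega)
  intro j _ s' hf hv h
  refine Does.of_wp ?_
  simp only [Prog.wp, BExp.holds_and, BExp.holds_nlt, BExp.holds_rlt, RExp.eval_get,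
    NExp.eval_get, NExp.eval_lit, NExp.eval_sub, hv, hf.real_eq, Store.nat_setNat_self]
  refine ⟨fun hc => forall_lt_succ_update h ?_, fun hc => forall_lt_succ_update h ?_⟩
  · rw [h (j - 1) (by omega), compStart_eq_ite _ _ j, if_pos hc]
  · rw [compStart_eq_ite, if_neg hc]

/-- Compute the net for the threshold `rT` and its components. -/
def cluster : Prog := .block [buildNet, prim, labels]

theorem cluster_spec :
    Does I cluster s (40 * (s.nat aP 0 + 1) * (s.nat aP 0 + 1)) fun s' =>
      s'.nat aM 0 ≤ s.nat aP 0 ∧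
      PrimOrder (I.ptDist (s.nat aPt)) (net m (s.nat aP 0) (s.real rRad) (s.real rT 0))
        (s'.nat aM 0) (s'.nat aY) (s'.real rKey) ∧
      ∀ j < s'.nat aM 0, s'.nat aLab j = compStart (s'.real rKey) (s.real rT 0) j := by
  refine (buildNet_spec.seq
    (T₂ := 20 * (s.nat aP 0 + 1) * (s.nat aP 0 + 1) + (5 * s.nat aP 0 + 2)) ?_).le (by nlinarith)
  intro s₁ hf₁ hbij
  have hM : s₁.nat aM 0 ≤ s.nat aP 0 := le_of_bijOn_net hbij
  refine ((prim_spec hbij).le (by gcongr)).seq ?_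
  intro s₂ hf₂ hprim
  refine labels_spec.mono (by rw [hf₂.nat aM]; omega) ?_
  intro s₃ hf₃ hlab
  rw [hf₁.nat aPt] at hprim
  rw [hf₂.nat aM, hf₂.real rT, hf₁.real rT] at hlab
  rw [hf₃.nat aM, hf₃.nat aY, hf₃.real rKey, hf₂.nat aM]
  exact ⟨hM, hprim, hlab⟩

end Cluster

/-! ### Augmenting paths -/

section Assign

variable {κ : Type*} {M : ℕ} {own : ℕ → ℕ}

/-- The component `l` is assigned to the class `c`. The number `own l` is `q + 1` if the component
is represented by the point at position `q`, and `0` if the component is not assigned. -/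
abbrev AssignedTo (cl : ℕ → κ) (own : ℕ → ℕ) (l : ℕ) (c : κ) : Prop :=
  own l ≠ 0 ∧ cl (own l - 1) = c

/-- The number of components that are assigned to the class `c`. -/
def assigned [DecidableEq κ] (M : ℕ) (cl : ℕ → κ) (own : ℕ → ℕ) (c : κ) : ℕ :=
  ((Finset.range M).filter fun l => AssignedTo cl own l c).card

/-- The assigned components are represented by one of their positions. -/
def ValidOwn (M : ℕ) (lb own : ℕ → ℕ) : Prop :=
  ∀ l < M, own l ≠ 0 → own l - 1 < M ∧ lb (own l - 1) = l

theorem assigned_update [DecidableEq κ] {cl : ℕ → κ} {l q : ℕ} (hl : l < M) (c : κ) :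
    assigned M cl (Function.update own l (q + 1)) c + (if AssignedTo cl own l c then 1 else 0) =
      assigned M cl own c + if cl q = c then 1 else 0 := by
  have hl := Finset.mem_range.2 hl
  have hrest : ∀ x ∈ (Finset.range M).erase l,
      (if AssignedTo cl (Function.update own l (q + 1)) x c then 1 else 0) =
        if AssignedTo cl own x c then 1 else 0 := by
    intro x hx
    simp only [AssignedTo, Function.update_of_ne (Finset.ne_of_mem_erase hx)]
  rw [assigned, assigned, Finset.card_filter, Finset.card_filter, ← Finset.add_sum_erase _ _ hl,
    ← Finset.add_sum_erase (Finset.range M) (fun l => if AssignedTo cl own l c then 1 else 0) hl,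
    Finset.sum_congr rfl hrest]
  simp only [AssignedTo, Function.update_self, Nat.add_sub_cancel, ne_eq, Nat.succ_ne_zero,
    not_false_eq_true, true_and]
  omega

theorem sum_assigned [DecidableEq κ] {cl : ℕ → κ} (R : Finset κ) :
    ∑ c ∈ R, assigned M cl own c =
      ((Finset.range M).filter fun l => own l ≠ 0 ∧ cl (own l - 1) ∈ R).card := by
  rw [Finset.card_eq_sum_card_fiberwise (f := fun l => cl (own l - 1)) (t := R)
    fun l hl => (Finset.mem_filter.1 (Finset.mem_coe.1 hl)).2.2]
  refine Finset.sum_congr rfl fun c hc => congrArg Finset.card ?_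
  ext l
  simp only [Finset.mem_filter]
  exact ⟨fun ⟨hl, h0, h⟩ => ⟨⟨hl, h0, h ▸ hc⟩, h⟩, fun ⟨⟨hl, h0, _⟩, h⟩ => ⟨hl, h0, h⟩⟩

theorem ValidOwn.update {lb : ℕ → ℕ} (h : ValidOwn M lb own) {q : ℕ} (hq : q < M) :
    ValidOwn M lb (Function.update own (lb q) (q + 1)) := by
  intro l hl h0
  rcases eq_or_ne l (lb q) with rfl | he
  · simp [hq]
  · rw [Function.update_of_ne he] at h0 ⊢
    exact h l hl h0

-- The classes reached by an unsuccessful search violate Hall's condition: every component that they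
-- meet is already assigned to one of them.
theorem PrimOrder.not_hallCondition {ι : Type*} [DecidableEq κ] {δ : ι → ι → ℝ}
    {Y : Finset ι} {y : ℕ → ι} {key : ℕ → ℝ} {t : ℝ} {col : ι → κ} {need : κ → ℕ} {K : Finset κ}
    {lb : ℕ → ℕ} (h : PrimOrder δ Y M y key) (hδ : ∀ a b, δ a b = δ b a)
    (hlb : ∀ q < M, lb q = compStart key t q) {R : Finset κ} (hR : R ⊆ K)
    (hclosed : ∀ q < M, col (y q) ∈ R → own (lb q) ≠ 0 ∧ col (y (own (lb q) - 1)) ∈ R)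
    (hle : ∀ c ∈ R, assigned M (col ∘ y) own c ≤ need c)
    (hlt : ∃ c ∈ R, assigned M (col ∘ y) own c < need c) :
    ¬ HallCondition (nearGraph δ Y t) Y col K need := by
  intro hall
  obtain ⟨S, hSY, hSR, hinj, hcard⟩ := hall R hR
  choose! pos hposM hpos using fun p (hp : p ∈ S) => h.bijOn.surjOn (Finset.mem_coe.2 (hSY hp))
  have hmaps : ∀ p ∈ S, lb (pos p) ∈
      (Finset.range M).filter fun l => own l ≠ 0 ∧ (col ∘ y) (own l - 1) ∈ R := by
    intro p hp
    refine Finset.mem_filter.2 ⟨Finset.mem_range.2 ?_,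
      hclosed _ (hposM p hp) ((hpos p hp).symm ▸ hSR p hp)⟩
    exact hlb _ (hposM p hp) ▸ (compStart_le _).trans_lt (hposM p hp)
  have hinj' : Set.InjOn (fun p => lb (pos p)) S := by
    intro p hp q hq hpq
    refine hinj hp hq (SimpleGraph.ConnectedComponent.eq.2 ?_)
    rw [← hpos p hp, ← hpos q hq, h.reachable_iff hδ (hposM p hp) (hposM q hq),
      ← hlb _ (hposM p hp), ← hlb _ (hposM q hq)]
    exact hpq
  have hSle := Finset.card_le_card_of_injOn _ hmaps hinj'
  have hsum := Finset.sum_lt_sum hle hlt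
  rw [sum_assigned] at hsum
  omega

end Assign

section Search

variable {m M r : ℕ} {cl lb own vis par que : ℕ → ℕ} {tail : ℕ}

/-- The position `q` leads to a visited class. -/
def Closed (cl lb own vis : ℕ → ℕ) (q : ℕ) : Prop :=
  own (lb q) ≠ 0 ∧ vis (cl (own (lb q) - 1)) ≠ 0

/-- The search has reached the unassigned component of the position `q`. -/
def Hit (M : ℕ) (cl lb own vis : ℕ → ℕ) (q : ℕ) : Prop :=
  q < M ∧ own (lb q) = 0 ∧ vis (cl q) ≠ 0

/-- The state of a breadth first search for an augmenting path that starts at the class `r`. The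
queue of classes is `que 0, …, que (tail - 1)`; `vis c` is `0` if `c` has not been visited and one
plus the position of `c` in the queue otherwise; `par c` is the position through which `c` has been
reached. -/
structure Bfs (m M : ℕ) (cl lb own : ℕ → ℕ) (r : ℕ) (vis par que : ℕ → ℕ) (tail : ℕ) : Prop where
  tail_pos : 0 < tail
  source : que 0 = r
  vis_le : ∀ c < m, vis c ≠ 0 → vis c ≤ tail ∧ que (vis c - 1) = c
  que_lt : ∀ i < tail, que i < m ∧ vis (que i) = i + 1
  parent : ∀ c < m, 2 ≤ vis c → par c < M ∧ AssignedTo cl own (lb (par c)) c ∧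
    0 < vis (cl (par c)) ∧ vis (cl (par c)) < vis c

theorem Closed.update (h : Closed cl lb own vis r) (c x : ℕ) :
    Closed cl lb own (Function.update vis c (x + 1)) r := by
  refine ⟨h.1, ?_⟩
  rw [Function.update_apply]
  split_ifs
  · exact x.succ_ne_zero
  · exact h.2

theorem Bfs.init (hr : r < m) (hvis : ∀ c < m, vis c = 0) :
    Bfs m M cl lb own r (Function.update vis r 1) par (Function.update que 0 r) 1 := by
  have hvis' : ∀ c < m, c ≠ r → Function.update vis r 1 c = 0 := fun c hc hne => by
    rw [Function.update_of_ne hne, hvis c hc]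
  refine ⟨one_pos, by simp, fun c hc hv => ?_, fun i hi => ?_, fun c hc hv => ?_⟩
  · obtain rfl : c = r := by_contra fun hne => hv (hvis' c hc hne)
    simp
  · obtain rfl : i = 0 := by omega
    simpa using hr
  · rcases eq_or_ne c r with rfl | hne
    · simp at hv
    · simp [hvis' c hc hne] at hv

theorem Bfs.vis_source (h : Bfs m M cl lb own r vis par que tail) : vis r = 1 := by
  rw [← h.source, (h.que_lt 0 h.tail_pos).2]

theorem Bfs.tail_le (h : Bfs m M cl lb own r vis par que tail) : tail ≤ m := by
  have hmaps : ∀ i ∈ Finset.range tail, que i ∈ Finset.range m := fun i hi =>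
    Finset.mem_range.2 (h.que_lt i (Finset.mem_range.1 hi)).1
  have hinj : Set.InjOn que (Finset.range tail) := by
    intro i hi j hj hij
    have hvi := (h.que_lt i (Finset.mem_range.1 hi)).2
    have hvj := (h.que_lt j (Finset.mem_range.1 hj)).2
    rw [hij] at hvi
    omega
  simpa using Finset.card_le_card_of_injOn _ hmaps hinj

theorem Bfs.push (h : Bfs m M cl lb own r vis par que tail) {q c : ℕ} (hq : q < M)
    (hcl : cl q < m) (hv : vis (cl q) ≠ 0) (hc : c < m) (hown : AssignedTo cl own (lb q) c)
    (hnew : vis c = 0) :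
    Bfs m M cl lb own r (Function.update vis c (tail + 1)) (Function.update par c q)
      (Function.update que tail c) (tail + 1) := by
  have hne : cl q ≠ c := by rintro rfl; exact hv hnew
  refine ⟨by omega, ?_, fun c' hc' hv' => ?_, fun i hi => ?_, fun c' hc' hv' => ?_⟩
  · rw [Function.update_of_ne h.tail_pos.ne, h.source]
  · rcases eq_or_ne c' c with rfl | hcc
    · simp
    · rw [Function.update_of_ne hcc] at hv' ⊢
      have := h.vis_le c' hc' hv'
      rw [Function.update_of_ne (by omega)]
      exact ⟨by omega, this.2⟩
  · rcases Nat.lt_succ_iff_lt_or_eq.1 hi with hi | rfl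
    · obtain ⟨hlt, hvi⟩ := h.que_lt i hi
      have hic : que i ≠ c := fun h' => by rw [h'] at hvi; omega
      rw [Function.update_of_ne hi.ne, Function.update_of_ne hic]
      exact ⟨hlt, hvi⟩
    · simpa using hc
  · rcases eq_or_ne c' c with rfl | hcc
    · simp only [Function.update_self, Function.update_of_ne hne]
      have := (h.vis_le _ hcl hv).1
      exact ⟨hq, hown, by omega, by omega⟩
    · simp only [Function.update_of_ne hcc] at hv' ⊢
      obtain ⟨hp, ho, hpos, hlt⟩ := h.parent c' hc' hv'
      have : cl (par c') ≠ c := fun h' => by rw [h', hnew] at hpos; exact hpos.false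
      rw [Function.update_of_ne this]
      exact ⟨hp, ho, hpos, hlt⟩

/-- The search has processed the first `head` classes of the queue and, for the class at position
`head`, the positions below `Q`; `found` is `1` if the search has been successful and `cur` is the
position at which it ended, otherwise `found` is `0`. -/
structure Scan (m M : ℕ) (cl lb own : ℕ → ℕ) (r : ℕ) (vis par que : ℕ → ℕ)
    (tail found cur head Q : ℕ) : Prop extends Bfs m M cl lb own r vis par que tail where
  closed : found = 0 → ∀ q < M, (∃ i < head, cl q = que i) ∨ q < Q ∧ cl q = que head →
    Closed cl lb own vis q
  hit : found ≠ 0 → found = 1 ∧ Hit M cl lb own vis cur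

variable {found cur head Q : ℕ}

theorem Scan.init (hr : r < m) (hvis : ∀ c < m, vis c = 0) :
    Scan m M cl lb own r (Function.update vis r 1) par (Function.update que 0 r) 1 0 cur 0 0 where
  toBfs := .init hr hvis
  closed := by simp
  hit := by simp

theorem Scan.succ_of_closed (h : Scan m M cl lb own r vis par que tail found cur head Q)
    (hQ : found = 0 → cl Q = que head → Closed cl lb own vis Q) :
    Scan m M cl lb own r vis par que tail found cur head (Q + 1) where
  toBfs := h.toBfs
  hit := h.hit
  closed h0 q hq hc := by
    rcases hc with hi | ⟨hqQ, he⟩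
    · exact h.closed h0 q hq (Or.inl hi)
    · rcases Nat.lt_succ_iff_lt_or_eq.1 hqQ with hlt | rfl
      · exact h.closed h0 q hq (Or.inr ⟨hlt, he⟩)
      · exact hQ h0 he

theorem Scan.push (h : Scan m M cl lb own r vis par que tail found cur head Q)
    (hQ : Q < M) (hht : head < tail) (hf : found = 0) (he : cl Q = que head) {c : ℕ} (hc : c < m)
    (hown : AssignedTo cl own (lb Q) c) (hnew : vis c = 0) :
    Scan m M cl lb own r (Function.update vis c (tail + 1)) (Function.update par c Q)
      (Function.update que tail c) (tail + 1) found cur head (Q + 1) where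
  toBfs := by
    obtain ⟨hlt, hv⟩ := h.que_lt head hht
    exact h.toBfs.push hQ (he ▸ hlt) (by rw [he, hv]; omega) hc hown hnew
  hit h0 := absurd hf h0
  closed _ q hq hc := by
    rcases hc with ⟨i, hi, hqi⟩ | ⟨hqQ, hqh⟩
    · rw [Function.update_of_ne (by omega)] at hqi
      exact (h.closed hf q hq (Or.inl ⟨i, hi, hqi⟩)).update _ _
    · rw [Function.update_of_ne hht.ne] at hqh
      rcases Nat.lt_succ_iff_lt_or_eq.1 hqQ with hlt | rfl
      · exact (h.closed hf q hq (Or.inr ⟨hlt, hqh⟩)).update _ _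
      · exact ⟨hown.1, by simp [hown.2]⟩

theorem Scan.succ_of_free (h : Scan m M cl lb own r vis par que tail found cur head Q)
    (hQ : Q < M) (hht : head < tail) (he : cl Q = que head) (hown : own (lb Q) = 0) :
    Scan m M cl lb own r vis par que tail 1 Q head (Q + 1) where
  toBfs := h.toBfs
  closed h0 := absurd h0 one_ne_zero
  hit _ := ⟨rfl, hQ, hown, by rw [he, (h.que_lt head hht).2]; omega⟩

theorem Scan.next (h : Scan m M cl lb own r vis par que tail found cur head M) :
    Scan m M cl lb own r vis par que tail found cur (head + 1) 0 where
  toBfs := h.toBfs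
  hit := h.hit
  closed h0 q hq hc := by
    obtain ⟨i, hi, he⟩ := hc.resolve_right fun h' => absurd h'.1 q.not_lt_zero
    rcases Nat.lt_succ_iff_lt_or_eq.1 hi with hlt | rfl
    · exact h.closed h0 q hq (Or.inl ⟨i, hlt, he⟩)
    · exact h.closed h0 q hq (Or.inr ⟨hq, he⟩)

theorem Scan.closed_of_finished (h : Scan m M cl lb own r vis par que tail found cur head Q)
    (hcl : ∀ q < M, cl q < m) (hht : tail ≤ head) (hf : found = 0) :
    ∀ q < M, vis (cl q) ≠ 0 → Closed cl lb own vis q := by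
  intro q hq hv
  obtain ⟨hle, he⟩ := h.vis_le _ (hcl q hq) hv
  exact h.closed hf q hq (Or.inl ⟨vis (cl q) - 1, by omega, he.symm⟩)

/-- The state while an augmenting path is being switched; `own₀` is the assignment at the start, and
the position `q` is going to represent its component. -/
structure Switch (m M : ℕ) (cl lb own₀ vis par own : ℕ → ℕ) (q : ℕ) : Prop where
  valid : ValidOwn M lb own
  lt : q < M
  visited : vis (cl q) ≠ 0
  count : ∀ c, assigned M cl own c =
    assigned M cl own₀ c + if AssignedTo cl own (lb q) c then 1 else 0
  path : ∀ c < m, 2 ≤ vis c → vis c ≤ vis (cl q) → AssignedTo cl own (lb (par c)) c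
  desc : own (lb q) ≠ 0 → vis (cl q) < vis (cl (own (lb q) - 1))

variable {own₀ : ℕ → ℕ} {q : ℕ}

theorem Bfs.switch (h : Bfs m M cl lb own r vis par que tail) (hval : ValidOwn M lb own)
    (hq : Hit M cl lb own vis q) : Switch m M cl lb own vis par own q where
  valid := hval
  lt := hq.1
  visited := hq.2.2
  count c := by simp [AssignedTo, hq.2.1]
  path c hc hv _ := (h.parent c hc hv).2.1
  desc h0 := absurd hq.2.1 h0

theorem Switch.count_update (h : Switch m M cl lb own₀ vis par own q)
    (hlb : ∀ q < M, lb q < M) (c : ℕ) :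
    assigned M cl (Function.update own (lb q) (q + 1)) c =
      assigned M cl own₀ c + if cl q = c then 1 else 0 := by
  have hupdate := assigned_update (cl := cl) (own := own) (q := q) (hlb q h.lt) c
  have hcount := h.count c
  omega

/-- The assignment `own` arises from `own₀` by assigning one more component to the class `r`. -/
structure Augmented (M : ℕ) (cl lb own₀ own : ℕ → ℕ) (r : ℕ) : Prop where
  valid : ValidOwn M lb own
  count : ∀ c, assigned M cl own c = assigned M cl own₀ c + if r = c then 1 else 0

theorem Switch.augmented (h : Switch m M cl lb own₀ vis par own q)
    (hb : Bfs m M cl lb own₀ r vis par que tail) (hlb : ∀ q < M, lb q < M) (hcl : ∀ q < M, cl q < m)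
    (hv : vis (cl q) < 2) :
    Augmented M cl lb own₀ (Function.update own (lb q) (q + 1)) r := by
  have hone : vis (cl q) = 1 := by have := h.visited; omega
  have hroot : cl q = r := by
    rw [← (hb.vis_le _ (hcl q h.lt) h.visited).2, hone, hb.source]
  exact ⟨h.valid.update h.lt, fun c => hroot ▸ h.count_update hlb c⟩

theorem Switch.next (h : Switch m M cl lb own₀ vis par own q)
    (hb : Bfs m M cl lb own₀ r vis par que tail)
    (hlb : ∀ q < M, lb q < M) (hcl : ∀ q < M, cl q < m) (hv : 2 ≤ vis (cl q)) :
    Switch m M cl lb own₀ vis par (Function.update own (lb q) (q + 1)) (par (cl q)) ∧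
      vis (cl (par (cl q))) < vis (cl q) := by
  obtain ⟨hlt, -, hpos, hdesc⟩ := hb.parent _ (hcl q h.lt) hv
  have hne : ∀ c < m, 2 ≤ vis c → vis c ≤ vis (cl q) → lb (par c) ≠ lb q := by
    intro c hc h2 hle he
    obtain ⟨h0, hc'⟩ := h.path c hc h2 hle
    rw [he] at h0 hc'
    have := h.desc h0
    rw [hc'] at this
    omega
  have hpar := h.path _ (hcl q h.lt) hv le_rfl
  have hpq := hne _ (hcl q h.lt) hv le_rfl
  refine ⟨⟨h.valid.update h.lt, hlt, by omega, fun c => ?_, fun c hc h2 hle => ?_, ?_⟩, hdesc⟩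
  · rw [h.count_update hlb]
    simp [AssignedTo, Function.update_of_ne hpq, hpar.1, hpar.2]
  · simpa only [AssignedTo, Function.update_of_ne (hne c hc h2 (by omega))] using
      h.path c hc h2 (by omega)
  · rw [Function.update_of_ne hpq, hpar.2]
    exact fun _ => hdesc

end Search

section Matching

variable {n m : ℕ} {I : Instance n m} {s s' : Store} {p : Prog} {Y : Finset ℕ} {t : ℝ} {r : ℕ}

/-- Set the first `e` entries of the array `a` to zero. -/
abbrev clear (a v : ℕ) (e : NExp) : Prog := .for v e (.nset a (.var v) (.lit 0))

theorem clear_spec {a v N : ℕ} {e : NExp} (hN : ∀ s', Frame (clear a v e) s s' → e.eval I s' = N)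
    (hav : a ≠ v) : Does I (clear a v e) s (3 * N + 2) fun s' => ∀ i < N, s'.nat a i = 0 := by
  refine (Does.for (T := 1) (fun j s' => ∀ i < j, s'.nat a i = 0) hN (by simp) ?_ (fun _ _ h => h)
    (by simp [Prog.natWrites, hav.symm]) (by simp [hav])).le (by omega)
  intro j _ s' _ hv h
  refine Does.of_wp ?_ le_rfl
  simpa only [Prog.wp, Store.nat_setNat_self, NExp.eval_get, NExp.eval_lit, hv] using
    forall_lt_succ_update (f := fun _ => 0) h rfl

/-- The class of the point at a position. -/
def NExp.cls (q : NExp) : NExp := .color (.get aPt (.get aY q))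

/-- The class of the point at a position, as a function. -/
def clsOf (I : Instance n m) (s : Store) : ℕ → ℕ := I.ptCol (s.nat aPt) ∘ s.nat aY

@[simp] theorem NExp.eval_cls (q : NExp) : (NExp.cls q).eval I s = clsOf I s (q.eval I s) := rfl

@[simp] theorem clsOf_setNat {a : ℕ} (hPt : aPt ≠ a) (hY : aY ≠ a) (i x : ℕ) :
    clsOf I (s.setNat a i x) = clsOf I s := by
  rw [clsOf, Store.nat_setNat_of_ne _ hPt, Store.nat_setNat_of_ne _ hY, clsOf]

theorem clsOf_frame (hf : Frame p s s') (hPt : aPt ∉ p.natWrites := by decide)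
    (hY : aY ∉ p.natWrites := by decide) : clsOf I s' = clsOf I s := by
  rw [clsOf, hf.nat aPt hPt, hf.nat aY hY, clsOf]

/-- Equality of natural numbers. -/
def BExp.neq (x y : NExp) : BExp := .and (.not (.nlt x y)) (.not (.nlt y x))

@[simp] theorem BExp.holds_neq (x y : NExp) :
    (BExp.neq x y).Holds I s ↔ x.eval I s = y.eval I s := by
  simp only [BExp.neq, BExp.holds_and, BExp.holds_not, BExp.holds_nlt]
  omega

/-- The memory holds an assignment of some of the components to classes. -/
structure PartialMatching (I : Instance n m) (s : Store) : Prop where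
  cls_lt : ∀ q < s.nat aM 0, clsOf I s q < m
  lab_lt : ∀ q < s.nat aM 0, s.nat aLab q < s.nat aM 0
  valid : ValidOwn (s.nat aM 0) (s.nat aLab) (s.nat aOwn)

theorem PartialMatching.frame (h : PartialMatching I s) (hf : Frame p s s')
    (hp : ∀ a ∈ [aPt, aM, aY, aLab, aOwn], a ∉ p.natWrites := by decide) :
    PartialMatching I s' := by
  simp only [List.forall_mem_cons] at hp
  obtain ⟨hPt, hM, hY, hLab, hOwn, -⟩ := hp
  constructor
  · rw [hf.nat aM hM, clsOf_frame hf hPt hY]; exact h.cls_lt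
  · rw [hf.nat aM hM, hf.nat aLab hLab]; exact h.lab_lt
  · rw [hf.nat aM hM, hf.nat aLab hLab, hf.nat aOwn hOwn]; exact h.valid

/-- The class that owns the component of the position `vQ`. -/
def ownerCls : NExp := .cls (.sub (.get aOwn (.get aLab (.var vQ))) (.lit 1))

/-- Look at the position `vQ` while the class at the head of the queue is scanned. -/
def bfsVisit : Prog := .ite
  (.and (.nlt (.var aFound) (.lit 1)) (.neq (.cls (.var vQ)) (.get aQue (.var aHead))))
  (.ite (.nlt (.lit 0) (.get aOwn (.get aLab (.var vQ))))
    (.ite (.nlt (.get aVis ownerCls) (.lit 1))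
      (.block [
        .nset aVis ownerCls (.add (.var aTail) (.lit 1)),
        .nset aPar ownerCls (.var vQ),
        .nset aQue (.var aTail) ownerCls,
        .incr aTail])
      .skip)
    (.block [.nass aFound (.lit 1), .nass aCur (.var vQ)]))
  .skip

/-- The memory holds the state of a breadth first search from the class `r` that has scanned the
positions below `Q` for the class at the head of the queue. -/
abbrev Scanning (I : Instance n m) (r Q : ℕ) (s : Store) : Prop :=
  Scan m (s.nat aM 0) (clsOf I s) (s.nat aLab) (s.nat aOwn) r (s.nat aVis) (s.nat aPar)
    (s.nat aQue) (s.nat aTail 0) (s.nat aFound 0) (s.nat aCur 0) (s.nat aHead 0) Q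

theorem bfsVisit_spec {Q : ℕ} (hm : PartialMatching I s) (hv : s.nat vQ 0 = Q)
    (hQ : Q < s.nat aM 0) (hht : s.nat aHead 0 < s.nat aTail 0) (h : Scanning I r Q s) :
    Does I bfsVisit s 11 fun s' =>
      Scanning I r (Q + 1) s' ∧ s'.nat aHead 0 < s'.nat aTail 0 := by
  refine Does.of_wp ?_
  simp only [bfsVisit, Prog.wp, Prog.block, BExp.holds_and, BExp.holds_nlt, BExp.holds_neq,
    NExp.eval_cls, NExp.eval_get, NExp.eval_lit, NExp.eval_add, NExp.eval_sub, ownerCls, hv,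
    Scanning, Store.nat_setNat_self, Store.nat_setNat_of_ne, clsOf_setNat, ne_eq, Nat.reduceEqDiff,
    not_false_eq_true, Function.update_self]
  refine ⟨fun ⟨_, he⟩ => ⟨fun h0 => ⟨fun hnew => ⟨?_, by omega⟩, fun hvis => ⟨?_, hht⟩⟩,
    fun h0 => ⟨?_, hht⟩⟩, fun hn => ⟨?_, hht⟩⟩
  · exact h.push hQ hht (by omega) he (hm.cls_lt _ (hm.valid _ (hm.lab_lt Q hQ) h0.ne').1)
      ⟨h0.ne', rfl⟩ (by omega)
  · exact h.succ_of_closed fun _ _ => ⟨h0.ne', by omega⟩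
  · exact h.succ_of_free hQ hht he (by omega)
  · exact h.succ_of_closed fun hf he => absurd ⟨by omega, he⟩ hn

/-- Scan the points of the class at the head of the queue. -/
def bfsScan : Prog := .for vQ (.var aM) bfsVisit

theorem bfsScan_spec (hm : PartialMatching I s) (hht : s.nat aHead 0 < s.nat aTail 0)
    (h : Scanning I r 0 s) :
    Does I bfsScan s (13 * s.nat aM 0 + 2) fun s' =>
      Scanning I r (s.nat aM 0) s' ∧ s'.nat aHead 0 < s'.nat aTail 0 := by
  refine (Does.for_var (T := 11) (fun Q s' => Scanning I r Q s' ∧ s'.nat aHead 0 < s'.nat aTail 0)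
    ⟨h, hht⟩ ?_ (fun s' _ h => h)
    (hInv := fun j s x h => by simpa [Scanning] using h)).le (by omega)
  rintro Q hQ s' hf hv ⟨h, hht⟩
  exact bfsVisit_spec (hm.frame hf) hv (by rwa [hf.nat aM]) hht h

/-- Prepare the search for an augmenting path that starts at the class `slot vJ`. -/
def bfsInit : Prog := .block [
  clear aVis vI .numClasses,
  .nset aQue (.lit 0) (.get aSlot (.var vJ)),
  .nset aVis (.get aSlot (.var vJ)) (.lit 1),
  .nass aHead (.lit 0),
  .nass aTail (.lit 1),
  .nass aFound (.lit 0)]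

theorem bfsInit_spec (hr : s.nat aSlot (s.nat vJ 0) = r) (hrm : r < m) :
    Does I bfsInit s (3 * m + 7) fun s' => Scanning I r 0 s' ∧ s'.nat aHead 0 = 0 := by
  refine ((clear_spec (N := m) (fun _ _ => rfl) (by decide)).seq (T₂ := 5) ?_).le (by omega)
  intro s₁ hf hvis
  rw [← hf.nat aSlot, ← hf.nat vJ] at hr
  refine Does.of_wp ?_
  simpa [Prog.wp, Prog.block, Scanning, hr] using Scan.init hrm hvis

/-- Search for an augmenting path that starts at the class `slot vJ`. -/
def bfs : Prog := .block [
  bfsInit,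
  .loop (.and (.nlt (.var aHead) (.var aTail)) (.nlt (.var aFound) (.lit 1)))
    (.block [bfsScan, .incr aHead])]

theorem bfs_spec (hm : PartialMatching I s) (hr : s.nat aSlot (s.nat vJ 0) = r) (hrm : r < m) :
    Does I bfs s (30 * m * (s.nat aM 0 + 1)) fun s' => Scanning I r 0 s' ∧
      (s'.nat aFound 0 = 0 → ∀ q < s'.nat aM 0, s'.nat aVis (clsOf I s' q) ≠ 0 →
        Closed (clsOf I s') (s'.nat aLab) (s'.nat aOwn) (s'.nat aVis) q) := by
  refine ((bfsInit_spec hr hrm).seq (T₂ := m * (13 * s.nat aM 0 + 4) + 1) ?_).le (by nlinarith)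
  rintro s₁ hf₁ ⟨hinit, hhead⟩
  refine (Does.while (T := 13 * s.nat aM 0 + 3) (Scanning I r 0) (fun s' => m - s'.nat aHead 0)
    hinit ?_ ?_).le (by simp [hhead])
  · rintro s' hf' h ⟨hht, -⟩
    have hm' := (hm.frame hf₁).frame hf'
    rw [← hf₁.nat aM, ← hf'.nat aM]
    refine (bfsScan_spec hm' hht h).seq (T₂ := 1) ?_
    rintro s'' hf'' ⟨hscan, hht'⟩
    rw [← hf''.nat aM] at hscan
    refine Does.of_wp ?_
    simp only [Prog.block, Prog.wp, Scanning, NExp.eval_add, NExp.eval_get, NExp.eval_lit,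
      Store.nat_setNat_self, Store.nat_setNat_of_ne, clsOf_setNat, ne_eq, Nat.reduceEqDiff,
      not_false_eq_true, Function.update_self]
    have htail := hscan.tail_le
    have hhead' : s''.nat aHead = s'.nat aHead := hf''.nat aHead
    exact ⟨hscan.next, by rw [hhead'] at hht' ⊢; omega⟩
  · intro s' hf' h hend
    refine ⟨h, fun hfound => h.closed_of_finished ((hm.frame hf₁).frame hf').cls_lt ?_ hfound⟩
    simp only [BExp.holds_and, BExp.holds_nlt, NExp.eval_get, NExp.eval_lit, hfound] at hend
    omega

/-- Let the position `aCur` represent its component and move on along the augmenting path. -/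
def switchStep : Prog := .block [
  .nset aOwn (.get aLab (.var aCur)) (.add (.var aCur) (.lit 1)),
  .ite (.nlt (.get aVis (.cls (.var aCur))) (.lit 2))
    (.nass aFound (.lit 2))
    (.nass aCur (.get aPar (.cls (.var aCur))))]

/-- Switch along the augmenting path that has been found. -/
def switch : Prog := .loop (.nlt (.var aFound) (.lit 2)) switchStep

/-- The invariant of `switch`: the end of the path is signalled by `aFound = 2`. -/
def Switching (I : Instance n m) (own₀ : ℕ → ℕ) (r : ℕ) (s : Store) : Prop :=
  if s.nat aFound 0 < 2 then
    Switch m (s.nat aM 0) (clsOf I s) (s.nat aLab) own₀ (s.nat aVis) (s.nat aPar) (s.nat aOwn)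
      (s.nat aCur 0)
  else Augmented (s.nat aM 0) (clsOf I s) (s.nat aLab) own₀ (s.nat aOwn) r

/-- The number of steps that `switch` still has to make is at most this. -/
def switchRank (I : Instance n m) (s : Store) : ℕ :=
  if s.nat aFound 0 < 2 then s.nat aVis (clsOf I s (s.nat aCur 0)) else 0

theorem switchStep_spec {own₀ que : ℕ → ℕ} {tail : ℕ} (hfound : s.nat aFound 0 < 2)
    (hcl : ∀ q < s.nat aM 0, clsOf I s q < m) (hlb : ∀ q < s.nat aM 0, s.nat aLab q < s.nat aM 0)
    (hb : Bfs m (s.nat aM 0) (clsOf I s) (s.nat aLab) own₀ r (s.nat aVis) (s.nat aPar) que tail)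
    (h : Switching I own₀ r s) :
    Does I switchStep s 4 fun s' => Switching I own₀ r s' ∧ switchRank I s' < switchRank I s := by
  rw [Switching, if_pos hfound] at h
  refine Does.of_wp ?_
  simp only [switchStep, Prog.wp, Prog.block, BExp.holds_nlt, NExp.eval_cls, NExp.eval_get,
    NExp.eval_lit, NExp.eval_add, Switching, switchRank, clsOf_setNat, Store.nat_setNat_self,
    Store.nat_setNat_of_ne, ne_eq, Nat.reduceEqDiff, not_false_eq_true, Function.update_self,
    if_pos hfound, lt_irrefl, if_false]
  exact ⟨fun hv => ⟨h.augmented hb hlb hcl hv, Nat.pos_of_ne_zero h.visited⟩,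
    fun hv => h.next hb hlb hcl (not_lt.1 hv)⟩

theorem switch_spec {que : ℕ → ℕ} {tail : ℕ} (hm : PartialMatching I s)
    (hb : Bfs m (s.nat aM 0) (clsOf I s) (s.nat aLab) (s.nat aOwn) r (s.nat aVis) (s.nat aPar) que
      tail)
    (hfound : s.nat aFound 0 = 1)
    (hhit : Hit (s.nat aM 0) (clsOf I s) (s.nat aLab) (s.nat aOwn) (s.nat aVis) (s.nat aCur 0)) :
    Does I switch s (5 * m + 1) fun s' =>
      Augmented (s.nat aM 0) (clsOf I s) (s.nat aLab) (s.nat aOwn) (s'.nat aOwn) r := by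
  have hlt : s.nat aFound 0 < 2 := by omega
  have hrank : switchRank I s ≤ m := by
    rw [switchRank, if_pos hlt]
    exact (hb.vis_le _ (hm.cls_lt _ hhit.1) hhit.2.2).1.trans hb.tail_le
  refine (Does.while (T := 4) (Switching I (s.nat aOwn) r) (switchRank I) ?_ ?_ ?_).le (by omega)
  · rw [Switching, if_pos hlt]
    exact hb.switch hm.valid hhit
  · intro s' hf h hcond
    have hcls := clsOf_frame (I := I) hf
    refine switchStep_spec (que := que) (tail := tail) hcond ?_ ?_ ?_ h
    · rw [hf.nat aM, hcls]; exact hm.cls_lt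
    · rw [hf.nat aM, hf.nat aLab]; exact hm.lab_lt
    · rw [hf.nat aM, hcls, hf.nat aLab, hf.nat aVis, hf.nat aPar]; exact hb
  · intro s' hf h hend
    have hend : ¬ s'.nat aFound 0 < 2 := hend
    rw [Switching, if_neg hend] at h
    rwa [hf.nat aM, clsOf_frame hf, hf.nat aLab] at h

/-- The memory holds the points of `Y` and their components for the threshold `t`. -/
structure Clustered (I : Instance n m) (Y : Finset ℕ) (t : ℝ) (s : Store) : Prop where
  pt_lt : ∀ p ∈ Y, s.nat aPt p < n
  order : PrimOrder (I.ptDist (s.nat aPt)) Y (s.nat aM 0) (s.nat aY) (s.real rKey)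
  lab_eq : ∀ q < s.nat aM 0, s.nat aLab q = compStart (s.real rKey) t q

theorem Clustered.frame (h : Clustered I Y t s) (hf : Frame p s s')
    (hp : ∀ a ∈ [aPt, aM, aY, aLab], a ∉ p.natWrites := by decide)
    (hr : rKey ∉ p.realWrites := by decide) : Clustered I Y t s' := by
  simp only [List.forall_mem_cons] at hp
  obtain ⟨hPt, hM, hY, hLab, -⟩ := hp
  constructor
  · rw [hf.nat aPt hPt]; exact h.pt_lt
  · rw [hf.nat aPt hPt, hf.nat aM hM, hf.nat aY hY, hf.real rKey hr]; exact h.order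
  · rw [hf.nat aM hM, hf.nat aLab hLab, hf.real rKey hr]; exact h.lab_eq

theorem Clustered.partialMatching (h : Clustered I Y t s)
    (hval : ValidOwn (s.nat aM 0) (s.nat aLab) (s.nat aOwn)) : PartialMatching I s where
  cls_lt _ hq := I.col_lt (h.pt_lt _ (h.order.bijOn.mapsTo hq))
  lab_lt q hq := h.lab_eq q hq ▸ (compStart_le q).trans_lt hq
  valid := hval

theorem Clustered.not_rich (h : Clustered I Y t s) (hm : PartialMatching I s)
    (hscan : Scanning I r 0 s) (hclosed : ∀ q < s.nat aM 0, s.nat aVis (clsOf I s q) ≠ 0 →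
      Closed (clsOf I s) (s.nat aLab) (s.nat aOwn) (s.nat aVis) q)
    (hrm : r < m) (hle : ∀ c < m, assigned (s.nat aM 0) (clsOf I s) (s.nat aOwn) c ≤ I.quo c)
    (hlt : assigned (s.nat aM 0) (clsOf I s) (s.nat aOwn) r < I.quo r) :
    ¬ Rich I (s.nat aPt) Y t := by
  refine h.order.not_hallCondition (isPseudoDist_ptDist h.pt_lt).comm h.lab_eq
    (R := (Finset.range m).filter fun c => s.nat aVis c ≠ 0) (own := s.nat aOwn)
    (Finset.filter_subset _ _) ?_ ?_ ?_
  · intro q hq hc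
    obtain ⟨h0, hvis⟩ := hclosed q hq (Finset.mem_filter.1 hc).2
    exact ⟨h0, Finset.mem_filter.2
      ⟨Finset.mem_range.2 (hm.cls_lt _ (hm.valid _ (hm.lab_lt q hq) h0).1), hvis⟩⟩
  · exact fun c hc => hle c (Finset.mem_range.1 (Finset.mem_filter.1 hc).1)
  · exact ⟨r, Finset.mem_filter.2 ⟨Finset.mem_range.2 hrm, by rw [hscan.vis_source]; simp⟩, hlt⟩

/-- Either every class `c` has `need c` components, or it has been reported that the class quotas
cannot be met. -/
def MatchState (I : Instance n m) (Y : Finset ℕ) (t : ℝ) (need : ℕ → ℕ) (s : Store) : Prop :=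
  (s.nat aOk 0 = 1 ∧ ValidOwn (s.nat aM 0) (s.nat aLab) (s.nat aOwn) ∧
    ∀ c < m, assigned (s.nat aM 0) (clsOf I s) (s.nat aOwn) c = need c) ∨
  (s.nat aOk 0 = 0 ∧ ¬ Rich I (s.nat aPt) Y t)

/-- Assign one more component to the class `slot vJ`, or report a failure. -/
def augment : Prog := .block [bfs, .ite (.nlt (.var aFound) (.lit 1)) (.nass aOk (.lit 0)) switch]

theorem augment_spec (hc : Clustered I Y t s) (hr : s.nat aSlot (s.nat vJ 0) = r) (hrm : r < m)
    (hok : s.nat aOk 0 = 1) (hval : ValidOwn (s.nat aM 0) (s.nat aLab) (s.nat aOwn))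
    (hle : ∀ c < m, assigned (s.nat aM 0) (clsOf I s) (s.nat aOwn) c ≤ I.quo c)
    (hlt : assigned (s.nat aM 0) (clsOf I s) (s.nat aOwn) r < I.quo r) :
    Does I augment s (40 * m * (s.nat aM 0 + 1)) <| MatchState I Y t fun c =>
      assigned (s.nat aM 0) (clsOf I s) (s.nat aOwn) c + if r = c then 1 else 0 := by
  have hm := hc.partialMatching hval
  refine ((bfs_spec hm hr hrm).seq (T₂ := 5 * m + 1 + 1) ?_).le (by nlinarith)
  rintro s₁ hf₁ ⟨hscan, hclosed⟩
  have hm₁ := hm.frame hf₁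
  have hc₁ := hc.frame hf₁
  rw [← hf₁.nat aOwn, ← hf₁.nat aM, ← clsOf_frame (I := I) hf₁] at *
  refine Does.ite (fun hfail => ?_) (fun hfound => ?_)
  · have hnr := hc₁.not_rich hm₁ hscan (hclosed (Nat.lt_one_iff.1 hfail)) hrm hle hlt
    refine Does.of_wp (Or.inr ?_) (by simp [Prog.cost])
    simpa using hnr
  · obtain ⟨hfound, hhit⟩ := hscan.hit fun h => hfound (by simp [h])
    refine (switch_spec hm₁ hscan.toBfs hfound hhit).mono le_rfl fun s₂ hf₂ haug => Or.inl ?_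
    rw [hf₂.nat aOk, hf₁.nat aOk, hf₂.nat aM, hf₂.nat aLab, clsOf_frame hf₂]
    exact ⟨hok, haug.valid, fun c _ => haug.count c⟩

/-- The list `slot 0, …, slot (N - 1)` of classes contains each class `c < m` exactly `need c`
times. -/
structure IsSlots (m N : ℕ) (need slot : ℕ → ℕ) : Prop where
  lt : ∀ j < N, slot j < m
  count : ∀ c < m, Nat.count (slot · = c) N = need c

theorem IsSlots.count_le {N : ℕ} {need slot : ℕ → ℕ} (h : IsSlots m N need slot) {j c : ℕ}
    (hj : j ≤ N) (hc : c < m) : Nat.count (slot · = c) j ≤ need c :=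
  (Nat.count_monotone _ hj).trans_eq (h.count c hc)

/-- Assign a component to the class `slot vJ` unless a failure has been reported. -/
def assignStep : Prog := .ite (.nlt (.lit 0) (.var aOk)) augment .skip

theorem assignStep_spec {j : ℕ} (hc : Clustered I Y t s) (hslot : IsSlots m I.k I.quo (s.nat aSlot))
    (hj : j < I.k) (hv : s.nat vJ 0 = j)
    (h : MatchState I Y t (fun c => Nat.count (s.nat aSlot · = c) j) s) :
    Does I assignStep s (40 * m * (s.nat aM 0 + 1) + 1) <|
      MatchState I Y t fun c => Nat.count (s.nat aSlot · = c) (j + 1) := by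
  have hrm := hslot.lt j hj
  refine Does.ite (fun hok => ?_) (fun hok => ?_)
  · obtain ⟨hok, hval, hcount⟩ := h.resolve_right fun h' => hok.ne' h'.1
    refine (augment_spec hc (hv ▸ rfl) hrm hok hval ?_ ?_).mono le_rfl fun s' _ h' =>
      h'.imp_left fun ⟨hok', hval', hcount'⟩ => ⟨hok', hval', fun c hcm => ?_⟩
    · exact fun c hcm => (hcount c hcm).trans_le (hslot.count_le hj.le hcm)
    · have := hslot.count_le hj hrm
      rw [Nat.count_succ, if_pos rfl] at this
      rw [hcount _ hrm]
      exact this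
    · simp only [hcount' c hcm, hcount c hcm, Nat.count_succ]
  · have hm : 0 < m := (Nat.zero_le _).trans_lt hrm
    have hcost : 1 ≤ 40 * m * (s.nat aM 0 + 1) := Nat.succ_le_of_lt (by positivity)
    exact Does.of_wp (p := .skip) (Or.inr (h.resolve_left fun h' => hok (by simp [h'.1]))) hcost

/-- Assign components to all classes, or report a failure. -/
def assignAll : Prog := .block [.nass aOk (.lit 1), clear aOwn vI (.var aM), .for vJ (.var aK)
  assignStep]

theorem assignAll_spec (hc : Clustered I Y t s) (hk : s.nat aK 0 = I.k)
    (hslot : IsSlots m I.k I.quo (s.nat aSlot)) :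
    Does I assignAll s (60 * (I.k * m + 1) * (s.nat aM 0 + 1)) (MatchState I Y t I.quo) := by
  have hkm : I.k ≤ I.k * m := by
    rcases Nat.eq_zero_or_pos I.k with h | h
    · omega
    · exact Nat.le_mul_of_pos_right _ (by have := hslot.lt 0 h; omega)
  refine ((Does.nass aOk (.lit 1)).seq (T₂ := (3 * s.nat aM 0 + 2) +
    (I.k * (40 * m * (s.nat aM 0 + 1) + 1 + 2) + 2)) ?_).le (by nlinarith)
  intro s₁ hf₁ hok
  refine (clear_spec (fun s' hf => by simp [hf.nat aM, hf₁.nat aM]) (by decide)).seq ?_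
  intro s₂ hf₂ hown
  have hok₂ : s₂.nat aOk 0 = 1 := by simp [hf₂.nat aOk, hok]
  have hc₂ := (hc.frame hf₁).frame hf₂
  rw [← hf₁.nat aK, ← hf₂.nat aK] at hk
  rw [← hf₁.nat aSlot, ← hf₂.nat aSlot] at hslot
  rw [← hf₁.nat aM, ← hf₂.nat aM] at hown ⊢
  rw [← hk]
  refine Does.for_var (fun j => MatchState I Y t fun c => Nat.count (s₂.nat aSlot · = c) j) ?_ ?_ ?_
    (hInv := fun j s x h => by simpa [MatchState] using h)
  · refine Or.inl ⟨hok₂, fun l hl h => absurd (hown l hl) h, fun c _ => ?_⟩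
    simp only [Nat.count_zero]
    exact Finset.card_eq_zero.2 (Finset.filter_eq_empty_iff.2 fun l hl h =>
      h.1 (hown l (Finset.mem_range.1 hl)))
  · intro j hj s' hf hv h
    rw [← hf.nat aSlot] at h hslot ⊢
    rw [← hf.nat aM]
    exact assignStep_spec (hc₂.frame hf) hslot (hk ▸ hj) hv h
  · rintro s' - (⟨hok', hval, hcount⟩ | hfail)
    · exact Or.inl ⟨hok', hval, fun c hcm => by simp only [hcount c hcm, hk, hslot.count c hcm]⟩
    · exact Or.inr hfail

end Matching

/-! ### Testing a threshold -/

section Transversal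

variable {ι κ : Type*} [DecidableEq κ] {δ : ι → ι → ℝ} {Y S : Finset ι} {t : ℝ} {col : ι → κ}
  {K : Finset κ} {need : κ → ℕ}

/-- `S` consists of points in different components of the threshold graph and contains `need c`
points of each class `c ∈ K`. -/
structure IsTransversal (δ : ι → ι → ℝ) (Y : Finset ι) (t : ℝ) (col : ι → κ) (K : Finset κ)
    (need : κ → ℕ) (S : Finset ι) : Prop where
  subset : S ⊆ Y
  injOn : Set.InjOn (nearGraph δ Y t).connectedComponentMk S
  count : ∀ c ∈ K, (S.filter fun p => col p = c).card = need c

theorem IsTransversal.le_dist (h : IsTransversal δ Y t col K need S)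
    (hδ : ∀ a b, δ a b = δ b a) {p q : ι} (hp : p ∈ S) (hq : q ∈ S) (hpq : p ≠ q) :
    t ≤ δ p q := by
  by_contra! hlt
  have hadj := (nearGraph_adj hδ).2 ⟨hpq, h.subset hp, h.subset hq, hlt⟩
  exact hpq (h.injOn hp hq (SimpleGraph.ConnectedComponent.eq.2 hadj.reachable))

theorem IsTransversal.hallCondition (h : IsTransversal δ Y t col K need S) :
    HallCondition (nearGraph δ Y t) Y col K need := by
  intro R hR
  have hmaps : ∀ p ∈ S.filter (fun p => col p ∈ R), col p ∈ R := fun p hp =>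
    (Finset.mem_filter.1 hp).2
  refine ⟨S.filter fun p => col p ∈ R, (Finset.filter_subset _ _).trans h.subset, hmaps,
    h.injOn.mono (Finset.coe_subset.2 (Finset.filter_subset _ _)), le_of_eq ?_⟩
  rw [Finset.card_eq_sum_card_fiberwise hmaps]
  refine Finset.sum_congr rfl fun c hc => ?_
  rw [← h.count c (hR hc), Finset.filter_filter]
  congr 1
  exact Finset.filter_congr fun p _ => ⟨fun hp => ⟨hp ▸ hc, hp⟩, And.right⟩

variable {M : ℕ} {y : ℕ → ι} {own lb : ℕ → ℕ} {key : ℕ → ℝ}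

theorem PrimOrder.eq_of_reachable_representatives (h : PrimOrder δ Y M y key)
    (hδ : ∀ a b, δ a b = δ b a) (hlb : ∀ q < M, lb q = compStart key t q)
    (hval : ValidOwn M lb own) {l l' : ℕ} (hl : l < M) (hl' : l' < M) (h0 : own l ≠ 0)
    (h0' : own l' ≠ 0)
    (hr : (nearGraph δ Y t).Reachable (y (own l - 1)) (y (own l' - 1))) : l = l' := by
  obtain ⟨hq, hlab⟩ := hval l hl h0
  obtain ⟨hq', hlab'⟩ := hval l' hl' h0'
  rw [← hlab, ← hlab', hlb _ hq, hlb _ hq']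
  exact (h.reachable_iff hδ hq hq').1 hr

variable [DecidableEq ι]

/-- The points that represent the components below `M` that have an owner. -/
def representatives (M : ℕ) (y : ℕ → ι) (own : ℕ → ℕ) : Finset ι :=
  ((Finset.range M).filter fun l => own l ≠ 0).image fun l => y (own l - 1)

theorem representatives_succ_of_ne_zero (h : own M ≠ 0) :
    representatives (M + 1) y own = insert (y (own M - 1)) (representatives M y own) := by
  rw [representatives, Finset.range_add_one, Finset.filter_insert, if_pos h, Finset.image_insert,
    representatives]

theorem representatives_succ_of_eq_zero (h : own M = 0) :
    representatives (M + 1) y own = representatives M y own := by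
  rw [representatives, Finset.range_add_one, Finset.filter_insert, if_neg (not_not.2 h),
    representatives]

theorem PrimOrder.isTransversal (h : PrimOrder δ Y M y key) (hδ : ∀ a b, δ a b = δ b a)
    (hlb : ∀ q < M, lb q = compStart key t q) (hval : ValidOwn M lb own)
    (hcount : ∀ c ∈ K, assigned M (col ∘ y) own c = need c) :
    IsTransversal δ Y t col K need (representatives M y own) := by
  have hinj := fun {l l'} => h.eq_of_reachable_representatives hδ hlb hval (l := l) (l' := l')
  constructor
  · simp only [representatives, Finset.subset_iff, Finset.mem_image, Finset.mem_filter,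
      Finset.mem_range]
    rintro _ ⟨l, ⟨hl, h0⟩, rfl⟩
    exact h.bijOn.mapsTo (hval l hl h0).1
  · simp only [representatives, Set.InjOn, Finset.mem_coe, Finset.mem_image, Finset.mem_filter,
      Finset.mem_range]
    rintro _ ⟨l, ⟨hl, h0⟩, rfl⟩ _ ⟨l', ⟨hl', h0'⟩, rfl⟩ he
    rw [hinj hl hl' h0 h0' (SimpleGraph.ConnectedComponent.eq.1 he)]
  · intro c hc
    rw [← hcount c hc, representatives, Finset.filter_image, Finset.filter_filter,
      Finset.card_image_of_injOn, assigned]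
    · rfl
    · simp only [Set.InjOn, Finset.mem_coe, Finset.mem_filter, Finset.mem_range]
      rintro l ⟨hl, h0, -⟩ l' ⟨hl', h0', -⟩ he
      exact hinj hl hl' h0 h0' (he ▸ .refl _)

end Transversal

section Test

variable {n m : ℕ} {I : Instance n m} {s s' : Store} {p : Prog}

theorem IsTransversal.isFair {pt : ℕ → ℕ} {Y S : Finset ℕ} {t : ℝ}
    (h : IsTransversal (I.ptDist pt) Y t (I.ptCol pt) (Finset.range m) I.quo S) (ht : 0 < t)
    (hpt : ∀ p ∈ Y, pt p < n) {A : Finset (Fin n)}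
    (hA : ∀ u : Fin n, u ∈ A ↔ ∃ p ∈ S, pt p = u) : I.IsFair A := by
  have hinj : Set.InjOn pt S := fun p hp q hq hpq => by
    by_contra hne
    have hle := h.le_dist (isPseudoDist_ptDist hpt).comm hp hq hne
    rw [Instance.ptDist, hpq, I.d_self] at hle
    exact hle.not_gt ht
  intro i
  rw [← I.quo_coe, ← h.count i (Finset.mem_range.2 i.2), ← Finset.card_map Fin.valEmbedding,
    ← Finset.card_image_of_injOn (hinj.mono (Finset.coe_subset.2 (Finset.filter_subset _ _)))]
  congr 1
  ext u
  simp only [Finset.mem_map, Finset.mem_inter, Instance.group, Finset.mem_filter,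
    Finset.mem_univ, true_and, Finset.mem_image, hA, Fin.valEmbedding_apply, Fin.ext_iff]
  constructor
  · rintro ⟨u, ⟨⟨p, hp, hpu⟩, hi⟩, rfl⟩
    exact ⟨p, ⟨hp, by rw [Instance.ptCol, hpu, I.col_coe, hi]⟩, hpu⟩
  · rintro ⟨p, ⟨hp, hi⟩, rfl⟩
    refine ⟨⟨pt p, hpt p (h.subset hp)⟩, ⟨⟨p, hp, rfl⟩, ?_⟩, rfl⟩
    rw [← hi, ← I.col_coe]

/-- The memory holds a solution for the threshold `t`. -/
def Solves (I : Instance n m) (Y : Finset ℕ) (t : ℝ) (s : Store) : Prop :=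
  IsTransversal (I.ptDist (s.nat aPt)) Y t (I.ptCol (s.nat aPt)) (Finset.range m) I.quo
    (representatives (s.nat aM 0) (s.nat aY) (s.nat aOwn))

theorem Clustered.solves {Y : Finset ℕ} {t : ℝ} (hc : Clustered I Y t s)
    (h : MatchState I Y t I.quo s) (hok : s.nat aOk 0 ≠ 0) : Solves I Y t s := by
  obtain ⟨-, hval, hcount⟩ := h.resolve_right fun h => hok h.1
  exact hc.order.isTransversal (isPseudoDist_ptDist hc.pt_lt).comm hc.lab_eq hval
    fun c hcm => hcount c (Finset.mem_range.1 hcm)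

/-- The memory holds the list of the required classes and a list of points. -/
structure Ready (I : Instance n m) (s : Store) : Prop where
  k_eq : s.nat aK 0 = I.k
  slots : IsSlots m I.k I.quo (s.nat aSlot)
  card_le : s.nat aP 0 ≤ I.k * m
  pt_lt : ∀ p < s.nat aP 0, s.nat aPt p < n

theorem Ready.frame (h : Ready I s) (hf : Frame p s s')
    (hp : ∀ a ∈ [aK, aSlot, aP, aPt], a ∉ p.natWrites := by decide) : Ready I s' := by
  simp only [List.forall_mem_cons] at hp
  obtain ⟨hK, hSlot, hP, hPt, -⟩ := hp
  constructor
  · rw [hf.nat aK hK]; exact h.k_eq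
  · rw [hf.nat aSlot hSlot]; exact h.slots
  · rw [hf.nat aP hP]; exact h.card_le
  · rw [hf.nat aP hP, hf.nat aPt hPt]; exact h.pt_lt

/-- The net for the threshold `t` of the points in the memory. -/
noncomputable def netAt (m : ℕ) (s : Store) (t : ℝ) : Finset ℕ :=
  net m (s.nat aP 0) (s.real rRad) t

theorem netAt_frame (hf : Frame p s s') (hP : aP ∉ p.natWrites := by decide)
    (hRad : rRad ∉ p.realWrites := by decide) : netAt m s' = netAt m s := by
  funext t
  rw [netAt, hf.nat aP hP, hf.real rRad hRad, netAt]

/-- The threshold `t` passes the test. -/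
def Passes (I : Instance n m) (s : Store) (t : ℝ) : Prop :=
  Rich I (s.nat aPt) (netAt m s t) t

theorem passes_frame (hf : Frame p s s') (hP : aP ∉ p.natWrites := by decide)
    (hPt : aPt ∉ p.natWrites := by decide) (hRad : rRad ∉ p.realWrites := by decide) :
    Passes I s' = Passes I s := by
  funext t
  rw [Passes, hf.nat aPt hPt, netAt_frame hf hP hRad, Passes]

/-- Test whether the threshold `rT` can be reached. -/
def test : Prog := .block [cluster, assignAll]

theorem test_spec (h : Ready I s) :
    Does I test s (100 * (I.k * m + 1) * (I.k * m + 1)) fun s' =>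
      s'.nat aM 0 ≤ s.nat aP 0 ∧ Clustered I (netAt m s (s.real rT 0)) (s.real rT 0) s' ∧
      MatchState I (netAt m s (s.real rT 0)) (s.real rT 0) I.quo s' := by
  have hcluster : 40 * (s.nat aP 0 + 1) * (s.nat aP 0 + 1) ≤ 40 * (I.k * m + 1) * (I.k * m + 1) :=
    by gcongr <;> exact h.card_le
  refine ((cluster_spec.le hcluster).seq (T₂ := 60 * (I.k * m + 1) * (I.k * m + 1)) ?_).le
    (by nlinarith)
  rintro s₁ hf₁ ⟨hM, horder, hlab⟩
  have hr := h.frame hf₁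
  have hc : Clustered I (netAt m s (s.real rT 0)) (s.real rT 0) s₁ := by
    refine ⟨fun p hp => ?_, ?_, hlab⟩
    · rw [hf₁.nat aPt]
      exact h.pt_lt p (mem_net.1 hp).1
    · rw [hf₁.nat aPt]
      exact horder
  refine (assignAll_spec hc hr.k_eq hr.slots).mono ?_ fun s₂ hf₂ hmatch =>
    ⟨by rwa [hf₂.nat aM], hc.frame hf₂, hmatch⟩
  gcongr
  exact hM.trans h.card_le

theorem passes_of_test {s₁ : Store} {t : ℝ} (hc : Clustered I (netAt m s t) t s₁)
    (h : MatchState I (netAt m s t) t I.quo s₁) (hPt : s₁.nat aPt = s.nat aPt) :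
    Passes I s t ↔ s₁.nat aOk 0 ≠ 0 := by
  refine ⟨fun hp hok => ?_, fun hok => ?_⟩
  · rcases h with ⟨hok', -⟩ | ⟨-, hn⟩
    · omega
    · exact hn (by rwa [hPt])
  · rw [Passes, ← hPt]
    exact (hc.solves h hok).hallCondition

/-- Write the elements that have been found to the output. -/
def writeOut : Prog :=
  .for vI (.var aM) (.ite (.nlt (.lit 0) (.get aOwn (.var vI)))
    (.nset 0 (.get aPt (.get aY (.sub (.get aOwn (.var vI)) (.lit 1)))) (.lit 1)) .skip)

theorem writeOut_spec (h0 : ∀ u, s.nat 0 u = 0) :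
    Does I writeOut s (5 * s.nat aM 0 + 2) fun s' => ∀ u, s'.nat 0 u = 1 ↔
      ∃ p ∈ representatives (s.nat aM 0) (s.nat aY) (s.nat aOwn), s.nat aPt p = u := by
  refine (Does.for_var (T := 3) (fun L s' => ∀ u, s'.nat 0 u = 1 ↔
    ∃ p ∈ representatives L (s.nat aY) (s.nat aOwn), s.nat aPt p = u) ?_ ?_
    fun _ _ h => h).le (by omega)
  · simp [h0, representatives]
  · intro L _ s' hf hv h
    refine Does.of_wp ⟨fun hown => ?_, fun hown => ?_⟩
    all_goals simp only [BExp.holds_nlt, NExp.eval_get, NExp.eval_lit, hv, hf.nat aOwn] at hown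
    · simp only [Prog.wp, NExp.eval_get, NExp.eval_lit, NExp.eval_sub, hv, hf.nat aOwn, hf.nat aPt,
        hf.nat aY, Store.nat_setNat_self]
      intro u
      rw [representatives_succ_of_ne_zero hown.ne', Finset.exists_mem_insert, ← h u,
        Function.update_apply]
      split_ifs with hu
      · simp [hu]
      · simp [Ne.symm hu]
    · rw [representatives_succ_of_eq_zero (Nat.eq_zero_of_not_pos hown)]
      exact h

end Test

/-! ### Searching the candidates -/

section Median

variable {N : ℕ} {cand : ℕ → ℝ} {lo hi c : ℝ}

/-- The candidates strictly between `lo` and `hi`. -/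
noncomputable def inside (N : ℕ) (cand : ℕ → ℝ) (lo hi : ℝ) : Finset ℕ :=
  (Finset.range N).filter fun a => lo < cand a ∧ cand a < hi

theorem mem_inside {a : ℕ} : a ∈ inside N cand lo hi ↔ a < N ∧ lo < cand a ∧ cand a < hi := by
  simp [inside]

open Classical in
theorem card_inside_succ (N : ℕ) (cand : ℕ → ℝ) (lo hi : ℝ) : (inside (N + 1) cand lo hi).card =
    (inside N cand lo hi).card + if lo < cand N ∧ cand N < hi then 1 else 0 := by
  rw [inside, inside, Finset.card_filter, Finset.card_filter, Finset.sum_range_succ]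

theorem card_inside_le : (inside N cand lo hi).card ≤ N := by
  simpa [inside] using Finset.card_le_card (Finset.filter_subset _ (Finset.range N))

theorem card_inside_add_card_inside_le {b : ℝ} (hb : lo ≤ b) (hc : c ≤ hi)
    (h : ∀ a ∈ inside N cand lo c, cand a ≤ b) :
    (inside N cand lo c).card + (inside N cand b hi).card ≤ (inside N cand lo hi).card := by
  rw [← Finset.card_union_of_disjoint]
  · refine Finset.card_le_card (Finset.union_subset (fun a ha => ?_) fun a ha => ?_)
    all_goals rw [mem_inside] at *
    · exact ⟨ha.1, ha.2.1, ha.2.2.trans_le hc⟩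
    · exact ⟨ha.1, hb.trans_lt ha.2.1, ha.2.2⟩
  · exact Finset.disjoint_left.2 fun a ha ha' => (h a ha).not_gt (mem_inside.1 ha').2.1

/-- `c` is a candidate between `lo` and `hi`, at most half of the candidates between `lo` and `hi`
are below `c`, and at most half of them are above `c`. -/
structure Median (N : ℕ) (cand : ℕ → ℝ) (lo hi c : ℝ) : Prop where
  exists_eq : ∃ a ∈ inside N cand lo hi, cand a = c
  below : 2 * (inside N cand lo c).card ≤ (inside N cand lo hi).card
  above : 2 * (inside N cand c hi).card ≤ (inside N cand lo hi).card

theorem Median.lt_left (h : Median N cand lo hi c) : lo < c := by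
  obtain ⟨a, ha, rfl⟩ := h.exists_eq
  exact (mem_inside.1 ha).2.1

theorem Median.lt_right (h : Median N cand lo hi c) : c < hi := by
  obtain ⟨a, ha, rfl⟩ := h.exists_eq
  exact (mem_inside.1 ha).2.2

theorem Median.card_pos (h : Median N cand lo hi c) : 0 < (inside N cand lo hi).card := by
  obtain ⟨a, ha, -⟩ := h.exists_eq
  exact Finset.card_pos.2 ⟨a, ha⟩

/-- The median found is the least candidate with at most half of the candidates above it. -/
theorem exists_median (h : (inside N cand lo hi).Nonempty) : ∃ c, Median N cand lo hi c := by
  classical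
  set F := inside N cand lo hi
  set G := F.filter fun a => 2 * (inside N cand (cand a) hi).card ≤ F.card
  have hne : G.Nonempty := by
    obtain ⟨a, ha, hmax⟩ := F.exists_max_image cand h
    have hcard := card_inside_add_card_inside_le (mem_inside.1 ha).2.1.le le_rfl hmax
    exact ⟨a, Finset.mem_filter.2 ⟨ha, by omega⟩⟩
  obtain ⟨a, ha, hmin⟩ := G.exists_min_image cand hne
  obtain ⟨haF, habove⟩ := Finset.mem_filter.1 ha
  suffices hbelow : 2 * (inside N cand lo (cand a)).card ≤ F.card from
    ⟨cand a, ⟨a, haF, rfl⟩, hbelow, habove⟩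
  by_contra! hlt
  have hbelow : (inside N cand lo (cand a)).Nonempty := by
    rw [← Finset.card_pos]
    omega
  obtain ⟨b, hb, hmax⟩ := (inside N cand lo (cand a)).exists_max_image cand hbelow
  obtain ⟨hbN, hlob, hba⟩ := mem_inside.1 hb
  have hah := (mem_inside.1 haF).2.2
  have hcard : _ ≤ F.card := card_inside_add_card_inside_le hlob.le hah.le hmax
  have hbG : b ∈ G :=
    Finset.mem_filter.2 ⟨mem_inside.2 ⟨hbN, hlob, hba.trans hah⟩, by omega⟩
  exact (hmin b hbG).not_gt hba

theorem size_lt_size_of_two_mul_le {a b : ℕ} (hb : 0 < b) (h : 2 * a ≤ b) :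
    a.size < b.size := by
  rw [Nat.lt_size]
  rcases Nat.eq_zero_or_pos a with rfl | ha
  · simpa using Nat.one_le_iff_ne_zero.2 hb.ne'
  · have hpow : 2 ^ (a.size - 1) ≤ a := Nat.lt_size.1 (Nat.sub_lt (Nat.size_pos.2 ha) one_pos)
    calc 2 ^ a.size = 2 * 2 ^ (a.size - 1) := by
          rw [← pow_succ', Nat.sub_add_cancel (Nat.size_pos.2 ha)]
      _ ≤ b := by omega

end Median

section Search

variable {n m : ℕ} {I : Instance n m} {s : Store}

/-- The test whether the candidate `x` lies strictly between `rLo` and `rHi`. -/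
def BExp.inRange (x : NExp) : BExp :=
  .and (.rlt (.var rLo) (.get rCand x)) (.rlt (.get rCand x) (.var rHi))

/-- Count the candidate `vB`. -/
def countStep : Prog :=
  .ite (.inRange (.var vB))
    (.block [
      .incr aTot,
      .ite (.rlt (.get rCand (.var vB)) (.get rCand (.var vA))) (.incr aLess) .skip,
      .ite (.rlt (.get rCand (.var vA)) (.get rCand (.var vB))) (.incr aMore) .skip])
    .skip

/-- Count the candidates between `rLo` and `rHi`, and those of them below and above the candidate
`vA`. -/
def countCands : Prog := .block [
  .nass aLess (.lit 0), .nass aMore (.lit 0), .nass aTot (.lit 0), .for vB (.var aNc) countStep]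

/-- The counters hold the numbers of candidates for the first `N` candidates. -/
structure Counted (N : ℕ) (cand : ℕ → ℝ) (lo hi c : ℝ) (s : Store) : Prop where
  less : s.nat aLess 0 = (inside N cand lo c).card
  more : s.nat aMore 0 = (inside N cand c hi).card
  tot : s.nat aTot 0 = (inside N cand lo hi).card

theorem countStep_spec {N : ℕ} {cand : ℕ → ℝ} {lo hi c : ℝ} (hB : s.nat vB 0 = N)
    (hcand : s.real rCand = cand) (hlo : s.real rLo 0 = lo) (hhi : s.real rHi 0 = hi)
    (hc : cand (s.nat vA 0) = c) (hloc : lo < c) (hchi : c < hi) (h : Counted N cand lo hi c s) :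
    Does I countStep s 9 (Counted (N + 1) cand lo hi c) := by
  obtain ⟨hless, hmore, htot⟩ := h
  have hin : (BExp.inRange (.var vB)).Holds I s ↔ lo < cand N ∧ cand N < hi := by
    simp [BExp.inRange, hB, hcand, hlo, hhi]
  refine Does.of_wp ?_
  simp only [countStep, Prog.wp, Prog.block, hin, BExp.holds_rlt, RExp.eval_get, NExp.eval_get,
    NExp.eval_lit, NExp.eval_add, Store.nat_setNat_of_ne, Store.real_setNat, ne_eq,
    Nat.reduceEqDiff, not_false_eq_true, hB, hcand, hc]
  refine ⟨fun hr => ⟨fun hl => ⟨fun hm => absurd hl hm.not_gt, fun hm => ?_⟩,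
    fun hl => ⟨fun hm => ?_, fun hm => ?_⟩⟩, fun hr => ?_⟩
  · constructor <;> simp [card_inside_succ, hless, hmore, htot, hr.1, hr.2, hl, hm]
  · constructor <;> simp [card_inside_succ, hless, hmore, htot, hr.1, hr.2, hl, hm]
  · constructor <;> simp [card_inside_succ, hless, hmore, htot, hr.1, hr.2, hl, hm]
  · have hl : ¬ (lo < cand N ∧ cand N < c) := fun h => hr ⟨h.1, h.2.trans hchi⟩
    have hm : ¬ (c < cand N ∧ cand N < hi) := fun h => hr ⟨hloc.trans h.1, h.2⟩
    constructor <;> simp [card_inside_succ, hless, hmore, htot, hr, hl, hm]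

theorem countCands_spec {N : ℕ} {cand : ℕ → ℝ} {lo hi c : ℝ} (hN : s.nat aNc 0 = N)
    (hcand : s.real rCand = cand) (hlo : s.real rLo 0 = lo) (hhi : s.real rHi 0 = hi)
    (hc : cand (s.nat vA 0) = c) (hloc : lo < c) (hchi : c < hi) :
    Does I countCands s (11 * N + 5) (Counted N cand lo hi c) := by
  refine ((Does.nass aLess (.lit 0)).seq (T₂ := 11 * N + 4) ?_).le (by omega)
  rintro _ hf₁ rfl
  refine ((Does.nass aMore (.lit 0)).seq (T₂ := 11 * N + 3) ?_).le (by omega)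
  rintro _ hf₂ rfl
  refine ((Does.nass aTot (.lit 0)).seq (T₂ := 11 * N + 2) ?_).le (by omega)
  rintro _ hf₃ rfl
  subst hN
  refine (Does.for_var (T := 9) (v := vB) (fun j => Counted j cand lo hi c) ?_ ?_ (fun _ _ h => h)
    (hInv := fun _ _ _ h => ⟨h.less, h.more, h.tot⟩)).le (by simp; omega)
  · constructor <;> simp [inside]
  · intro j _ s' hf hv h
    have hreal : s'.real = s.real := hf.real_eq
    have hA : s'.nat vA = s.nat vA := hf.nat vA
    exact countStep_spec hv (by rw [hreal, hcand]) (by rw [hreal, hlo]) (by rw [hreal, hhi])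
      (by rw [hA, hc]) hloc hchi h

/-- Choose the candidate `vA` if it is a median of the candidates between `rLo` and `rHi`. -/
def selectStep : Prog :=
  .ite (.inRange (.var vA))
    (.block [countCands,
      .ite (.and (.not (.nlt (.var aTot) (.add (.var aLess) (.var aLess))))
          (.not (.nlt (.var aTot) (.add (.var aMore) (.var aMore)))))
        (.block [.nass aHas (.lit 1), .rass rPiv (.get rCand (.var vA))]) .skip])
    .skip

/-- Choose a median of the candidates between `rLo` and `rHi`. -/
def selectPivot : Prog := .block [.nass aHas (.lit 0), .for vA (.var aNc) selectStep]

/-- A median has been chosen, or there is none among the first `A` candidates. -/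
def Selected (N : ℕ) (cand : ℕ → ℝ) (lo hi : ℝ) (A : ℕ) (s : Store) : Prop :=
  s.nat aHas 0 = 1 ∧ Median N cand lo hi (s.real rPiv 0) ∨
    s.nat aHas 0 = 0 ∧ ∀ a < A, ¬ Median N cand lo hi (cand a)

theorem Selected.succ {N A : ℕ} {cand : ℕ → ℝ} {lo hi : ℝ} (h : Selected N cand lo hi A s)
    (hA : ¬ Median N cand lo hi (cand A)) : Selected N cand lo hi (A + 1) s :=
  h.imp_right fun h => ⟨h.1, fun a ha => by
    rcases Nat.lt_succ_iff_lt_or_eq.1 ha with ha | rfl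
    exacts [h.2 a ha, hA]⟩

theorem selectStep_spec {N A : ℕ} {cand : ℕ → ℝ} {lo hi : ℝ} (hN : s.nat aNc 0 = N)
    (hcand : s.real rCand = cand) (hlo : s.real rLo 0 = lo) (hhi : s.real rHi 0 = hi)
    (hA : s.nat vA 0 = A) (hAN : A < N) (h : Selected N cand lo hi A s) :
    Does I selectStep s (11 * N + 10) (Selected N cand lo hi (A + 1)) := by
  have hin : (BExp.inRange (.var vA)).Holds I s ↔ lo < cand A ∧ cand A < hi := by
    simp [BExp.inRange, hA, hcand, hlo, hhi]
  refine Does.ite (fun hr => ?_) fun hr => Does.of_wp ?_ (by simp [Prog.cost])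
  · obtain ⟨hloc, hchi⟩ := hin.1 hr
    refine (countCands_spec hN hcand hlo hhi (by rw [hA]) hloc hchi).seq (T₂ := 4) ?_
    intro s' hf hcount
    have h' : Selected N cand lo hi A s' := by
      rwa [Selected, hf.nat aHas, hf.real rPiv]
    have hA' : s'.nat vA 0 = A := by rw [hf.nat vA, hA]
    have hcand' : s'.real rCand = cand := by rw [hf.real rCand, hcand]
    refine Does.of_wp ⟨fun hmed => ?_, fun hmed => h'.succ fun hm => hmed ?_⟩
    · simp only [BExp.holds_and, BExp.holds_not, BExp.holds_nlt, NExp.eval_add, NExp.eval_get,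
        NExp.eval_lit, hcount.less, hcount.more, hcount.tot, not_lt, ← two_mul] at hmed
      refine Or.inl ⟨rfl, ?_⟩
      simpa [hA', hcand'] using (⟨⟨A, mem_inside.2 ⟨hAN, hloc, hchi⟩, rfl⟩, hmed.1, hmed.2⟩ :
        Median N cand lo hi (cand A))
    · simpa only [BExp.holds_and, BExp.holds_not, BExp.holds_nlt, NExp.eval_add, NExp.eval_get,
        NExp.eval_lit, hcount.less, hcount.more, hcount.tot, not_lt, ← two_mul] using
        ⟨hm.below, hm.above⟩
  · exact h.succ fun hm => hr (hin.2 ⟨hm.lt_left, hm.lt_right⟩)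

theorem selectPivot_spec {N : ℕ} {cand : ℕ → ℝ} {lo hi : ℝ} (hN : s.nat aNc 0 = N)
    (hcand : s.real rCand = cand) (hlo : s.real rLo 0 = lo) (hhi : s.real rHi 0 = hi) :
    Does I selectPivot s (20 * (N + 1) * (N + 1)) fun s' =>
      (s'.nat aHas 0 = 1 ∧ Median N cand lo hi (s'.real rPiv 0)) ∨
      (s'.nat aHas 0 = 0 ∧ inside N cand lo hi = ∅) := by
  refine ((Does.nass aHas (.lit 0)).seq (T₂ := N * (11 * N + 10 + 2) + 2) ?_).le (by nlinarith)
  rintro _ hf₁ rfl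
  subst hN
  refine Does.for_var (fun A => Selected (s.nat aNc 0) cand lo hi A) ?_ ?_ ?_
    (hInv := fun _ _ _ h => h)
  · exact Or.inr ⟨rfl, by simp⟩
  · intro A hA s' hf hv h
    exact selectStep_spec (by rw [hf.nat aNc]; rfl) (by rw [hf.real rCand]; exact hcand)
      (by rw [hf.real rLo]; exact hlo) (by rw [hf.real rHi]; exact hhi) hv hA h
  · refine fun s' _ h => h.imp_right fun ⟨hhas, hnone⟩ => ⟨hhas, ?_⟩
    by_contra hne
    obtain ⟨c, hmed⟩ := exists_median (Finset.nonempty_iff_ne_empty.2 hne)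
    obtain ⟨a, ha, rfl⟩ := hmed.exists_eq
    exact hnone a (mem_inside.1 ha).1 hmed

/-- The threshold `rLo` can be reached (or is `0`), and the larger threshold `rHi` cannot. -/
structure Bracket (I : Instance n m) (s : Store) : Prop where
  nonneg : 0 ≤ s.real rLo 0
  lt : s.real rLo 0 < s.real rHi 0
  pass : s.real rLo 0 = 0 ∨ Passes I s (s.real rLo 0)
  fail : ¬ Passes I s (s.real rHi 0)

theorem Bracket.frame {s' : Store} {p : Prog} (h : Bracket I s) (hf : Frame p s s')
    (hn : ∀ a ∈ [aP, aPt], a ∉ p.natWrites := by decide)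
    (hr : ∀ a ∈ [rRad, rLo, rHi], a ∉ p.realWrites := by decide) : Bracket I s' := by
  simp only [List.forall_mem_cons] at hn hr
  obtain ⟨hP, hPt, -⟩ := hn
  obtain ⟨hRad, hLo, hHi, -⟩ := hr
  have hp := passes_frame (I := I) hf hP hPt hRad
  constructor <;> simp only [hf.real rLo hLo, hf.real rHi hHi, hp]
  exacts [h.nonneg, h.lt, h.pass, h.fail]

/-- Move `rLo` or `rHi` to `rPiv`. -/
def narrow : Prog := .block [
  .rass rT (.var rPiv),
  test,
  .ite (.nlt (.lit 0) (.var aOk)) (.rass rLo (.var rPiv)) (.rass rHi (.var rPiv))]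

theorem narrow_spec (h : Ready I s) (hb : Bracket I s) (hlo : s.real rLo 0 < s.real rPiv 0)
    (hhi : s.real rPiv 0 < s.real rHi 0) :
    Does I narrow s (100 * (I.k * m + 1) * (I.k * m + 1) + 3) fun s' => Bracket I s' ∧
      (s'.real rLo 0 = s.real rPiv 0 ∧ s'.real rHi 0 = s.real rHi 0 ∨
        s'.real rLo 0 = s.real rLo 0 ∧ s'.real rHi 0 = s.real rPiv 0) := by
  refine ((Does.rass rT (.var rPiv)).seq
    (T₂ := 100 * (I.k * m + 1) * (I.k * m + 1) + 2) ?_).le (by omega)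
  rintro _ hf₁ rfl
  refine (test_spec (h.frame hf₁)).seq ?_
  rintro s₂ hf₂ ⟨-, hc, hmatch⟩
  have hpass := passes_of_test hc hmatch (hf₂.nat aPt)
  rw [passes_frame hf₁] at hpass
  have hrPiv : s₂.real rPiv = s.real rPiv := by rw [hf₂.real rPiv, hf₁.real rPiv]
  have hrLo : s₂.real rLo = s.real rLo := by rw [hf₂.real rLo, hf₁.real rLo]
  have hrHi : s₂.real rHi = s.real rHi := by rw [hf₂.real rHi, hf₁.real rHi]
  have hp : Passes I s₂ = Passes I s := by rw [passes_frame hf₂, passes_frame hf₁]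
  refine Does.ite (T := 1) (fun hok => ?_) fun hok => ?_
  · refine (Does.rass rLo (.var rPiv)).mono le_rfl fun s₃ hf₃ h₃ => ?_
    have hlo' : s₃.real rLo 0 = s.real rPiv 0 := by simp [h₃, hrPiv]
    have hhi' : s₃.real rHi 0 = s.real rHi 0 := by rw [hf₃.real rHi, hrHi]
    have hp' : Passes I s₃ = Passes I s := by rw [passes_frame hf₃, hp]
    refine ⟨⟨?_, ?_, Or.inr ?_, ?_⟩, Or.inl ⟨hlo', hhi'⟩⟩
    · rw [hlo']; exact hb.nonneg.trans hlo.le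
    · rwa [hlo', hhi']
    · rw [hlo', hp']; exact hpass.2 hok.ne'
    · rw [hhi', hp']; exact hb.fail
  · refine (Does.rass rHi (.var rPiv)).mono le_rfl fun s₃ hf₃ h₃ => ?_
    have hlo' : s₃.real rLo 0 = s.real rLo 0 := by rw [hf₃.real rLo, hrLo]
    have hhi' : s₃.real rHi 0 = s.real rPiv 0 := by simp [h₃, hrPiv]
    have hp' : Passes I s₃ = Passes I s := by rw [passes_frame hf₃, hp]
    refine ⟨⟨?_, ?_, ?_, ?_⟩, Or.inr ⟨hlo', hhi'⟩⟩
    · rw [hlo']; exact hb.nonneg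
    · rwa [hlo', hhi']
    · rw [hlo', hp']; exact hb.pass
    · rw [hhi', hp']; exact fun hpiv => hok (Nat.pos_of_ne_zero (hpass.1 hpiv))

/-- Choose a median of the candidates between `rLo` and `rHi` and test it; clear `aGo` if there is
no candidate. -/
def searchRound : Prog :=
  .block [selectPivot, .ite (.nlt (.lit 0) (.var aHas)) narrow (.nass aGo (.lit 0))]

/-- The number of candidates between `rLo` and `rHi`. -/
noncomputable def remaining (s : Store) : ℕ :=
  (inside (s.nat aNc 0) (s.real rCand) (s.real rLo 0) (s.real rHi 0)).card

/-- A memory that the search can reach from `s`. -/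
structure Narrowed (I : Instance n m) (s s' : Store) : Prop where
  bracket : Bracket I s'
  lo_le : s.real rLo 0 ≤ s'.real rLo 0
  le_hi : s'.real rHi 0 ≤ s.real rHi 0
  done : s'.nat aGo 0 = 0 → remaining s' = 0

theorem searchRound_spec (h : Ready I s) (hN : s.nat aNc 0 ≤ I.k * m) (hb : Bracket I s)
    (hgo : s.nat aGo 0 ≠ 0) :
    Does I searchRound s (125 * ((I.k * m + 1) * (I.k * m + 1))) fun s' => Narrowed I s s' ∧
      (s'.nat aGo 0 ≠ 0 → (remaining s').size < (remaining s).size) := by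
  have hselect : 20 * (s.nat aNc 0 + 1) * (s.nat aNc 0 + 1) ≤
      20 * (I.k * m + 1) * (I.k * m + 1) := by gcongr
  refine (((selectPivot_spec rfl rfl rfl rfl).le hselect).seq
    (T₂ := 100 * (I.k * m + 1) * (I.k * m + 1) + 4) ?_).le (by nlinarith)
  intro s₁ hf₁ hsel
  have hbr₁ : Bracket I s₁ := hb.frame hf₁
  have hlo₁ : s₁.real rLo = s.real rLo := hf₁.real rLo
  have hhi₁ : s₁.real rHi = s.real rHi := hf₁.real rHi
  have hN₁ : s₁.nat aNc = s.nat aNc := hf₁.nat aNc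
  have hcand₁ : s₁.real rCand = s.real rCand := hf₁.real rCand
  refine Does.ite (fun hhas => ?_) fun hhas => ?_
  · obtain ⟨-, hmed⟩ := hsel.resolve_right fun h => (h.1 ▸ hhas : 0 < 0).false
    refine (narrow_spec (h.frame hf₁) hbr₁ (by rw [hlo₁]; exact hmed.lt_left)
      (by rw [hhi₁]; exact hmed.lt_right)).mono le_rfl ?_
    rintro s₂ hf₂ ⟨hbr₂, hcases⟩
    have hgo₂ : s₂.nat aGo 0 ≠ 0 := by rwa [hf₂.nat aGo, hf₁.nat aGo]
    rw [hlo₁, hhi₁] at hcases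
    rw [remaining, hf₂.nat aNc, hf₂.real rCand, hN₁, hcand₁]
    rcases hcases with ⟨hlo₂, hhi₂⟩ | ⟨hlo₂, hhi₂⟩
    · refine ⟨⟨hbr₂, hlo₂ ▸ hmed.lt_left.le, hhi₂.le, fun hgo' => absurd hgo' hgo₂⟩, fun _ => ?_⟩
      rw [hlo₂, hhi₂]
      exact size_lt_size_of_two_mul_le hmed.card_pos hmed.above
    · refine ⟨⟨hbr₂, hlo₂.ge, hhi₂ ▸ hmed.lt_right.le, fun hgo' => absurd hgo' hgo₂⟩, fun _ => ?_⟩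
      rw [hlo₂, hhi₂]
      exact size_lt_size_of_two_mul_le hmed.card_pos hmed.below
  · obtain ⟨-, hemp⟩ := hsel.resolve_left fun h =>
      hhas (h.1.symm ▸ one_pos : 0 < s₁.nat aHas 0)
    refine (Does.nass aGo (.lit 0)).mono (by omega) fun s₂ hf₂ h₂ => ?_
    have hgo₂ : s₂.nat aGo 0 = 0 := by simp [h₂]
    refine ⟨⟨hbr₁.frame hf₂, ?_, ?_, fun _ => ?_⟩, fun hgo' => absurd hgo₂ hgo'⟩
    · rw [hf₂.real rLo, hlo₁]
    · rw [hf₂.real rHi, hhi₁]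
    · rw [remaining, hf₂.nat aNc, hf₂.real_eq, hN₁, hcand₁, hlo₁, hhi₁, hemp, Finset.card_empty]

/-- Binary search among the candidates. -/
def search : Prog :=
  .block [.nass aGo (.lit 1), .loop (.nlt (.lit 0) (.var aGo)) searchRound]

theorem search_spec (h : Ready I s) (hN : s.nat aNc 0 ≤ I.k * m) (hb : Bracket I s) :
    Does I search s (130 * ((I.k * m).size + 2) * ((I.k * m + 1) * (I.k * m + 1))) fun s' =>
      Narrowed I s s' ∧ remaining s' = 0 := by
  set X := (I.k * m + 1) * (I.k * m + 1)
  have hX1 : 1 ≤ X := Nat.mul_pos (by omega) (by omega)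
  refine ((Does.nass aGo (.lit 1)).seq
    (T₂ := ((I.k * m).size + 1) * (125 * X + 1) + 1) ?_).le (by nlinarith)
  intro s₁ hf₁ h₁
  have hgo₁ : s₁.nat aGo 0 = 1 := by simp [h₁]
  have hsize : (remaining s₁).size + 1 ≤ (I.k * m).size + 1 := by
    gcongr
    exact Nat.size_le_size (card_inside_le.trans (by rwa [hf₁.nat aNc]))
  refine (Does.while (T := 125 * X) (Narrowed I s)
    (fun s' => if s'.nat aGo 0 = 0 then 0 else (remaining s').size + 1) ?_ ?_ ?_).le ?_
  · refine ⟨hb.frame hf₁, ?_, ?_, by omega⟩ <;> rw [hf₁.real_eq]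
  · intro s₂ hf₂ hs₂ hgo
    have hgo : 0 < s₂.nat aGo 0 := hgo
    refine (searchRound_spec ((h.frame hf₁).frame hf₂) (by rwa [hf₂.nat aNc, hf₁.nat aNc])
      hs₂.bracket hgo.ne').mono le_rfl ?_
    rintro s₃ - ⟨hs₃, hlt⟩
    refine ⟨⟨hs₃.bracket, hs₂.lo_le.trans hs₃.lo_le, hs₃.le_hi.trans hs₂.le_hi, hs₃.done⟩, ?_⟩
    rw [if_neg hgo.ne']
    split_ifs with hgo'
    · omega
    · exact Nat.succ_lt_succ (hlt hgo')
  · exact fun s₂ _ hs₂ hgo => ⟨hs₂, hs₂.done (Nat.eq_zero_of_not_pos hgo)⟩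
  · rw [if_neg (by omega)]
    gcongr

end Search

/-! ### Farthest point sampling -/

section FarthestPoint

variable {α ι : Type*} {δ : α → α → ℝ} {A : Set α} {B : ℝ} {j : ℕ} {D : Finset ι}
  {pt : ι → α} {rad : ι → ℝ} {μ : α → ℝ}

/-- The state of farthest point sampling in the set `A` after `j` rounds: the points `pt p` for
`p ∈ D` have been chosen, `rad p` was the distance of `pt p` to the earlier points when it was
chosen, and `μ u` is the distance of `u` to all of them, where distances to the empty set are
`B`. -/
structure IsFarthestSample (δ : α → α → ℝ) (A : Set α) (B : ℝ) (j : ℕ) (D : Finset ι) (pt : ι → α)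
    (rad : ι → ℝ) (μ : α → ℝ) : Prop where
  card_le : D.card ≤ j
  le_dist : ∀ u ∈ A, ∀ p ∈ D, μ u ≤ δ u (pt p)
  attained : ∀ u ∈ A, μ u = B ∨ ∃ p ∈ D, μ u = δ u (pt p)
  separated : ∀ r, ∀ p ∈ D, ∀ q ∈ D, p ≠ q → r ≤ rad p → r ≤ rad q → r ≤ δ (pt p) (pt q)
  covers : ∀ r ≤ B, j ≤ (D.filter fun p => r ≤ rad p).card ∨
    ∀ u ∈ A, ∃ p ∈ D, r ≤ rad p ∧ δ u (pt p) < r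

theorem IsFarthestSample.init (hμ : ∀ u ∈ A, μ u = B) :
    IsFarthestSample δ A B 0 (∅ : Finset ι) pt rad μ where
  card_le := le_rfl
  le_dist := by simp
  attained u hu := Or.inl (hμ u hu)
  separated := by simp
  covers _ _ := Or.inl (Nat.zero_le _)

theorem IsFarthestSample.congr (h : IsFarthestSample δ A B j D pt rad μ) {pt' : ι → α}
    {rad' : ι → ℝ} {ν : α → ℝ} (hpt : ∀ p ∈ D, pt' p = pt p) (hrad : ∀ p ∈ D, rad' p = rad p)
    (hμ : ∀ u ∈ A, ν u = μ u) : IsFarthestSample δ A B j D pt' rad' ν where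
  card_le := h.card_le
  le_dist u hu p hp := by rw [hμ u hu, hpt p hp]; exact h.le_dist u hu p hp
  attained u hu := by
    rw [hμ u hu]
    exact (h.attained u hu).imp_right fun ⟨p, hp, hu⟩ => ⟨p, hp, by rw [hu, hpt p hp]⟩
  separated r p hp q hq := by
    rw [hpt p hp, hpt q hq, hrad p hp, hrad q hq]
    exact h.separated r p hp q hq
  covers r hr := by
    rw [Finset.filter_congr fun p hp => by rw [hrad p hp]]
    refine (h.covers r hr).imp_right fun h u hu => ?_
    obtain ⟨p, hp, hpr, hup⟩ := h u hu
    exact ⟨p, hp, by rwa [hrad p hp], by rwa [hpt p hp]⟩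

theorem IsFarthestSample.succ_of_empty (h : IsFarthestSample δ A B j D pt rad μ) (hA : A = ∅) :
    IsFarthestSample δ A B (j + 1) D pt rad μ :=
  { h with
    card_le := h.card_le.trans j.le_succ
    covers := fun _ _ => Or.inr fun u hu => by simp [hA] at hu }

theorem IsFarthestSample.exists_lt_of_lt (h : IsFarthestSample δ A B j D pt rad μ) {r : ℝ}
    (hr : r ≤ B) (hD : ∀ p ∈ D, r ≤ rad p) {u : α} (hu : u ∈ A) (hur : μ u < r) :
    ∃ p ∈ D, r ≤ rad p ∧ δ u (pt p) < r := by
  rcases h.attained u hu with hB | ⟨p, hp, hup⟩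
  · linarith
  · exact ⟨p, hp, hD p hp, hup ▸ hur⟩

variable [DecidableEq ι]

theorem IsFarthestSample.covers_insert (h : IsFarthestSample δ A B j D pt rad μ) {P : ι}
    (hP : P ∉ D) (hrad : rad P = μ (pt P)) (hmax : ∀ u ∈ A, μ u ≤ μ (pt P)) {r : ℝ} (hr : r ≤ B) :
    j + 1 ≤ ((insert P D).filter fun p => r ≤ rad p).card ∨
      ∀ u ∈ A, ∃ p ∈ insert P D, r ≤ rad p ∧ δ u (pt p) < r := by
  have hmono : (∀ u ∈ A, ∃ p ∈ D, r ≤ rad p ∧ δ u (pt p) < r) →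
      ∀ u ∈ A, ∃ p ∈ insert P D, r ≤ rad p ∧ δ u (pt p) < r := fun h u hu =>
    (h u hu).imp fun _ h => ⟨Finset.mem_insert_of_mem h.1, h.2⟩
  rcases h.covers r hr with hj | hcov
  · rcases le_or_gt r (rad P) with hrP | hrP
    · left
      rw [Finset.filter_insert, if_pos hrP,
        Finset.card_insert_of_notMem fun h => hP (Finset.mem_filter.1 h).1]
      exact Nat.succ_le_succ hj
    · -- All points have radius at least `r`, while all distances are less than `r`.
      have hall : ∀ p ∈ D, r ≤ rad p := Finset.filter_eq_self.1
        (Finset.eq_of_subset_of_card_le (Finset.filter_subset _ _) (h.card_le.trans hj))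
      exact Or.inr (hmono fun u hu =>
        h.exists_lt_of_lt hr hall hu ((hmax u hu).trans_lt (hrad ▸ hrP)))
  · exact Or.inr (hmono hcov)

theorem IsFarthestSample.insert (h : IsFarthestSample δ A B j D pt rad μ)
    (hδ : ∀ u v, δ u v = δ v u) {P : ι} (hP : P ∉ D) (hmem : pt P ∈ A) (hrad : rad P = μ (pt P))
    (hmax : ∀ u ∈ A, μ u ≤ μ (pt P)) :
    IsFarthestSample δ A B (j + 1) (insert P D) pt rad fun u => min (μ u) (δ u (pt P)) where
  card_le := (Finset.card_insert_le _ _).trans (Nat.succ_le_succ h.card_le)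
  le_dist u hu := by
    rw [Finset.forall_mem_insert]
    exact ⟨min_le_right _ _, fun p hp => (min_le_left _ _).trans (h.le_dist u hu p hp)⟩
  attained u hu := by
    rcases min_choice (μ u) (δ u (pt P)) with hm | hm <;> rw [hm]
    · exact (h.attained u hu).imp_right fun ⟨p, hp, hu⟩ => ⟨p, Finset.mem_insert_of_mem hp, hu⟩
    · exact Or.inr ⟨P, Finset.mem_insert_self _ _, rfl⟩
  separated r p hp q hq hne hpr hqr := by
    rcases Finset.mem_insert.1 hp with rfl | hpD <;> rcases Finset.mem_insert.1 hq with rfl | hqD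
    · exact absurd rfl hne
    · exact (hrad ▸ hpr).trans (h.le_dist _ hmem q hqD)
    · rw [hδ]
      exact (hrad ▸ hqr).trans (h.le_dist _ hmem p hpD)
    · exact h.separated r p hpD q hqD hne hpr hqr
  covers _ hr := h.covers_insert hP hrad hmax hr

end FarthestPoint

section ClassPoints

variable {n m : ℕ} {I : Instance n m} {c j P w : ℕ} {pt : ℕ → ℕ} {rad μ : ℕ → ℝ} {B x : ℝ}

/-- The elements of the class `c`. -/
def classSet (I : Instance n m) (c : ℕ) : Set ℕ := {u | u < n ∧ I.col u = c}

/-- The points that name an element of the class `c`. -/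
def classPoints (I : Instance n m) (P : ℕ) (pt : ℕ → ℕ) (c : ℕ) : Finset ℕ :=
  (Finset.range P).filter fun p => I.ptCol pt p = c

theorem mem_classPoints {p : ℕ} : p ∈ classPoints I P pt c ↔ p < P ∧ I.ptCol pt p = c := by
  simp [classPoints]

theorem update_of_mem_classPoints {α : Type*} {f : ℕ → α} {y : α} :
    ∀ p ∈ classPoints I P pt c, Function.update f P y p = f p := fun _ hp =>
  Function.update_of_ne (mem_classPoints.1 hp).1.ne _ _

theorem classPoints_succ_update :
    classPoints I (P + 1) (Function.update pt P w) c =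
      if I.col w = c then insert P (classPoints I P pt c) else classPoints I P pt c := by
  have hold : (Finset.range P).filter (fun p => I.ptCol (Function.update pt P w) p = c) =
      classPoints I P pt c := Finset.filter_congr fun p hp => by
    rw [Instance.ptCol, Function.update_of_ne (Finset.mem_range.1 hp).ne]
  rw [classPoints, Finset.range_add_one, Finset.filter_insert, hold, Instance.ptCol,
    Function.update_self]

/-- The state of farthest point sampling in the class `c`. -/
def ClassSample (I : Instance n m) (B : ℝ) (c j P : ℕ) (pt : ℕ → ℕ) (rad μ : ℕ → ℝ) : Prop :=
  IsFarthestSample I.d (classSet I c) B j (classPoints I P pt c) pt rad μ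

theorem ClassSample.congr (h : ClassSample I B c j P pt rad μ) {ν : ℕ → ℝ}
    (hμ : ∀ u < n, I.col u = c → ν u = μ u) : ClassSample I B c j P pt rad ν :=
  IsFarthestSample.congr h (fun _ _ => rfl) (fun _ _ => rfl) fun u hu => hμ u hu.1 hu.2

theorem ClassSample.update_of_ne (h : ClassSample I B c j P pt rad μ) (hw : I.col w ≠ c) :
    ClassSample I B c j (P + 1) (Function.update pt P w) (Function.update rad P x) μ := by
  rw [ClassSample, classPoints_succ_update, if_neg hw]
  exact IsFarthestSample.congr h update_of_mem_classPoints update_of_mem_classPoints fun _ _ => rfl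

theorem ClassSample.update (h : ClassSample I B c j P pt rad μ) (hw : w ∈ classSet I c)
    (hmax : ∀ u ∈ classSet I c, μ u ≤ μ w) :
    ClassSample I B c (j + 1) (P + 1) (Function.update pt P w) (Function.update rad P (μ w))
      fun u => min (μ u) (I.d u w) := by
  rw [ClassSample, classPoints_succ_update, if_pos hw.2]
  have h' := IsFarthestSample.insert (P := P) (pt := Function.update pt P w)
    (rad := Function.update rad P (μ w))
    (IsFarthestSample.congr h update_of_mem_classPoints update_of_mem_classPoints fun _ _ => rfl)
    I.d_comm (fun hP => (mem_classPoints.1 hP).1.false)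
  simp only [Function.update_self] at h'
  exact h' hw trivial hmax

/-- The result of farthest point sampling in all classes: each class has a sample of `k` rounds
with initial distance `m top`. -/
structure Sampled (I : Instance n m) (top : ℝ) (P : ℕ) (pt : ℕ → ℕ) (rad : ℕ → ℝ) : Prop where
  pt_lt : ∀ p < P, pt p < n
  sample : ∃ μ, ∀ c < m, ClassSample I (m * top) c I.k P pt rad μ

variable {top t : ℝ}

theorem filter_net_ptCol_eq :
    ((net m P rad t).filter fun p => I.ptCol pt p = c) =
      (classPoints I P pt c).filter fun p => (m : ℝ) * t ≤ rad p := by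
  rw [net, classPoints, Finset.filter_comm]

theorem Sampled.isSeparated (h : Sampled I top P pt rad) (ht : 0 < t) :
    IsSeparated (I.ptDist pt) (I.ptCol pt) m (net m P rad t) t := by
  obtain ⟨μ, hμ⟩ := h.sample
  have hpt : ∀ p ∈ net m P rad t, pt p < n := fun p hp => h.pt_lt p (mem_net.1 hp).1
  refine ⟨isPseudoDist_ptDist hpt, ht, card_image_ptCol_le hpt, fun p hp q hq hne hc => ?_⟩
  obtain ⟨hpP, hpt'⟩ := mem_net.1 hp
  obtain ⟨hqP, hqt⟩ := mem_net.1 hq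
  exact (hμ _ (I.col_lt (hpt p hp))).separated _ p (mem_classPoints.2 ⟨hpP, rfl⟩) q
    (mem_classPoints.2 ⟨hqP, hc.symm⟩) hne hpt' hqt

theorem Sampled.covers (h : Sampled I top P pt rad) (ht : t ≤ top) :
    Covers I pt (net m P rad t) t := by
  obtain ⟨μ, hμ⟩ := h.sample
  intro c hc
  rw [filter_net_ptCol_eq]
  refine ((hμ c hc).covers _ (mul_le_mul_of_nonneg_left ht m.cast_nonneg)).imp_right
    fun hcov u hu huc => ?_
  obtain ⟨p, hp, hpr, hup⟩ := hcov u ⟨hu, huc⟩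
  obtain ⟨hpP, hpc⟩ := mem_classPoints.1 hp
  exact ⟨p, mem_net.2 ⟨hpP, hpr⟩, hpc, hup⟩

end ClassPoints

section Sample

variable {n m : ℕ} {I : Instance n m} {s : Store}

/-- Compute an upper bound for all distances. -/
def bound : Prog := .block [
  .rass rTop (.ofNat (.lit 0)),
  .for vI .numElems (.rass rTop (.add (.var rTop) (.dist (.var vI) (.lit 0)))),
  .rass rTop (.add (.ofNat (.lit 1)) (.add (.var rTop) (.var rTop)))]

theorem d_lt_of_d_zero_le {x : ℝ} (hx : ∀ u < n, I.d u 0 ≤ x) :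
    ∀ u < n, ∀ v < n, I.d u v < 1 + (x + x) := by
  intro u hu v hv
  have htriangle := I.d_triangle (w := 0) (by omega) u v
  rw [I.d_comm 0 v] at htriangle
  linarith [hx u hu, hx v hv]

theorem bound_spec :
    Does I bound s (3 * n + 4) fun s' => 0 < s'.real rTop 0 ∧
      ∀ u < n, ∀ v < n, I.d u v < s'.real rTop 0 := by
  refine ((Does.rass rTop _).seq (T₂ := (n * (1 + 2) + 2) + 1) ?_).le (by omega)
  rintro _ - rfl
  refine Does.seq (Does.for (N := n)
    (fun U s' => 0 ≤ s'.real rTop 0 ∧ ∀ u < U, I.d u 0 ≤ s'.real rTop 0) (fun _ _ => rfl)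
    (by simp) ?_ fun _ _ h => h) ?_
  · rintro U - s' - hv ⟨h0, hle⟩
    refine Does.of_wp ?_ le_rfl
    simp only [Prog.wp, RExp.eval_add, RExp.eval_get, RExp.eval_dist, NExp.eval_get, NExp.eval_lit,
      hv, Store.real_setReal_self, Function.update_self]
    have hd := I.d_nonneg U 0
    refine ⟨by linarith, fun u hu => ?_⟩
    rcases Nat.lt_succ_iff_lt_or_eq.1 hu with hu | rfl
    · linarith [hle u hu]
    · linarith
  · rintro s₂ - ⟨h0, hle⟩
    refine Does.of_wp ?_
    simp only [Prog.wp, Prog.block, RExp.eval_add, RExp.eval_get, RExp.eval_ofNat, NExp.eval_lit,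
      Store.real_setReal_self, Function.update_self, Nat.cast_one]
    exact ⟨by linarith, d_lt_of_d_zero_le hle⟩

/-- The number `b` is the successor of an element of the class `c` with the largest value of `μ`
among the elements below `U`, or zero if there is no such element. -/
def IsBest (I : Instance n m) (U : ℕ) (μ : ℕ → ℝ) (c b : ℕ) : Prop :=
  (b = 0 ∧ ∀ u < U, I.col u ≠ c) ∨
    ∃ w < U, b = w + 1 ∧ I.col w = c ∧ ∀ u < U, I.col u = c → μ u ≤ μ w

variable {U b c : ℕ} {μ ν : ℕ → ℝ}

theorem IsBest.succ_of_ne (h : IsBest I U μ c b) (hU : I.col U ≠ c) : IsBest I (U + 1) μ c b := by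
  rcases h with ⟨hb, hne⟩ | ⟨w, hw, hb, hc, hmax⟩
  · refine Or.inl ⟨hb, fun u hu => ?_⟩
    rcases Nat.lt_succ_iff_lt_or_eq.1 hu with hu | rfl
    exacts [hne u hu, hU]
  · refine Or.inr ⟨w, hw.trans U.lt_succ_self, hb, hc, fun u hu huc => ?_⟩
    rcases Nat.lt_succ_iff_lt_or_eq.1 hu with hu | rfl
    exacts [hmax u hu huc, absurd huc hU]

theorem IsBest.succ_of_le (h : IsBest I U μ (I.col U) b) (hb : 0 < b) (hle : μ U ≤ μ (b - 1)) :
    IsBest I (U + 1) μ (I.col U) b := by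
  obtain ⟨w, hw, rfl, hc, hmax⟩ := h.resolve_left fun h => hb.ne' h.1
  refine Or.inr ⟨w, hw.trans U.lt_succ_self, rfl, hc, fun u hu huc => ?_⟩
  rcases Nat.lt_succ_iff_lt_or_eq.1 hu with hu | rfl
  exacts [hmax u hu huc, hle]

theorem IsBest.succ_of_not_le (h : IsBest I U μ (I.col U) b) (hb : ¬ (0 < b ∧ μ U ≤ μ (b - 1))) :
    IsBest I (U + 1) μ (I.col U) (U + 1) := by
  refine Or.inr ⟨U, U.lt_succ_self, rfl, rfl, fun u hu huc => ?_⟩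
  rcases Nat.lt_succ_iff_lt_or_eq.1 hu with hu | rfl
  · rcases h with ⟨-, hne⟩ | ⟨w, -, rfl, -, hmax⟩
    · exact absurd huc (hne u hu)
    · exact (hmax u hu huc).trans (not_le.1 fun h => hb ⟨w.succ_pos, h⟩).le
  · exact le_rfl

/-- Update the farthest element of its class by the element `vI`. -/
def farthestStep : Prog :=
  .ite (.and (.nlt (.lit 0) (.get aBest (.color (.var vI))))
      (.not (.rlt (.get rMin (.sub (.get aBest (.color (.var vI))) (.lit 1)))
        (.get rMin (.var vI)))))
    .skip
    (.nset aBest (.color (.var vI)) (.add (.var vI) (.lit 1)))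

theorem farthestStep_spec (h : ∀ c < m, IsBest I (s.nat vI 0) (s.real rMin) c (s.nat aBest c)) :
    Does I farthestStep s 3 fun s' =>
      ∀ c < m, IsBest I (s.nat vI 0 + 1) (s.real rMin) c (s'.nat aBest c) := by
  refine Does.of_wp ?_
  simp only [farthestStep, Prog.wp, BExp.holds_and, BExp.holds_nlt, BExp.holds_not, BExp.holds_rlt,
    RExp.eval_get, NExp.eval_get, NExp.eval_lit, NExp.eval_color, NExp.eval_add, NExp.eval_sub,
    Store.nat_setNat_self, not_lt]
  refine ⟨fun ⟨hb, hle⟩ c hc => ?_, fun hb c hc => ?_⟩ <;>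
    by_cases hcol : I.col (s.nat vI 0) = c
  · subst hcol
    exact (h _ hc).succ_of_le hb hle
  · exact (h c hc).succ_of_ne hcol
  · subst hcol
    rw [Function.update_self]
    exact (h _ hc).succ_of_not_le hb
  · rw [Function.update_of_ne (Ne.symm hcol)]
    exact (h c hc).succ_of_ne hcol

/-- Determine the farthest element of each class. -/
def farthest : Prog := .block [clear aBest vI .numClasses, .for vI .numElems farthestStep]

theorem farthest_spec :
    Does I farthest s (5 * (n + m + 1)) fun s' =>
      ∀ c < m, IsBest I n (s.real rMin) c (s'.nat aBest c) := by
  refine ((clear_spec (N := m) (fun _ _ => rfl) (by decide)).seq (T₂ := n * (3 + 2) + 2) ?_).le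
    (by omega)
  intro s₁ hf₁ h0
  refine Does.for (fun U s' => ∀ c < m, IsBest I U (s.real rMin) c (s'.nat aBest c))
    (fun _ _ => rfl) (fun c hc => Or.inl ⟨h0 c hc, by simp⟩) ?_ fun _ _ h => h
  rintro U - s' hf rfl h
  rw [← hf₁.real rMin, ← hf.real rMin] at h ⊢
  exact farthestStep_spec h

/-- The state of a round of farthest point sampling after `i` classes: the classes below `i` have
got their new point. The distances to the points are `μ` before and `ν` after the round. -/
structure Adding (I : Instance n m) (B : ℝ) (j : ℕ) (μ ν : ℕ → ℝ) (i P : ℕ) (pt : ℕ → ℕ)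
    (rad : ℕ → ℝ) : Prop where
  card_le : P ≤ j * m + i
  pt_lt : ∀ p < P, pt p < n
  new : ∀ c < i, ClassSample I B c (j + 1) P pt rad ν
  old : ∀ c < m, i ≤ c → ClassSample I B c j P pt rad μ

variable {B : ℝ} {i j P w : ℕ} {pt : ℕ → ℕ} {rad : ℕ → ℝ}

theorem Adding.succ_of_empty (h : Adding I B j μ ν i P pt rad) (hi : i < m)
    (hempty : ∀ u < n, I.col u ≠ i) : Adding I B j μ ν (i + 1) P pt rad where
  card_le := h.card_le.trans (Nat.le_succ _)
  pt_lt := h.pt_lt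
  new c hc := by
    rcases Nat.lt_succ_iff_lt_or_eq.1 hc with hc | rfl
    · exact h.new c hc
    · have hc0 : classSet I c = ∅ := Set.eq_empty_of_forall_notMem fun u hu => hempty u hu.1 hu.2
      exact ClassSample.congr (IsFarthestSample.succ_of_empty (h.old c hi le_rfl) hc0)
        fun u hu huc => absurd huc (hempty u hu)
  old c hc hic := h.old c hc (by omega)

theorem Adding.succ (h : Adding I B j μ ν i P pt rad) (hi : i < m) (hw : w ∈ classSet I i)
    (hmax : ∀ u ∈ classSet I i, μ u ≤ μ w)
    (hν : ∀ u < n, I.col u = i → ν u = min (μ u) (I.d u w)) :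
    Adding I B j μ ν (i + 1) (P + 1) (Function.update pt P w) (Function.update rad P (μ w)) where
  card_le := Nat.succ_le_succ h.card_le
  pt_lt p hp := by
    rcases Nat.lt_succ_iff_lt_or_eq.1 hp with hp | rfl
    · rw [Function.update_of_ne hp.ne]
      exact h.pt_lt p hp
    · rw [Function.update_self]
      exact hw.1
  new c hc := by
    rcases Nat.lt_succ_iff_lt_or_eq.1 hc with hc | rfl
    · exact (h.new c hc).update_of_ne (by rw [hw.2]; exact hc.ne')
    · exact ((h.old c hi le_rfl).update hw hmax).congr hν
  old c hc hic := (h.old c hc (by omega)).update_of_ne (by rw [hw.2]; omega)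

/-- Add the farthest element of the class `vI`, if any, to the list of points. -/
def addPoint : Prog :=
  .ite (.nlt (.lit 0) (.get aBest (.var vI)))
    (.block [
      .nset aPt (.var aP) (.sub (.get aBest (.var vI)) (.lit 1)),
      .rset rRad (.var aP) (.get rMin (.sub (.get aBest (.var vI)) (.lit 1))),
      .incr aP])
    .skip

/-- The distances to the points after a round in which each class `c` has got the point
`best c - 1`. -/
noncomputable def newDist (I : Instance n m) (best : ℕ → ℕ) (μ : ℕ → ℝ) (u : ℕ) : ℝ :=
  min (μ u) (I.d u (best (I.col u) - 1))

theorem addPoint_spec (hi : s.nat vI 0 < m)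
    (hbest : IsBest I n (s.real rMin) (s.nat vI 0) (s.nat aBest (s.nat vI 0)))
    (h : Adding I B j (s.real rMin) (newDist I (s.nat aBest) (s.real rMin)) (s.nat vI 0)
      (s.nat aP 0) (s.nat aPt) (s.real rRad)) :
    Does I addPoint s 5 fun s' =>
      Adding I B j (s.real rMin) (newDist I (s.nat aBest) (s.real rMin)) (s.nat vI 0 + 1)
        (s'.nat aP 0) (s'.nat aPt) (s'.real rRad) := by
  refine Does.of_wp ?_
  simp only [addPoint, Prog.wp, Prog.block, BExp.holds_nlt, RExp.eval_get, NExp.eval_get,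
    NExp.eval_lit, NExp.eval_add, NExp.eval_sub, Store.nat_setNat_self, Store.nat_setNat_of_ne,
    Store.nat_setReal, Store.real_setNat, Store.real_setReal_self, ne_eq, Nat.reduceEqDiff,
    not_false_eq_true, Function.update_self]
  rcases hbest with ⟨hb, hempty⟩ | ⟨w, hw, hb, hc, hmax⟩
  · exact ⟨fun hb' => absurd hb hb'.ne', fun _ => h.succ_of_empty hi hempty⟩
  · refine ⟨fun _ => ?_, fun hb' => absurd (hb ▸ w.succ_pos) hb'⟩
    rw [hb, Nat.add_sub_cancel]
    exact h.succ hi ⟨hw, hc⟩ (fun u hu => hmax u hu.1 hu.2) fun u _ hu => by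
      rw [newDist, hu, hb, Nat.add_sub_cancel]

/-- The state of farthest point sampling in all classes after `j` rounds, with initial
distance `B`. -/
structure SampleState (I : Instance n m) (B : ℝ) (j : ℕ) (s : Store) : Prop where
  card_le : s.nat aP 0 ≤ j * m
  pt_lt : ∀ p < s.nat aP 0, s.nat aPt p < n
  sample : ∀ c < m, ClassSample I B c j (s.nat aP 0) (s.nat aPt) (s.real rRad) (s.real rMin)

/-- Add the farthest elements of all classes to the list of points. -/
def addPoints : Prog := .for vI .numClasses addPoint

theorem addPoints_spec (hbest : ∀ c < m, IsBest I n (s.real rMin) c (s.nat aBest c))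
    (h : SampleState I B j s) :
    Does I addPoints s (7 * m + 2) fun s' =>
      Adding I B j (s.real rMin) (newDist I (s.nat aBest) (s.real rMin)) m
        (s'.nat aP 0) (s'.nat aPt) (s'.real rRad) := by
  refine (Does.for (N := m) (T := 5) (fun i s' =>
    Adding I B j (s.real rMin) (newDist I (s.nat aBest) (s.real rMin)) i
      (s'.nat aP 0) (s'.nat aPt) (s'.real rRad))
    (fun _ _ => rfl) ⟨h.card_le, h.pt_lt, by simp, fun c hc _ => h.sample c hc⟩ ?_
    fun _ _ h => h).le (by omega)
  rintro _ hi s' hf rfl h'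
  rw [← hf.nat aBest, ← hf.real rMin] at *
  exact addPoint_spec hi (hbest _ hi) h'

/-- Update the distance of the element `vI` to the points. -/
def updateDist : Prog :=
  .ite (.rlt (.dist (.var vI) (.sub (.get aBest (.color (.var vI))) (.lit 1)))
      (.get rMin (.var vI)))
    (.rset rMin (.var vI) (.dist (.var vI) (.sub (.get aBest (.color (.var vI))) (.lit 1))))
    .skip

theorem updateDist_spec :
    Does I updateDist s 3 fun s' => s'.real rMin =
      Function.update (s.real rMin) (s.nat vI 0)
        (newDist I (s.nat aBest) (s.real rMin) (s.nat vI 0)) := by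
  refine Does.of_wp ?_
  simp only [updateDist, Prog.wp, BExp.holds_rlt, RExp.eval_get, RExp.eval_dist, NExp.eval_get,
    NExp.eval_lit, NExp.eval_sub, NExp.eval_color, Store.real_setReal_self, newDist]
  refine ⟨fun hlt => ?_, fun hge => ?_⟩
  · rw [min_eq_right hlt.le]
  · rw [min_eq_left (not_lt.1 hge), Function.update_eq_self]

/-- Update the distances of all elements to the points. -/
def updateDists : Prog := .for vI .numElems updateDist

theorem updateDists_spec :
    Does I updateDists s (5 * n + 2) fun s' =>
      ∀ u < n, s'.real rMin u = newDist I (s.nat aBest) (s.real rMin) u := by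
  refine (Does.for (N := n) (T := 3) (fun U s' =>
    (∀ u < U, s'.real rMin u = newDist I (s.nat aBest) (s.real rMin) u) ∧
      ∀ u, U ≤ u → s'.real rMin u = s.real rMin u) (fun _ _ => rfl) (by simp) ?_
    fun _ _ h => h.1).le (by omega)
  rintro _ - s' hf rfl ⟨hnew, hold⟩
  refine updateDist_spec.mono le_rfl fun s'' _ h => ?_
  rw [h, hf.nat aBest]
  refine ⟨forall_lt_succ_update hnew ?_, fun u hu => ?_⟩
  · rw [newDist, newDist, hold _ le_rfl]
  · rw [Function.update_of_ne (by omega), hold u (by omega)]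

/-- A round of farthest point sampling in all classes. -/
def sampleRound : Prog := .block [farthest, addPoints, updateDists]

theorem sampleRound_spec (h : SampleState I B j s) :
    Does I sampleRound s (12 * (n + m + 1)) (SampleState I B (j + 1)) := by
  refine (farthest_spec.seq (T₂ := (7 * m + 2) + (5 * n + 2)) ?_).le (by omega)
  intro s₁ hf₁ hbest
  rw [← hf₁.real rMin] at hbest
  have h₁ : SampleState I B j s₁ := by
    constructor <;> simp only [hf₁.nat aP, hf₁.nat aPt, hf₁.real rRad, hf₁.real rMin]
    exacts [h.card_le, h.pt_lt, h.sample]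
  refine (addPoints_spec hbest h₁).seq fun s₂ hf₂ h₂ =>
    updateDists_spec.mono le_rfl fun s₃ hf₃ hdist => ?_
  rw [hf₂.nat aBest, hf₂.real rMin] at hdist
  constructor <;> simp only [hf₃.nat aP, hf₃.nat aPt, hf₃.real rRad]
  · rw [Nat.succ_mul]
    exact h₂.card_le
  · exact h₂.pt_lt
  · exact fun c hc => (h₂.new c hc).congr fun u hu _ => hdist u hu

/-- Start farthest point sampling without points. -/
def sampleInit : Prog := .block [
  .nass aP (.lit 0),
  .for vI .numElems (.rset rMin (.var vI) (.mul (.ofNat .numClasses) (.var rTop)))]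

theorem sampleInit_spec :
    Does I sampleInit s (3 * n + 3) (SampleState I (m * s.real rTop 0) 0) := by
  refine ((Does.nass aP _).seq (T₂ := n * (1 + 2) + 2) ?_).le (by omega)
  rintro _ - rfl
  refine Does.for (fun U s' => ∀ u < U, s'.real rMin u = m * s.real rTop 0) (fun _ _ => rfl)
    (by simp) ?_ fun s' hf hdist => ?_
  · intro U _ s' hf hv h
    refine Does.of_wp ?_ le_rfl
    simp only [Prog.wp, RExp.eval_mul, RExp.eval_ofNat, RExp.eval_get, NExp.eval_numClasses,
      NExp.eval_get, NExp.eval_lit, hv, hf.real rTop, Store.real_setNat, Store.real_setReal_self]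
    exact forall_lt_succ_update (f := fun _ => m * s.real rTop 0) h rfl
  · have hP : s'.nat aP 0 = 0 := by simp [hf.nat aP]
    refine ⟨by omega, by omega, fun c _ => ?_⟩
    rw [ClassSample, hP]
    exact IsFarthestSample.init fun u hu => hdist u hu.1

/-- Farthest point sampling with `aK` rounds in all classes. -/
def sample : Prog := .block [sampleInit, .for vJ (.var aK) sampleRound]

theorem sample_spec (hk : s.nat aK 0 = I.k) :
    Does I sample s (20 * (I.k + 1) * (n + m + 1)) fun s' =>
      s'.nat aP 0 ≤ I.k * m ∧
      Sampled I (s.real rTop 0) (s'.nat aP 0) (s'.nat aPt) (s'.real rRad) := by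
  refine (sampleInit_spec.seq (T₂ := I.k * ((12 * (n + m + 1)) + 2) + 2) ?_).le (by nlinarith)
  intro s₁ hf₁ h₁
  rw [← hf₁.nat aK] at hk
  rw [← hk]
  exact Does.for_var (fun j s' => SampleState I (m * s.real rTop 0) j s') h₁
    (fun j _ s' _ _ h => sampleRound_spec h) (fun s' _ h => ⟨h.card_le, h.pt_lt, _, hk ▸ h.sample⟩)
    (hInv := fun _ _ _ h => ⟨h.card_le, h.pt_lt, h.sample⟩)

end Sample

section Setup

theorem count_congr_of_lt {p q : ℕ → Prop} [DecidablePred p] [DecidablePred q] {N : ℕ}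
    (h : ∀ j < N, p j ↔ q j) : Nat.count p N = Nat.count q N := by
  rw [Nat.count_eq_card_filter_range, Nat.count_eq_card_filter_range,
    Finset.filter_congr fun j hj => h j (Finset.mem_range.1 hj)]

theorem card_filter_univ_eq_count {n : ℕ} (p : ℕ → Prop) [DecidablePred p] :
    (Finset.univ.filter fun u : Fin n => p u).card = Nat.count p n := by
  rw [Nat.count_eq_card_filter_range, Finset.card_filter, Finset.card_filter, Finset.sum_range]

theorem IsSlots.append {m N i : ℕ} {need need' slot : ℕ → ℕ} (h : IsSlots m N need slot)
    (hi : i < m) (hneed : ∀ c, need' c = need c + if i = c then 1 else 0) :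
    IsSlots m (N + 1) need' (Function.update slot N i) where
  lt j hj := by
    rcases Nat.lt_succ_iff_lt_or_eq.1 hj with hj | rfl
    · rw [Function.update_of_ne hj.ne]; exact h.lt j hj
    · rwa [Function.update_self]
  count c hc := by
    rw [Nat.count_succ, Function.update_self, hneed, ← h.count c hc]
    congr 1
    exact count_congr_of_lt fun j hj => by rw [Function.update_of_ne hj.ne]

theorem IsSlots.sum_need {m N : ℕ} {need slot : ℕ → ℕ} (h : IsSlots m N need slot) :
    ∑ c ∈ Finset.range m, need c = N := by
  have hmaps : ∀ j ∈ Finset.range N, slot j ∈ Finset.range m := fun j hj =>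
    Finset.mem_range.2 (h.lt j (Finset.mem_range.1 hj))
  calc ∑ c ∈ Finset.range m, need c
      = ∑ c ∈ Finset.range m, ((Finset.range N).filter (slot · = c)).card :=
        Finset.sum_congr rfl fun c hc => by
          rw [← h.count c (Finset.mem_range.1 hc), Nat.count_eq_card_filter_range]
    _ = N := by rw [← Finset.card_eq_sum_card_fiberwise hmaps, Finset.card_range]

variable {n m : ℕ} {I : Instance n m} {s : Store}

/-- The numbers of occurrences of the classes when the classes below `i` are complete and the
class `i` has been listed `r` times. -/
def partialQuota (I : Instance n m) (i r c : ℕ) : ℕ :=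
  if c < i then I.quo c else if c = i then r else 0

theorem partialQuota_succ (i r c : ℕ) :
    partialQuota I i (r + 1) c = partialQuota I i r c + if i = c then 1 else 0 := by
  unfold partialQuota
  split_ifs <;> omega

theorem partialQuota_quo (i : ℕ) : partialQuota I i (I.quo i) = partialQuota I (i + 1) 0 := by
  funext c
  rcases lt_trichotomy c i with h | rfl | h
  · simp [partialQuota, h, h.trans i.lt_succ_self]
  · simp [partialQuota]
  · simp [partialQuota, h.not_gt, h.ne', (Nat.succ_le_of_lt h).not_gt]

/-- List the classes with multiplicities given by the quotas. -/
def setup : Prog := .for vI .numClasses (.for vJ (.quota (.var vI))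
  (.block [.nset aSlot (.var aK) (.var vI), .incr aK]))

theorem setup_spec (hk : s.nat aK 0 = 0) :
    Does I setup s (4 * (I.k * m + m + 1)) fun s' =>
      s'.nat aK 0 = I.k ∧ IsSlots m I.k I.quo (s'.nat aSlot) := by
  refine (Does.for (N := m) (T := I.k * (2 + 2) + 2)
    (fun i s' => IsSlots m (s'.nat aK 0) (partialQuota I i 0) (s'.nat aSlot)) (fun _ _ => rfl)
    ?_ ?_ ?_).le (by nlinarith)
  · rw [hk]
    exact ⟨fun _ h => absurd h (Nat.not_lt_zero _), fun c _ => by simp [partialQuota]⟩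
  · rintro i hi s₁ - hv h₁
    refine (Does.for (N := I.quo i) (T := 2)
      (fun r s₂ => IsSlots m (s₂.nat aK 0) (partialQuota I i r) (s₂.nat aSlot))
      (fun s₂ hf₂ => by simp [hf₂.nat vI, hv]) h₁ ?_ ?_).le (by have := I.quo_le_k hi; gcongr)
    · rintro r - s₂ hf₂ - h₂
      refine Does.of_wp ?_
      simp only [Prog.wp, Prog.block, Prog.incr, NExp.eval_get, NExp.eval_lit, NExp.eval_add,
        Store.nat_setNat_self, Store.nat_setNat_of_ne, ne_eq, not_false_eq_true,
        Function.update_self, OfNat.one_ne_ofNat, OfNat.ofNat_ne_one, hf₂.nat vI, hv]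
      exact h₂.append hi fun c => partialQuota_succ i r c
    · rintro s₂ - h₂
      rwa [partialQuota_quo] at h₂
  · rintro s' - h
    have hcard : s'.nat aK 0 = I.k := by
      rw [← h.sum_need, ← I.sum_quo]
      exact Finset.sum_congr rfl fun c hc => if_pos (Finset.mem_range.1 hc)
    rw [hcard] at h
    exact ⟨hcard, h.lt, fun c hc => (h.count c hc).trans (if_pos hc)⟩

/-- The invariant of the greedy choice of a fair set after the elements below `U` have been
considered: the vector `o` marks the chosen elements and `chosen` counts them by class. -/
structure IsGreedyChoice (I : Instance n m) (U : ℕ) (o chosen : ℕ → ℕ) : Prop where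
  eq_zero : ∀ u, U ≤ u → o u = 0
  count : ∀ c < m, Nat.count (fun u => I.col u = c ∧ o u = 1) U = chosen c
  eq_min : ∀ c < m, chosen c = min (I.quo c) (Nat.count (I.col · = c) U)

variable {U : ℕ} {o chosen : ℕ → ℕ}

theorem IsGreedyChoice.choose (h : IsGreedyChoice I U o chosen)
    (hlt : chosen (I.col U) < I.quo (I.col U)) :
    IsGreedyChoice I (U + 1) (Function.update o U 1)
      (Function.update chosen (I.col U) (chosen (I.col U) + 1)) where
  eq_zero u hu := by rw [Function.update_of_ne (by omega), h.eq_zero u (by omega)]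
  count c hc := by
    have hbelow : Nat.count (fun u => I.col u = c ∧ Function.update o U 1 u = 1) U = chosen c := by
      rw [← h.count c hc]
      exact count_congr_of_lt fun u hu => by rw [Function.update_of_ne hu.ne]
    rw [Nat.count_succ, hbelow, Function.update_self]
    by_cases hUc : I.col U = c
    · subst hUc; simp
    · simp [hUc, Function.update_of_ne (Ne.symm hUc)]
  eq_min c hc := by
    have hmin := h.eq_min c hc
    rw [Nat.count_succ]
    by_cases hUc : I.col U = c
    · subst hUc
      rw [Function.update_self, if_pos rfl]
      omega
    · rw [Function.update_of_ne (Ne.symm hUc), if_neg hUc, hmin, add_zero]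

theorem IsGreedyChoice.skip (h : IsGreedyChoice I U o chosen)
    (hle : ¬ chosen (I.col U) < I.quo (I.col U)) : IsGreedyChoice I (U + 1) o chosen where
  eq_zero u hu := h.eq_zero u (by omega)
  count c hc := by
    rw [Nat.count_succ, h.count c hc, if_neg fun hU => by simp [h.eq_zero U le_rfl] at hU, add_zero]
  eq_min c hc := by
    have hmin := h.eq_min c hc
    rw [Nat.count_succ]
    split_ifs with hUc
    · subst hUc; omega
    · exact hmin

theorem IsGreedyChoice.isFair {s : Store} (h : IsGreedyChoice I n (s.nat 0) chosen)
    (hq : ∀ i, I.quota i ≤ (I.group i).card) : I.IsFair (s.output n) := by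
  intro i
  have hgroup : (I.group i).card = Nat.count (I.col · = i) n := by
    rw [← card_filter_univ_eq_count]
    simp only [Instance.group, I.col_coe, Fin.ext_iff]
  calc (s.output n ∩ I.group i).card
      = Nat.count (fun u => I.col u = i ∧ s.nat 0 u = 1) n := by
        rw [← card_filter_univ_eq_count, Store.output, Instance.group, ← Finset.filter_and]
        simp only [I.col_coe, Fin.ext_iff, and_comm]
    _ = min (I.quo i) (Nat.count (I.col · = i) n) := by rw [h.count i i.2, h.eq_min i i.2]
    _ = I.quota i := by rw [← hgroup, I.quo_coe, min_eq_left (hq i)]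

/-- Choose elements greedily until all quotas are filled. -/
def fallback : Prog :=
  .for vI .numElems (.ite (.nlt (.get aCnt (.color (.var vI))) (.quota (.color (.var vI))))
    (.block [
      .nset 0 (.var vI) (.lit 1),
      .nset aCnt (.color (.var vI)) (.add (.get aCnt (.color (.var vI))) (.lit 1))])
    .skip)

theorem fallback_spec (h0 : ∀ u, s.nat 0 u = 0) (hc : ∀ c, s.nat aCnt c = 0)
    (hq : ∀ i, I.quota i ≤ (I.group i).card) :
    Does I fallback s (6 * n + 2) fun s' => I.IsFair (s'.output n) := by
  refine (Does.for (N := n) (T := 4) (fun U s' => IsGreedyChoice I U (s'.nat 0) (s'.nat aCnt))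
    (fun _ _ => rfl) ?_ ?_ fun s' _ h => h.isFair hq).le (by omega)
  · exact ⟨fun u _ => h0 u, fun c _ => by simp [hc], fun c _ => by simp [hc]⟩
  · rintro U - s' - hv h
    refine Does.of_wp ?_
    simp only [Prog.wp, Prog.block, BExp.holds_nlt, NExp.eval_get, NExp.eval_lit, NExp.eval_add,
      NExp.eval_color, NExp.eval_quota, hv, Store.nat_setNat_self, Store.nat_setNat_of_ne, ne_eq,
      not_false_eq_true, OfNat.ofNat_ne_zero, OfNat.zero_ne_ofNat]
    exact ⟨h.choose, h.skip⟩

end Setup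

/-! ### The approximation guarantee -/

section Optimum

variable {n m : ℕ} {I : Instance n m}

theorem not_rich_of_forall_d_lt {pt : ℕ → ℕ} {Y : Finset ℕ} {t : ℝ} (hk : 1 < I.k)
    (hpt : ∀ p ∈ Y, pt p < n) (hlt : ∀ u < n, ∀ v < n, I.d u v < t) : ¬ Rich I pt Y t := by
  intro h
  obtain ⟨S, hSY, -, hinj, hcard⟩ := h (Finset.range m) (Finset.Subset.refl _)
  rw [I.sum_quo] at hcard
  obtain ⟨p, hp, q, hq, hpq⟩ := Finset.one_lt_card.1 (hk.trans_le hcard)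
  have hadj : (nearGraph (I.ptDist pt) Y t).Adj p q :=
    (nearGraph_adj (isPseudoDist_ptDist hpt).comm).2
      ⟨hpq, hSY hp, hSY hq, hlt _ (hpt p (hSY hp)) _ (hpt q (hSY hq))⟩
  exact hpq (hinj hp hq (SimpleGraph.ConnectedComponent.eq.2 hadj.reachable))

theorem lt_iff_lt_of_inside_eq_empty {N a : ℕ} {cand : ℕ → ℝ} {lo hi t : ℝ}
    (h : inside N cand lo hi = ∅) (ha : a < N) (hlo : lo < t) (hhi : t ≤ hi) :
    cand a < t ↔ cand a < hi := by
  refine ⟨fun hlt => hlt.trans_le hhi, fun hlt => ?_⟩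
  by_contra! hle
  exact Finset.eq_empty_iff_forall_notMem.1 h a (mem_inside.2 ⟨ha, hlo.trans_le hle, hlt⟩)

theorem net_eq_of_inside_eq_empty {P : ℕ} {rad : ℕ → ℝ} {lo hi t : ℝ} (hm : 0 < m)
    (h : inside P (fun p => rad p / m) lo hi = ∅) (hlo : lo < t) (hhi : t ≤ hi) :
    net m P rad t = net m P rad hi := by
  have hle_iff (p : ℕ) (x : ℝ) : m * x ≤ rad p ↔ ¬ rad p / m < x := by
    rw [not_lt, le_div_iff₀' (Nat.cast_pos.2 hm)]
  ext p
  rw [mem_net, mem_net]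
  exact and_congr_right fun hp => by
    rw [hle_iff, hle_iff, lt_iff_lt_of_inside_eq_empty h hp hlo hhi]

theorem PrimOrder.rich_of_inside_eq_empty {pt y : ℕ → ℕ} {Y : Finset ℕ} {M : ℕ} {key : ℕ → ℝ}
    {lo hi t : ℝ} (hp : PrimOrder (I.ptDist pt) Y M y key) (hpt : ∀ p ∈ Y, pt p < n)
    (h : inside M key lo hi = ∅) (hlo : lo < t) (hhi : t ≤ hi) (hr : Rich I pt Y t) :
    Rich I pt Y hi :=
  hp.hallCondition_congr (isPseudoDist_ptDist hpt).comm
    (fun _ hj _ => lt_iff_lt_of_inside_eq_empty h hj hlo hhi) hr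

theorem ofReal_le_div_iff {S : Finset (Fin n)} {t : ℝ} :
    ENNReal.ofReal t ≤ I.div S ↔ ∀ u ∈ S, ∀ v ∈ S, u ≠ v → t ≤ I.dist u v := by
  simp only [Instance.div, le_iInf_iff, ENNReal.ofReal_le_ofReal_iff (I.dist_nonneg _ _)]

/-- If the optimum exceeded the bound, then so would the bound for a slightly larger threshold,
which would thus be reachable. -/
theorem opt_le_of_not_rich {P : ℕ} {pt : ℕ → ℕ} {rad : ℕ → ℝ} {top lo hi : ℝ}
    (hs : Sampled I top P pt rad) (h0 : 0 ≤ lo) (hlt : lo < hi) (htop : hi ≤ top)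
    (hfail : ∀ t, lo < t → t ≤ hi → ¬ Rich I pt (net m P rad t) t) :
    I.opt ≤ ENNReal.ofReal ((3 * m - 1) * lo) := by
  refine iSup₂_le fun S hS => not_lt.1 fun hdiv => ?_
  have hcont : Continuous fun t : ℝ => ENNReal.ofReal ((3 * m - 1) * t) :=
    ENNReal.continuous_ofReal.comp (continuous_const_mul _)
  obtain ⟨t, hdiv, hlo, hhi⟩ := (((hcont.continuousAt.eventually_lt_const hdiv).filter_mono
    nhdsWithin_le_nhds).and (Ioo_mem_nhdsGT hlt)).exists
  exact hfail t hlo hhi.le (rich_of_isFair (fun p hp => hs.pt_lt p (mem_net.1 hp).1)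
    (hs.isSeparated (h0.trans_lt hlo)) (hs.covers (hhi.le.trans htop)) hS
    (ofReal_le_div_iff.1 hdiv.le))

theorem card_eq_k_of_isFair {S : Finset (Fin n)} (hS : I.IsFair S) : S.card = I.k := by
  rw [← I.sum_quo, ← card_filter_col_mem hS (Finset.Subset.refl _), Finset.filter_true_of_mem]
  exact fun u _ => Finset.mem_range.2 (I.col_lt u.2)

theorem div_eq_top_of_card_le_one {S : Finset (Fin n)} (hS : S.card ≤ 1) : I.div S = ⊤ := by
  simp only [Instance.div, iInf_eq_top]
  exact fun u hu v hv huv => absurd (Finset.card_le_one.1 hS u hu v hv) huv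

theorem opt_div_le_div {S : Finset (Fin n)} {t : ℝ} (hS : I.IsFair S) (ht : 0 ≤ t)
    (hopt : I.k ≤ 1 ∨ I.opt ≤ ENNReal.ofReal ((3 * m - 1) * t))
    (hdiv : ENNReal.ofReal t ≤ I.div S) : I.opt / (3 * (m : ℝ≥0∞) - 1) ≤ I.div S := by
  rcases hopt with hk | hopt
  · rw [div_eq_top_of_card_le_one (by rwa [card_eq_k_of_isFair hS])]
    exact le_top
  · have hfactor : ENNReal.ofReal (3 * m - 1) = 3 * (m : ℝ≥0∞) - 1 := by
      rw [ENNReal.ofReal_sub _ zero_le_one, ENNReal.ofReal_mul (by norm_num),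
        ENNReal.ofReal_natCast, ENNReal.ofReal_one, ENNReal.ofReal_ofNat]
    rw [ENNReal.ofReal_mul' ht, hfactor, mul_comm] at hopt
    exact ENNReal.div_le_of_le_mul (hopt.trans (by gcongr))

end Optimum

/-! ### The algorithm -/

section Main

variable {n m : ℕ} {I : Instance n m} {s : Store}

/-- Let the candidates be the values of the expression `x` for the values of `vI` below `a`. -/
def fillCands (a : ℕ) (x : RExp) : Prog :=
  .block [.nass aNc (.var a), .for vI (.var a) (.rset rCand (.var vI) x)]

theorem fillCands_spec {a : ℕ} {x : RExp} {f : ℕ → ℝ} (ha : a ∉ [aNc, vI])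
    (hx : ∀ s', Frame (fillCands a x) s s' → x.eval I s' = f (s'.nat vI 0)) :
    Does I (fillCands a x) s (3 * s.nat a 0 + 3) fun s' =>
      s'.nat aNc 0 = s.nat a 0 ∧ ∀ p < s.nat a 0, s'.real rCand p = f p := by
  obtain ⟨haNc, haI⟩ : a ≠ aNc ∧ a ≠ vI := by simpa using ha
  refine ((Does.nass aNc (.var a)).seq (T₂ := s.nat a 0 * (1 + 2) + 2) ?_).le (by omega)
  intro s₁ hf₁ h₁
  have hNc : s₁.nat aNc 0 = s.nat a 0 := by simp [h₁]
  rw [← hf₁.nat a (by simpa [Prog.natWrites] using haNc)] at hNc ⊢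
  refine Does.for_var (fun j s' => ∀ p < j, s'.real rCand p = f p) (by simp) ?_
    (fun s' hf hfill => ⟨?_, hfill⟩) (by simpa [Prog.for, Prog.natWrites] using haI)
    (by simp [Prog.natWrites])
  · intro j _ s' hf hv hfill
    have hframe : Frame (fillCands a x) s s' := (hf₁.mono (List.subset_append_left _ _)
      (List.subset_append_left _ _)).trans
      (hf.mono (List.subset_append_right _ _) (List.subset_append_right _ _))
    refine Does.of_wp ?_ le_rfl
    simp only [Prog.wp, NExp.eval_get, NExp.eval_lit, hx s' hframe, hv, Store.real_setReal_self]
    exact forall_lt_succ_update hfill rfl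
  · rw [hf.nat aNc (by simp [Prog.for, Prog.natWrites]), hNc]

/-- Time bound for a search. -/
def searchTime (I : Instance n m) : ℕ :=
  130 * ((I.k * m).size + 2) * ((I.k * m + 1) * (I.k * m + 1))

/-- Search among the values of the expression `x` for the values of `vI` below `a`. -/
def searchCands (a : ℕ) (x : RExp) : Prog := .block [fillCands a x, search]

theorem searchCands_spec {a : ℕ} {x : RExp} {f : ℕ → ℝ} (h : Ready I s) (hb : Bracket I s)
    (hN : s.nat a 0 ≤ I.k * m) (ha : a ∉ [aNc, vI])
    (hx : ∀ s', Frame (fillCands a x) s s' → x.eval I s' = f (s'.nat vI 0)) :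
    Does I (searchCands a x) s (3 * (I.k * m) + 3 + searchTime I) fun s' =>
      Bracket I s' ∧ s.real rLo 0 ≤ s'.real rLo 0 ∧ s'.real rHi 0 ≤ s.real rHi 0 ∧
        inside (s.nat a 0) f (s'.real rLo 0) (s'.real rHi 0) = ∅ := by
  refine ((fillCands_spec ha hx).le (by omega)).seq ?_
  rintro s₁ hf₁ ⟨hNc, hfill⟩
  -- The arrays written do not depend on `a` and `x`, but `decide` needs a closed program.
  replace hf₁ : Frame (fillCands aP (.var rT)) s s₁ :=
    hf₁.mono (List.Subset.refl _) (List.Subset.refl _)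
  refine (search_spec (h.frame hf₁) (by rwa [hNc]) (hb.frame hf₁)).mono le_rfl ?_
  rintro s₂ hf₂ ⟨hs₂, hdone⟩
  rw [remaining, Finset.card_eq_zero, hf₂.nat aNc, hf₂.real rCand, hNc] at hdone
  rw [← hf₁.real rLo, ← hf₁.real rHi]
  refine ⟨hs₂.bracket, hs₂.lo_le, hs₂.le_hi, ?_⟩
  rw [← hdone]
  exact Finset.filter_congr fun p hp => by rw [hfill p (Finset.mem_range.1 hp)]

/-- Search among the thresholds at which the set of points changes. -/
def searchRadii : Prog := .block [
  .rass rLo (.ofNat (.lit 0)),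
  .rass rHi (.var rTop),
  searchCands aP (.div (.get rRad (.var vI)) (.ofNat .numClasses))]

theorem searchRadii_spec (h : Ready I s) (hk : 1 < I.k) (h0 : 0 < s.real rTop 0)
    (hd : ∀ u < n, ∀ v < n, I.d u v < s.real rTop 0) :
    Does I searchRadii s (3 * (I.k * m) + 5 + searchTime I) fun s' =>
      Bracket I s' ∧ s'.real rHi 0 ≤ s.real rTop 0 ∧
        inside (s.nat aP 0) (fun p => s.real rRad p / m) (s'.real rLo 0) (s'.real rHi 0) = ∅ := by
  refine ((Does.rass rLo _).seq (T₂ := 1 + (3 * (I.k * m) + 3 + searchTime I)) ?_).le (by omega)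
  intro s₁ hf₁ h₁
  refine (Does.rass rHi (.var rTop)).seq ?_
  intro s₂ hf₂ h₂
  have hlo : s₂.real rLo 0 = 0 := by rw [hf₂.real rLo]; simp [h₁]
  have hhi : s₂.real rHi 0 = s.real rTop 0 := by rw [← hf₁.real rTop]; simp [h₂]
  have hready : Ready I s₂ := (h.frame hf₁).frame hf₂
  have hb : Bracket I s₂ := by
    refine ⟨hlo.ge, by rwa [hlo, hhi], Or.inl hlo, ?_⟩
    rw [hhi]
    exact not_rich_of_forall_d_lt hk (fun p hp => hready.pt_lt p (mem_net.1 hp).1) hd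
  rw [← hf₁.real rRad, ← hf₂.real rRad, ← hf₁.nat aP, ← hf₂.nat aP, ← hhi]
  refine (searchCands_spec (f := fun p => s₂.real rRad p / m) hready hb hready.card_le (by decide)
    fun s' hf => ?_).mono le_rfl fun s₃ _ h₃ => ⟨h₃.1, h₃.2.2⟩
  simp [hf.real rRad]

/-- Search among the thresholds at which the components of the set of points for `rHi` change. -/
def searchKeys : Prog :=
  .block [.rass rT (.var rHi), test, searchCands aM (.get rKey (.var vI))]

theorem searchKeys_spec (h : Ready I s) (hm : 0 < m) (hb : Bracket I s)
    (hrad : inside (s.nat aP 0) (fun p => s.real rRad p / m) (s.real rLo 0) (s.real rHi 0) = ∅) :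
    Does I searchKeys s
      (100 * (I.k * m + 1) * (I.k * m + 1) + 3 * (I.k * m) + 4 + searchTime I) fun s' =>
        Bracket I s' ∧ s'.real rHi 0 ≤ s.real rHi 0 ∧
          ∀ t, s'.real rLo 0 < t → t ≤ s'.real rHi 0 → ¬ Passes I s' t := by
  refine ((Does.rass rT (.var rHi)).seq (T₂ := 100 * (I.k * m + 1) * (I.k * m + 1) +
    (3 * (I.k * m) + 3 + searchTime I)) ?_).le (by omega)
  intro s₁ hf₁ h₁
  have hT : s₁.real rT 0 = s.real rHi 0 := by simp [h₁]
  have h₁ : Ready I s₁ := h.frame hf₁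
  refine (test_spec h₁).seq ?_
  rintro s₂ hf₂ ⟨hM, hc, -⟩
  refine (searchCands_spec (f := s₂.real rKey) (h₁.frame hf₂) ((hb.frame hf₁).frame hf₂)
    (hM.trans h₁.card_le) (by decide) fun s' hf => by simp [hf.real rKey]).mono le_rfl ?_
  rintro s₃ hf₃ ⟨hb₃, hlo, hhi, hkeys⟩
  rw [hf₂.real rLo, hf₁.real rLo] at hlo
  rw [hf₂.real rHi, hf₁.real rHi] at hhi
  have hnet (t : ℝ) (hlt : s₃.real rLo 0 < t) (hle : t ≤ s₃.real rHi 0) :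
      netAt m s t = netAt m s (s.real rHi 0) :=
    net_eq_of_inside_eq_empty hm hrad (hlo.trans_lt hlt) (hle.trans hhi)
  have hcongr : netAt m s₁ = netAt m s := by
    ext1 t
    rw [netAt, netAt, hf₁.nat aP, hf₁.real rRad]
  rw [hcongr, hT] at hc
  have hpt : s₂.nat aPt = s.nat aPt := by rw [hf₂.nat aPt, hf₁.nat aPt]
  refine ⟨hb₃, hhi, fun t hlt hle hpass => hb₃.fail ?_⟩
  rw [passes_frame hf₃, passes_frame hf₂, passes_frame hf₁, Passes] at hpass ⊢
  rw [hnet t hlt hle] at hpass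
  rw [hnet _ hb₃.lt le_rfl]
  rw [← hpt] at hpass ⊢
  exact hc.order.rich_of_inside_eq_empty hc.pt_lt hkeys hlt hle hpass

/-- Compute points and the best threshold for them. -/
def optimize : Prog := .block [bound, sample, searchRadii, searchKeys]

/-- Time bound for the computation of the best threshold. -/
def optimizeTime (I : Instance n m) : ℕ :=
  (3 * n + 4) + (20 * (I.k + 1) * (n + m + 1) + ((3 * (I.k * m) + 5 + searchTime I) +
    (100 * (I.k * m + 1) * (I.k * m + 1) + 3 * (I.k * m) + 4 + searchTime I)))

theorem optimize_spec (hk : s.nat aK 0 = I.k) (hslot : IsSlots m I.k I.quo (s.nat aSlot))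
    (hk1 : 1 < I.k) :
    Does I optimize s (optimizeTime I) fun s' => Ready I s' ∧ Bracket I s' ∧
      I.opt ≤ ENNReal.ofReal ((3 * m - 1) * s'.real rLo 0) := by
  have hm : 0 < m := (Nat.zero_le _).trans_lt (hslot.1 0 (by omega))
  refine bound_spec.seq ?_
  rintro s₁ hf₁ ⟨h0, hd⟩
  rw [← hf₁.nat aK] at hk
  refine (sample_spec hk).seq ?_
  rintro s₂ hf₂ ⟨hP, hsample⟩
  rw [← hf₂.real rTop] at h0 hd hsample
  have hready : Ready I s₂ := ⟨by rw [hf₂.nat aK, hk],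
    by rwa [hf₂.nat aSlot, hf₁.nat aSlot], hP, hsample.pt_lt⟩
  refine (searchRadii_spec hready hk1 h0 hd).seq ?_
  rintro s₃ hf₃ ⟨hb₃, htop, hrad⟩
  rw [← hf₃.nat aP, ← hf₃.real rRad] at hrad
  refine (searchKeys_spec (hready.frame hf₃) hm hb₃ hrad).mono le_rfl ?_
  rintro s₄ hf₄ ⟨hb₄, hhi, hfail⟩
  refine ⟨(hready.frame hf₃).frame hf₄, hb₄, ?_⟩
  rw [passes_frame hf₄, passes_frame hf₃] at hfail
  exact opt_le_of_not_rich hsample hb₄.nonneg hb₄.lt (hhi.trans htop) hfail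

/-- The threshold `rLo` is zero or can be reached, and bounds the optimum, unless the latter is
infinite because of a total quota of at most one. -/
structure GoodThreshold (I : Instance n m) (s : Store) : Prop where
  nonneg : 0 ≤ s.real rLo 0
  reached : 0 < s.real rLo 0 → Ready I s ∧ Passes I s (s.real rLo 0)
  opt_le : I.k ≤ 1 ∨ I.opt ≤ ENNReal.ofReal ((3 * m - 1) * s.real rLo 0)

/-- Compute a good threshold. -/
def chooseThreshold : Prog := .ite (.nlt (.lit 1) (.var aK)) optimize .skip

theorem chooseThreshold_spec (hk : s.nat aK 0 = I.k) (hslot : IsSlots m I.k I.quo (s.nat aSlot))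
    (hlo : s.real rLo 0 = 0) :
    Does I chooseThreshold s (optimizeTime I + 2) (GoodThreshold I) := by
  refine Does.ite (T := optimizeTime I + 1) (fun hk1 => ?_) fun hk1 => ?_
  · rw [BExp.holds_nlt, NExp.eval_get, NExp.eval_lit, NExp.eval_lit, hk] at hk1
    refine (optimize_spec hk hslot hk1).mono (by omega) ?_
    rintro s' - ⟨hready, hb, hopt⟩
    exact ⟨hb.nonneg, fun hpos => ⟨hready, hb.pass.resolve_left hpos.ne'⟩, Or.inr hopt⟩
  · rw [BExp.holds_nlt, NExp.eval_get, NExp.eval_lit, NExp.eval_lit, hk] at hk1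
    exact Does.of_wp (p := .skip) ⟨hlo.ge, fun hpos => absurd hlo hpos.ne', Or.inl (not_lt.1 hk1)⟩
      (by simp [Prog.cost])

/-- Write a fair set of diversity at least `rLo`. -/
def solve : Prog := .block [.rass rT (.var rLo), test, writeOut]

theorem solve_spec (h : Ready I s) (hpos : 0 < s.real rLo 0) (hpass : Passes I s (s.real rLo 0))
    (h0 : ∀ u, s.nat 0 u = 0) :
    Does I solve s (1 + (100 * (I.k * m + 1) * (I.k * m + 1) + (5 * (I.k * m) + 2))) fun s' =>
      I.IsFair (s'.output n) ∧ ENNReal.ofReal (s.real rLo 0) ≤ I.div (s'.output n) := by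
  refine (Does.rass rT (.var rLo)).seq fun s₁ hf₁ h₁ => ?_
  have hT : s₁.real rT 0 = s.real rLo 0 := by simp [h₁]
  have h₁ : Ready I s₁ := h.frame hf₁
  rw [← passes_frame hf₁, ← hT] at hpass
  rw [← hT] at hpos ⊢
  refine (test_spec h₁).seq ?_
  rintro s₂ hf₂ ⟨hM, hc, hmatch⟩
  have hsol := hc.solves hmatch ((passes_of_test hc hmatch (hf₂.nat aPt)).1 hpass)
  have h0₂ : ∀ u, s₂.nat 0 u = 0 := fun u => by rw [hf₂.nat 0, hf₁.nat 0, h0]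
  have hM' : s₂.nat aM 0 ≤ I.k * m := hM.trans h₁.card_le
  refine (writeOut_spec h0₂).mono (by omega) fun s₃ _ hout => ?_
  have hmem : ∀ u : Fin n, u ∈ s₃.output n ↔
      ∃ p ∈ representatives (s₂.nat aM 0) (s₂.nat aY) (s₂.nat aOwn), s₂.nat aPt p = u :=
    fun u => by rw [← hout u]; simp [Store.output]
  refine ⟨hsol.isFair hpos hc.pt_lt hmem, ofReal_le_div_iff.2 fun u hu v hv huv => ?_⟩
  obtain ⟨p, hp, hpu⟩ := (hmem u).1 hu
  obtain ⟨q, hq, hqv⟩ := (hmem v).1 hv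
  have hpq : p ≠ q := by
    rintro rfl
    exact huv (Fin.ext (hpu.symm.trans hqv))
  rw [← I.d_coe, ← hpu, ← hqv]
  exact hsol.le_dist (isPseudoDist_ptDist hc.pt_lt).comm hp hq hpq

/-- Write a fair set of diversity at least `rLo`, or any fair set if `rLo` is zero. -/
def output : Prog := .ite (.rlt (.ofNat (.lit 0)) (.var rLo)) solve fallback

/-- Time bound for the output. -/
def outputTime (I : Instance n m) : ℕ :=
  (1 + (100 * (I.k * m + 1) * (I.k * m + 1) + (5 * (I.k * m) + 2))) + (6 * n + 2) + 1

theorem output_spec (hq : ∀ i, I.quota i ≤ (I.group i).card) (h : GoodThreshold I s)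
    (h0 : ∀ u, s.nat 0 u = 0) (hcnt : ∀ c, s.nat aCnt c = 0) :
    Does I output s (outputTime I) fun s' =>
      I.IsFair (s'.output n) ∧ ENNReal.ofReal (s.real rLo 0) ≤ I.div (s'.output n) := by
  refine Does.ite (fun hpos => ?_) fun hpos => ?_
  · replace hpos : 0 < s.real rLo 0 := by simpa using hpos
    obtain ⟨hready, hpass⟩ := h.reached hpos
    exact (solve_spec hready hpos hpass h0).le (by omega)
  · replace hpos : s.real rLo 0 ≤ 0 := by simpa using hpos
    refine (fallback_spec h0 hcnt hq).mono (by omega) fun s' _ hfair => ⟨hfair, ?_⟩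
    rw [ENNReal.ofReal_of_nonpos hpos]
    exact bot_le

/-- The approximation algorithm. -/
def fairFlow : Prog := .block [setup, chooseThreshold, output]

/-- Time bound for the algorithm. -/
def fairFlowTime (I : Instance n m) : ℕ :=
  4 * (I.k * m + m + 1) + ((optimizeTime I + 2) + outputTime I)

theorem fairFlow_spec (hq : ∀ i, I.quota i ≤ (I.group i).card) :
    Does I fairFlow Store.init (fairFlowTime I) fun s =>
      I.IsFair (s.output n) ∧ I.opt / (3 * (m : ℝ≥0∞) - 1) ≤ I.div (s.output n) := by
  refine (setup_spec rfl).seq ?_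
  rintro s₁ hf₁ ⟨hk, hslot⟩
  refine (chooseThreshold_spec hk hslot (by rw [hf₁.real rLo]; rfl)).seq fun s₂ hf₂ h₂ => ?_
  refine (output_spec hq h₂ (fun u => by rw [hf₂.nat 0, hf₁.nat 0]; rfl)
    (fun c => by rw [hf₂.nat aCnt, hf₁.nat aCnt]; rfl)).mono le_rfl ?_
  exact fun s₃ _ ⟨hfair, hdiv⟩ => ⟨hfair, opt_div_le_div hfair h₂.nonneg h₂.opt_le hdiv⟩

end Main

/-! ### Running time -/

section Time

theorem size_le_three_mul_log {x : ℕ} (hx : 2 ≤ x) : (x.size : ℝ) ≤ 3 * Real.log x := by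
  have hsize : 0 < x.size := Nat.size_pos.2 (by omega)
  have hpow : (2 : ℝ) ^ (x.size - 1) ≤ x := by
    exact_mod_cast Nat.lt_size.1 (Nat.sub_lt hsize one_pos)
  have hlog := Real.log_le_log (by positivity) hpow
  rw [Real.log_pow, Nat.cast_sub hsize, Nat.cast_one] at hlog
  have hlog2 : Real.log 2 ≤ Real.log x := Real.log_le_log two_pos (by exact_mod_cast hx)
  nlinarith [Real.log_two_gt_d9]

theorem fairFlowTime_le {n m : ℕ} (I : Instance n m) (hk : 1 ≤ I.k) (hm : 1 ≤ m) (hn : 1 ≤ n) :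
    fairFlowTime I ≤ 5000 * (I.k * n + (I.k * m).size * (I.k * m * (I.k * m))) := by
  have hkX : I.k ≤ I.k * m := Nat.le_mul_of_pos_right _ hm
  have hmX : m ≤ I.k * m := Nat.le_mul_of_pos_left _ hk
  have hnA : n ≤ I.k * n := Nat.le_mul_of_pos_left _ hk
  have hsample : 20 * (I.k + 1) * (n + m + 1) ≤ 40 * (I.k * n) + 40 * (I.k * m) + 40 * I.k := by
    nlinarith
  unfold fairFlowTime optimizeTime outputTime searchTime
  generalize I.k * m = X at *
  generalize I.k * n = A at *
  have hX : 1 ≤ X := hm.trans hmX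
  have hL : 1 ≤ X.size := Nat.size_pos.2 hX
  generalize X.size = L at *
  have hX2 : X ≤ X * X := Nat.le_mul_of_pos_left _ hX
  have hLX2 : X * X ≤ L * (X * X) := Nat.le_mul_of_pos_left _ hL
  have hsquare : (X + 1) * (X + 1) ≤ 4 * (X * X) := by nlinarith
  have htest : 100 * (X + 1) * (X + 1) ≤ 400 * (X * X) := by
    rw [mul_assoc]
    omega
  have hsearch : 130 * (L + 2) * ((X + 1) * (X + 1)) ≤ 1560 * (L * (X * X)) :=
    calc 130 * (L + 2) * ((X + 1) * (X + 1)) ≤ 130 * (3 * L) * (4 * (X * X)) := by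
          gcongr
          omega
      _ = 1560 * (L * (X * X)) := by ring
  omega

theorem le_mul_log_of_le_mul_size {k n m t C : ℕ} (hk : 1 ≤ k) (hm : 1 ≤ m) (hn : 1 ≤ n)
    (ht : t ≤ C * (k * n + (k * m).size * (k * m * (k * m)))) :
    (t : ℝ) ≤ 3 * C * ((k : ℝ) * n + (k : ℝ) ^ 2 * (m : ℝ) ^ 2 * Real.log ((k : ℝ) * m)) := by
  have ht' : (t : ℝ) ≤ C * (k * n + (k * m).size * (k * m * (k * m))) := by exact_mod_cast ht
  have hkn : (1 : ℝ) ≤ k * n := by exact_mod_cast Nat.mul_pos hk hn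
  suffices h : (k : ℝ) * n + (k * m).size * (k * m * (k * m)) ≤
      3 * (k * n + k ^ 2 * m ^ 2 * Real.log (k * m)) by
    nlinarith [mul_le_mul_of_nonneg_left h C.cast_nonneg]
  rcases Nat.eq_or_lt_of_le (Nat.mul_pos hk hm) with hkm | hkm
  · -- The logarithm vanishes, and the first term pays for the second.
    have hkm' : (k : ℝ) * m = 1 := by exact_mod_cast hkm.symm
    rw [← hkm, hkm', Nat.size_one, Real.log_one, Nat.cast_one]
    linarith
  · have hlog := size_le_three_mul_log hkm
    rw [Nat.cast_mul] at hlog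
    have hX2 : (0 : ℝ) ≤ k * m * (k * m) := by positivity
    nlinarith [mul_le_mul_of_nonneg_right hlog hX2]

end Time

end FairDiv

theorem mainTheorem1 :
    ∃ (prog : FairDiv.Prog) (C : ℝ), ∀ (n m : ℕ) (I : FairDiv.Instance n m),
      (∀ i, I.quota i ≤ (I.group i).card) →
      ∃ (s : FairDiv.Store) (t : ℕ),
        FairDiv.Runs I prog FairDiv.Store.init s t ∧
        I.IsFair (s.output n) ∧
        I.opt / (3 * (m : ENNReal) - 1) ≤ I.div (s.output n) ∧
        (0 < I.k →
          (t : ℝ) ≤ C * ((I.k : ℝ) * n +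
            (I.k : ℝ) ^ 2 * (m : ℝ) ^ 2 * Real.log ((I.k : ℝ) * m))) := by
  refine ⟨FairDiv.fairFlow, 3 * (5000 : ℕ), fun n m I hq => ?_⟩
  obtain ⟨s, t, hrun, ht, hfair, hdiv⟩ := FairDiv.fairFlow_spec hq
  refine ⟨s, t, hrun, hfair, hdiv, fun hk => ?_⟩
  have hn : 1 ≤ n :=
    calc 1 ≤ I.k := hk
      _ = (s.output n).card := (FairDiv.card_eq_k_of_isFair hfair).symm
      _ ≤ n := by simpa using Finset.card_le_univ (s.output n)
  have hm : 1 ≤ m := (Nat.zero_le _).trans_lt (I.col_lt hn)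
  exact FairDiv.le_mul_log_of_le_mul_size hk hm hn (ht.trans (FairDiv.fairFlowTime_le I hk hm hn))
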